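/- Let $M$ be a smooth manifold and let $A\hookrightarrow L$ be a Lie pair over $M$, that is, $L$ is a (real, finite rank) Lie algebroid over $M$ and $A$ is a Lie subalgebroid of $L$ over the same base; write $A^\circ\cong (L/A)^*$, and let $\nabla^{\mathrm{Bott}}_a[\ell]=[[a,\ell]]$ be the Bott connection of $A$ on $L/A$. Let $E=\bigoplus_{-n\le i\le 0}E_i$ be a non-positively graded vector bundle over $M$ of finite rank, equipped with a representation up to homotopy of $A$: a flat superconnection $D_A=\partial+d^{\nabla}+\sum_{k\ge2}\omega_A^{(k)}$, where $\partial$ is an endomorphism of $E$ of degree $1$, $\nabla$ is a degree preserving $A$-connection on $E$, $\omega_A^{(k)}\in\Omega^k(A,\mathrm{End}_{1-k}(E))$, and $D_A^2=0$. Assume that $\partial$ has constant rank and that the cohomology of the complex of vector bundles $(E,\partial)$ vanishes outside degree $0$; let $K=\mathcal H^0(E,\partial)$ be the degree $0$ cohomology, a vector bundle on which $\nabla$ induces a flat $A$-connection $\nabla^K$. *The two complexes.* Let $\widehat\Omega(E)=\Omega(A,A^\circ\otimes\mathrm{End}(E))$, graded by total degree (form degree on $A$ plus degree of endomorphism), with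 the differential $s$ given by the exterior covariant derivative of the $A$-connection on $A^\circ\otimes \mathrm{End}(E)$ induced by $\nabla^{\mathrm{Bott}}$ and $\nabla$, plus the graded commutator with $\partial$ and the $\omega_A^{(k)}$; let $\widehat H^\bullet(E,s)$ be its cohomology. Let $H^\bullet(A,A^\circ\otimes\mathrm{End}(K))$ be the cohomology of $A$ with values in $A^\circ\otimes\mathrm{End}(K)$, with the flat $A$-connection induced by $\nabla^{\mathrm{Bott}}$ and $\nabla^K$. *The two classes.* Let $D_L=\partial+d^{\nabla_L}+\sum_{k\ge2}\omega_L^{(k)}$ be any $L$-superconnection on $E$ extending $D_A$ (it restricts to $D_A$ on arguments in $A$). Its Atiyah cocycle is $\alpha_E=\sum_k\alpha^{(k)}$, $\alpha^{(k)}\in\Omega^k(A,A^\circ\otimes\mathrm{End}_{1-k}(E))$, where $$\alpha^{(k)}(a_1,\dots,a_k;[\ell])=\big(D_L^2\big)^{(k+1)}(a_1,\dots,a_k,\ell),$$ the superscript denoting the component of form degree $k+1$. Let $\widetilde\nabla$ be any $L$-connection on $K$ extending $\nabla^K$. Its Atiyah cocycle is $\mathrm{at}_K\in\Omega^1(A,A^\circ\otimes\mathrm{End}(K))$,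 $\mathrm{at}_K(a;[\ell])=R_{\widetilde\nabla}(a,\ell)$, where $R_{\widetilde\nabla}$ is the curvature. Then $\alpha_E$ is an $s$-cocycle of total degree $1$, $\mathrm{at}_K$ is a cocycle, and $$[\alpha_E]=0\ \text{ in }\ \widehat H^1(E,s)\quad\Longleftrightarrow\quad[\mathrm{at}_K]=0\ \text{ in }\ H^1\big(A,A^\circ\otimes\mathrm{End}(K)\big).$$ -/

import Mathlib

open scoped DirectSum Manifold ContDiff
open Bundle

set_option linter.unusedSectionVars false
set_option linter.unusedVariables false

noncomputable section

namespace LiePairAtiyah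

section Wedge

variable {R P N₁ N₂ N₃ : Type*} [CommRing R] [AddCommGroup P] [Module R P]
  [AddCommGroup N₁] [Module R N₁] [AddCommGroup N₂] [Module R N₂] [AddCommGroup N₃] [Module R N₃]

/-- The wedge product of alternating forms with respect to a bilinear pairing `B` of the values:
the sum over all `(k, l)`-shuffles `σ` of
`sign σ • B (f (v_σ(1), …, v_σ(k))) (g (v_σ(k+1), …, v_σ(k+l)))`. -/
def wedge (B : N₁ →ₗ[R] N₂ →ₗ[R] N₃) {k l n : ℕ} (h : k + l = n)
    (f : P [⋀^Fin k]→ₗ[R] N₁) (g : P [⋀^Fin l]→ₗ[R] N₂) : P [⋀^Fin n]→ₗ[R] N₃ :=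
  ((TensorProduct.lift B).compAlternatingMap (f.domCoprod g)).domDomCongr
    (finSumFinEquiv.trans (finCongr h))

theorem wedge_apply (B : N₁ →ₗ[R] N₂ →ₗ[R] N₃) {k l n : ℕ} (h : k + l = n)
    (f : P [⋀^Fin k]→ₗ[R] N₁) (g : P [⋀^Fin l]→ₗ[R] N₂) (v : Fin n → P) :
    wedge B h f g v = TensorProduct.lift B
      (f.domCoprod g fun i => v (finCongr h (finSumFinEquiv i))) := rfl

theorem wedge_add_right (B : N₁ →ₗ[R] N₂ →ₗ[R] N₃) {k l n : ℕ} (h : k + l = n)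
    (f : P [⋀^Fin k]→ₗ[R] N₁) (g g' : P [⋀^Fin l]→ₗ[R] N₂) :
    wedge B h f (g + g') = wedge B h f g + wedge B h f g' := by
  ext v
  simp only [wedge_apply, AlternatingMap.add_apply, ← AlternatingMap.domCoprod'_apply,
    TensorProduct.tmul_add, map_add]

theorem wedge_add_left (B : N₁ →ₗ[R] N₂ →ₗ[R] N₃) {k l n : ℕ} (h : k + l = n)
    (f f' : P [⋀^Fin k]→ₗ[R] N₁) (g : P [⋀^Fin l]→ₗ[R] N₂) :
    wedge B h (f + f') g = wedge B h f g + wedge B h f' g := by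
  ext v
  simp only [wedge_apply, AlternatingMap.add_apply, ← AlternatingMap.domCoprod'_apply,
    TensorProduct.add_tmul, map_add]

theorem wedge_smul_right [Algebra ℝ R] [Module ℝ N₂] [IsScalarTower ℝ R N₂]
    [Module ℝ N₃] [IsScalarTower ℝ R N₃] (B : N₁ →ₗ[R] N₂ →ₗ[R] N₃) {k l n : ℕ} (h : k + l = n) (c : ℝ)
    (f : P [⋀^Fin k]→ₗ[R] N₁) (g : P [⋀^Fin l]→ₗ[R] N₂) :
    wedge B h f (c • g) = c • wedge B h f g := by
  ext v
  have e : c • g = algebraMap ℝ R c • g := by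
    ext
    simp [algebraMap_smul]
  rw [e, AlternatingMap.smul_apply, ← algebraMap_smul R c]
  simp only [wedge_apply, ← AlternatingMap.domCoprod'_apply,
    TensorProduct.tmul_smul, map_smul, AlternatingMap.smul_apply]

theorem wedge_smul_left [Algebra ℝ R] [Module ℝ N₁] [IsScalarTower ℝ R N₁]
    [Module ℝ N₃] [IsScalarTower ℝ R N₃] (B : N₁ →ₗ[R] N₂ →ₗ[R] N₃) {k l n : ℕ} (h : k + l = n) (c : ℝ)
    (f : P [⋀^Fin k]→ₗ[R] N₁) (g : P [⋀^Fin l]→ₗ[R] N₂) :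
    wedge B h (c • f) g = c • wedge B h f g := by
  ext v
  have e : c • f = algebraMap ℝ R c • f := by
    ext
    simp [algebraMap_smul]
  rw [e, AlternatingMap.smul_apply, ← algebraMap_smul R c]
  simp only [wedge_apply, ← AlternatingMap.domCoprod'_apply,
    ← TensorProduct.smul_tmul', map_smul, AlternatingMap.smul_apply]

theorem wedge_zero_left (B : N₁ →ₗ[R] N₂ →ₗ[R] N₃) {k l n : ℕ} (h : k + l = n)
    (g : P [⋀^Fin l]→ₗ[R] N₂) : wedge B h (0 : P [⋀^Fin k]→ₗ[R] N₁) g = 0 := by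
  have := wedge_add_left B h (0 : P [⋀^Fin k]→ₗ[R] N₁) 0 g
  simpa using this

theorem wedge_zero_right (B : N₁ →ₗ[R] N₂ →ₗ[R] N₃) {k l n : ℕ} (h : k + l = n)
    (f : P [⋀^Fin k]→ₗ[R] N₁) : wedge B h f (0 : P [⋀^Fin l]→ₗ[R] N₂) = 0 := by
  have := wedge_add_right B h f (0 : P [⋀^Fin l]→ₗ[R] N₂) 0
  simpa using this

/-- Evaluation of alternating maps. -/
def evalHom {n : ℕ} (v : Fin n → P) : (P [⋀^Fin n]→ₗ[R] N₁) →+ N₁ where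
  toFun f := f v
  map_zero' := rfl
  map_add' _ _ := rfl

theorem wedge_mem (B : N₁ →ₗ[R] N₂ →ₗ[R] N₃) {k l n : ℕ} (h : k + l = n)
    (f : P [⋀^Fin k]→ₗ[R] N₁) (g : P [⋀^Fin l]→ₗ[R] N₂) (S : Submodule R N₃)
    (hS : ∀ v w, B (f v) (g w) ∈ S) (v : Fin n → P) : wedge B h f g v ∈ S := by
  rw [wedge_apply]
  simp only [AlternatingMap.domCoprod_apply, sum_apply, map_sum]
  refine Submodule.sum_mem _ fun σ _ => ?_
  induction σ using Quotient.inductionOn' with | _ σ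
  rw [AlternatingMap.domCoprod.summand_mk'']
  have e : ((Equiv.Perm.sign σ • (MultilinearMap.domCoprod (f : MultilinearMap R (fun _ => P) N₁)
        (g : MultilinearMap R (fun _ => P) N₂)).domDomCongr σ) fun i =>
          v (finCongr h (finSumFinEquiv i)))
      = (Equiv.Perm.sign σ : ℤ) • ((f fun i => v (finCongr h (finSumFinEquiv (σ (Sum.inl i))))) ⊗ₜ[R]
          (g fun i => v (finCongr h (finSumFinEquiv (σ (Sum.inr i)))))) := rfl
  rw [e, map_zsmul, TensorProduct.lift.tmul]
  exact zsmul_mem (hS _ _) _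

theorem wedge_comp {P' : Type*} [AddCommGroup P'] [Module R P'] (i : P' →ₗ[R] P)
    (B : N₁ →ₗ[R] N₂ →ₗ[R] N₃) {k l n : ℕ} (h : k + l = n)
    (f : P [⋀^Fin k]→ₗ[R] N₁) (g : P [⋀^Fin l]→ₗ[R] N₂) (v : Fin n → P') :
    wedge B h f g (fun j => i (v j))
      = wedge B h (f.compLinearMap i) (g.compLinearMap i) v := by
  rw [wedge_apply, wedge_apply]
  congr 1
  simp only [AlternatingMap.domCoprod_apply, sum_apply]
  refine Finset.sum_congr rfl fun σ _ => ?_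
  induction σ using Quotient.inductionOn' with | _ σ
  rfl

end Wedge

section Quotients

variable {R N : Type*} [CommRing R] [Algebra ℝ R]
  [AddCommGroup N] [Module R N] [Module ℝ N] [IsScalarTower ℝ R N]

/-- The map induced on a quotient. -/
def quotientMap (S : Submodule R N) (f : N →ₗ[ℝ] N) (hf : ∀ x ∈ S, f x ∈ S) :
    (N ⧸ S) →ₗ[ℝ] (N ⧸ S) where
  toFun := Quotient.map' f fun x y h => by
    rw [Submodule.quotientRel_def] at h ⊢
    rw [← map_sub]
    exact hf _ h
  map_add' x y := by
    obtain ⟨x, rfl⟩ := Submodule.Quotient.mk_surjective _ x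
    obtain ⟨y, rfl⟩ := Submodule.Quotient.mk_surjective _ y
    exact congrArg (Submodule.Quotient.mk (p := S)) (map_add f x y)
  map_smul' c x := by
    obtain ⟨x, rfl⟩ := Submodule.Quotient.mk_surjective _ x
    exact congrArg (Submodule.Quotient.mk (p := S)) (map_smul f c x)

theorem quotientMap_mk (S : Submodule R N) (f : N →ₗ[ℝ] N) (hf : ∀ x ∈ S, f x ∈ S) (x : N) :
    quotientMap S f hf (Submodule.Quotient.mk x) = Submodule.Quotient.mk (f x) := rfl

end Quotients

section Connections

variable {R P N N₁ N₂ N₃ : Type*} [CommRing R] [Algebra ℝ R]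
  [LieRing P] [Module R P] [LieRingModule P R] [LieAlgebra ℝ P]
  [LieRinehartRing R P] [LieRinehartAlgebra ℝ R P]
  [AddCommGroup N] [Module R N] [Module ℝ N] [IsScalarTower ℝ R N]
  [AddCommGroup N₁] [Module R N₁] [Module ℝ N₁] [IsScalarTower ℝ R N₁]
  [AddCommGroup N₂] [Module R N₂] [Module ℝ N₂] [IsScalarTower ℝ R N₂]
  [AddCommGroup N₃] [Module R N₃] [Module ℝ N₃] [IsScalarTower ℝ R N₃]

variable (R P N) in
/-- A linear `P`-connection on the `R`-module `N` (the sections of a vector bundle), for a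
Lie-Rinehart algebra `P` (the sections of a Lie algebroid): `∇_{f a} e = f ∇_a e` and
`∇_a (f e) = f ∇_a e + ρ(a)(f) e`, where `ρ(a)(f)` is written `⁅a, f⁆`. -/
structure Connection where
  toFun : P →ₗ[R] N →ₗ[ℝ] N
  leibniz : ∀ (a : P) (f : R) (e : N), toFun a (f • e) = f • toFun a e + ⁅a, f⁆ • e

instance : CoeFun (Connection R P N) (fun _ => P → N →ₗ[ℝ] N) := ⟨fun D => D.toFun⟩

variable (R P N) in
/-- `N`-valued differential forms on `P`, as families of forms of all degrees. -/
abbrev Forms : Type _ := ∀ n : ℕ, P [⋀^Fin n]→ₗ[R] N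

namespace Connection

/-- The operator `u ↦ ∑ⱼ u (v₁, …, ⁅a, vⱼ⁆, …, vₙ)`. -/
def lieAux {n : ℕ} (u : P [⋀^Fin n]→ₗ[R] N) (a : P) : P [⋀^Fin n]→ₗ[ℝ] N where
  toFun v := ∑ j, u (Function.update v j ⁅a, v j⁆)
  map_update_add' := by
    intro inst v i x y
    obtain rfl := Subsingleton.elim inst (instDecidableEqFin n)
    rw [← Finset.sum_add_distrib]
    refine Finset.sum_congr rfl fun j _ => ?_
    by_cases h : j = i
    · subst h
      simp
    · simp only [Function.update_comm (Ne.symm h), Function.update_of_ne h]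
      exact u.map_update_add _ _ _ _
  map_update_smul' := by
    intro inst v i c x
    obtain rfl := Subsingleton.elim inst (instDecidableEqFin n)
    rw [Finset.smul_sum]
    refine Finset.sum_congr rfl fun j _ => ?_
    by_cases h : j = i
    · subst h
      simp only [Function.update_idem, Function.update_self, lie_smul]
      rw [← algebraMap_smul R c ⁅a, x⁆, u.map_update_smul, algebraMap_smul]
    · simp only [Function.update_comm (Ne.symm h), Function.update_of_ne h]
      rw [← algebraMap_smul R c x, u.map_update_smul, algebraMap_smul]
  map_eq_zero_of_eq' v i j hv hij := by
    classical
    rw [Fintype.sum_eq_add i j hij]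
    · have h1 : Function.update v j ⁅a, v j⁆
          = Function.update v i ⁅a, v i⁆ ∘ Equiv.swap i j := by
        ext k
        by_cases hk : k = i
        · subst hk
          rw [Function.comp_apply, Equiv.swap_apply_left, Function.update_of_ne hij,
            Function.update_of_ne hij.symm, hv]
        · by_cases hk' : k = j
          · subst hk'; simp [hv]
          · simp [Equiv.swap_apply_of_ne_of_ne hk hk', hk, hk']
      rw [h1, u.map_swap _ hij, add_neg_cancel]
    · rintro k ⟨hki, hkj⟩
      exact u.map_eq_zero_of_eq _ (by simp [Ne.symm hki, Ne.symm hkj, hv]) hij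

/-- An auxiliary operator, whose alternatization is the exterior covariant derivative. -/
def dAux (D : Connection R P N) {n : ℕ} (u : P [⋀^Fin n]→ₗ[R] N) :
    P →ₗ[ℝ] P [⋀^Fin n]→ₗ[ℝ] N where
  toFun a :=
    (D a).compAlternatingMap
      { u.toMultilinearMap.restrictScalars ℝ with
        map_eq_zero_of_eq' := u.map_eq_zero_of_eq' } - (2⁻¹ : ℝ) • lieAux u a
  map_add' a b := by
    ext v
    simp [lieAux, Finset.sum_add_distrib]
    module
  map_smul' c a := by
    ext v
    have : ∀ j, u (Function.update v j (c • ⁅a, v j⁆)) = c • u (Function.update v j ⁅a, v j⁆) := by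
      intro j
      rw [← algebraMap_smul R c ⁅a, v j⁆, u.map_update_smul, algebraMap_smul]
    have h2 : D.toFun (c • a) = c • D.toFun a := by
      rw [← algebraMap_smul R c a, map_smul, algebraMap_smul]
    simp [lieAux, this, h2, ← Finset.smul_sum]
    module

theorem dAux_apply (D : Connection R P N) {n : ℕ} (u : P [⋀^Fin n]→ₗ[R] N) (a : P)
    (v : Fin n → P) :
    dAux D u a v = D a (u v) - (2⁻¹ : ℝ) • ∑ j, u (Function.update v j ⁅a, v j⁆) := rfl

/-- The exterior covariant derivative, as an `ℝ`-multilinear map. -/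
def dReal (D : Connection R P N) {n : ℕ} (u : P [⋀^Fin n]→ₗ[R] N) :
    P [⋀^Fin (n + 1)]→ₗ[ℝ] N :=
  AlternatingMap.alternatizeUncurryFin (dAux D u)

theorem dReal_cons_smul (D : Connection R P N) {n : ℕ} (u : P [⋀^Fin n]→ₗ[R] N) (c : R) (x : P)
    (w : Fin n → P) :
    dReal D u (Fin.cons (c • x) w) = c • dReal D u (Fin.cons x w) := by
  have hlie : ∀ y : P, ⁅c • x, y⁆ = c • ⁅x, y⁆ - ⁅y, c⁆ • x := by
    intro y
    rw [← lie_skew, LieRinehartRing.leibniz_smul_right, ← lie_skew y x, smul_neg]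
    abel
  have h0 : dAux D u (c • x) w
      = c • dAux D u x w + (2⁻¹ : ℝ) • ∑ j, ⁅w j, c⁆ • u (Function.update w j x) := by
    simp only [dAux_apply, hlie, map_smul, LinearMap.smul_apply, AlternatingMap.map_update_sub,
      AlternatingMap.map_update_smul, Finset.sum_sub_distrib, smul_sub, ← Finset.smul_sum]
    rw [smul_comm c (2⁻¹ : ℝ)]
    abel
  cases n with
  | zero =>
    simp only [dReal, AlternatingMap.alternatizeUncurryFin_apply]
    simpa [Fin.removeNth_zero] using h0
  | succ m =>
    have hrem : ∀ (y : P) (i : Fin (m + 1)), Fin.removeNth i.succ (Fin.cons y w : Fin (m + 2) → P)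
        = Fin.cons y (Fin.removeNth i w) := by
      intro y i
      ext j
      refine Fin.cases ?_ (fun j => ?_) j <;> simp [Fin.removeNth]
    have h1 : ∀ i, dAux D u (w i) (Fin.cons (c • x) (Fin.removeNth i w))
        = c • dAux D u (w i) (Fin.cons x (Fin.removeNth i w))
          + (2⁻¹ : ℝ) • ⁅w i, c⁆ • u (Fin.cons x (Fin.removeNth i w)) := by
      intro i
      have hc : ∀ (r : R) (w' : Fin m → P), u (Fin.cons (r • x) w') = r • u (Fin.cons x w') :=
        fun r w' => by simpa using u.map_update_smul (Fin.cons x w') 0 r x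
      have hc' : ∀ (y : P) (w' : Fin m → P), u (Fin.cons (c • y) w') = c • u (Fin.cons y w') :=
        fun y w' => by simpa using u.map_update_smul (Fin.cons y w') 0 c y
      have hadd : ∀ (y z : P) (w' : Fin m → P) ,
          u (Fin.cons (y + z) w') = u (Fin.cons y w') + u (Fin.cons z w') :=
        fun y z w' => by simpa using u.map_update_add (Fin.cons y w') 0 y z
      simp only [dAux_apply, Fin.sum_univ_succ, Fin.cons_zero, Fin.cons_succ, Fin.update_cons_zero,
        ← Fin.cons_update, hc', hc, D.leibniz, LieRinehartRing.leibniz_smul_right, hadd,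
        ← Finset.smul_sum, smul_add, smul_sub]
      simp only [smul_comm c (2⁻¹ : ℝ)]
      generalize ⁅w i, c⁆ • u (Fin.cons x (Fin.removeNth i w)) = X
      have hX : X = (2⁻¹ : ℝ) • X + (2⁻¹ : ℝ) • X := by module
      nth_rewrite 1 [hX]
      abel
    have h2 : ∀ i, u (Function.update w i x)
        = (-1) ^ (i : ℕ) • u (Fin.cons x (Fin.removeNth i w)) := by
      intro i
      have := u.map_insertNth i x (Fin.removeNth i w)
      rwa [Fin.insertNth_removeNth] at this
    have e : ∀ y, dReal D u (Fin.cons y w) = dAux D u y w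
        + ∑ i : Fin (m + 1), -((-1 : ℤ) ^ (i : ℕ) • dAux D u (w i)
            (Fin.cons y (Fin.removeNth i w))) := by
      intro y
      simp only [dReal, AlternatingMap.alternatizeUncurryFin_apply]
      rw [Fin.sum_univ_succ]
      congr 1
      · simp
      · refine Finset.sum_congr rfl fun i _ => ?_
        rw [hrem, Fin.cons_succ, Fin.val_succ, pow_succ, mul_neg_one, neg_smul]
    rw [e, e, h0, smul_add, add_assoc, add_right_inj, Finset.smul_sum, Finset.smul_sum,
      ← Finset.sum_add_distrib]
    refine Finset.sum_congr rfl fun i _ => ?_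
    rw [h1, h2, smul_add, smul_neg, smul_comm c ((-1 : ℤ) ^ (i : ℕ)),
      smul_comm ⁅w i, c⁆ ((-1 : ℤ) ^ (i : ℕ)), smul_comm (2⁻¹ : ℝ) ((-1 : ℤ) ^ (i : ℕ))]
    abel

/-- The exterior covariant derivative
`(d u)(v₀, …, vₙ) = ∑ᵢ (-1)ⁱ ∇_{vᵢ} (u (v₀, …, v̂ᵢ, …, vₙ))
  + ∑_{i < j} (-1)^(i+j) u (⁅vᵢ, vⱼ⁆, v₀, …, v̂ᵢ, …, v̂ⱼ, …, vₙ)`.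
In the second sum the bracket is inserted here in the slot of the second of its two arguments,
and the sum runs over ordered pairs, so that every unordered pair occurs twice. -/
def d (D : Connection R P N) {n : ℕ} (u : P [⋀^Fin n]→ₗ[R] N) : P [⋀^Fin (n + 1)]→ₗ[R] N where
  toFun v := ∑ i : Fin (n + 1), (-1 : ℤ) ^ (i : ℕ) •
    (D (v i) (u (i.removeNth v))
      - (2⁻¹ : ℝ) • ∑ j, u (Function.update (i.removeNth v) j ⁅v i, i.removeNth v j⁆))
  map_update_add' := by
    intro inst v i x y
    have := (dReal D u).map_update_add v i x y
    simpa only [dReal, AlternatingMap.alternatizeUncurryFin_apply, dAux_apply] using this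
  map_update_smul' := by
    intro inst v i c x
    obtain rfl := Subsingleton.elim inst (instDecidableEqFin _)
    suffices h : dReal D u (Function.update v i (c • x)) = c • dReal D u (Function.update v i x) by
      simpa only [dReal, AlternatingMap.alternatizeUncurryFin_apply, dAux_apply] using h
    have key : ∀ y, dReal D u (Function.update v i y)
        = (-1) ^ (i : ℕ) • dReal D u (Fin.cons y (i.removeNth v)) := by
      intro y
      have := (dReal D u).map_insertNth i y (i.removeNth v)
      rwa [Fin.insertNth_removeNth] at this
    rw [key, key, dReal_cons_smul, smul_comm]
  map_eq_zero_of_eq' v i j hv hij := by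
    have := (dReal D u).map_eq_zero_of_eq v hv hij
    simpa only [dReal, AlternatingMap.alternatizeUncurryFin_apply, dAux_apply] using this

theorem d_apply (D : Connection R P N) {n : ℕ} (u : P [⋀^Fin n]→ₗ[R] N) (v : Fin (n + 1) → P) :
    D.d u v = ∑ i : Fin (n + 1), (-1 : ℤ) ^ (i : ℕ) •
      (D (v i) (u (i.removeNth v))
        - (2⁻¹ : ℝ) • ∑ j, u (Function.update (i.removeNth v) j ⁅v i, i.removeNth v j⁆)) := rfl

/-- The exterior covariant derivative as a linear map. -/
def dLin (D : Connection R P N) (n : ℕ) :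
    (P [⋀^Fin n]→ₗ[R] N) →ₗ[ℝ] (P [⋀^Fin (n + 1)]→ₗ[R] N) where
  toFun u := D.d u
  map_add' u w := by
    ext v
    simp only [d_apply, AlternatingMap.add_apply, map_add, ← Finset.sum_add_distrib, ← smul_add]
    refine Finset.sum_congr rfl fun i _ => ?_
    rw [Finset.sum_add_distrib, smul_add]
    congr 1
    abel
  map_smul' c u := by
    ext v
    simp only [d_apply, AlternatingMap.smul_apply, map_smul, ← Finset.smul_sum, RingHom.id_apply]
    rw [Finset.smul_sum]
    refine Finset.sum_congr rfl fun i _ => ?_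
    rw [smul_comm c ((-1 : ℤ) ^ (i : ℕ)), smul_sub c, smul_comm c (2⁻¹ : ℝ)]

/-- The curvature `R(a, b) = [∇_a, ∇_b] - ∇_{[a, b]}`. -/
def curvature (D : Connection R P N) : P [⋀^Fin 2]→ₗ[R] Module.End R N where
  toFun v :=
    { toFun := fun e => D (v 0) (D (v 1) e) - D (v 1) (D (v 0) e) - D ⁅v 0, v 1⁆ e
      map_add' := fun e e' => by simp only [map_add]; abel
      map_smul' := fun f e => by
        simp only [D.leibniz, map_add, RingHom.id_apply, lie_lie, sub_smul, smul_sub]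
        abel }
  map_update_add' := by
    intro inst v i x y
    obtain rfl := Subsingleton.elim inst (instDecidableEqFin 2)
    ext e
    fin_cases i <;> simp <;> abel
  map_update_smul' := by
    intro inst v i c x
    obtain rfl := Subsingleton.elim inst (instDecidableEqFin 2)
    ext e
    have hlie : ∀ x y : P, ⁅c • x, y⁆ = c • ⁅x, y⁆ - ⁅y, c⁆ • x := by
      intro x y
      rw [← lie_skew, LieRinehartRing.leibniz_smul_right, ← lie_skew y x, smul_neg]
      abel
    fin_cases i
    · simp [hlie, D.leibniz, smul_sub]
      abel
    · simp [D.leibniz, smul_sub]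
      abel
  map_eq_zero_of_eq' v i j hv hij := by
    have h : v 0 = v 1 := by
      fin_cases i <;> fin_cases j <;> simp_all
    ext e
    simp [h]

theorem curvature_apply (D : Connection R P N) (v : Fin 2 → P) (e : N) :
    D.curvature v e = D (v 0) (D (v 1) e) - D (v 1) (D (v 0) e) - D ⁅v 0, v 1⁆ e := rfl

/-- The connection induced on `Hom(N₁, N₂)`. -/
def hom (D₁ : Connection R P N₁) (D₂ : Connection R P N₂) : Connection R P (N₁ →ₗ[R] N₂) where
  toFun :=
    { toFun := fun a =>
        { toFun := fun φ =>
            { toFun := fun e => D₂ a (φ e) - φ (D₁ a e)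
              map_add' := fun e e' => by simp only [map_add]; abel
              map_smul' := fun f e => by
                simp only [map_smul, D₁.leibniz, D₂.leibniz, map_add, RingHom.id_apply, smul_sub]
                abel }
          map_add' := fun φ ψ => by
            ext e
            simp only [LinearMap.add_apply, map_add, LinearMap.coe_mk, AddHom.coe_mk]
            abel
          map_smul' := fun c φ => by
            ext e
            simp [smul_sub] }
      map_add' := fun a b => by
        ext φ e
        simp only [map_add, LinearMap.add_apply, LinearMap.coe_mk, AddHom.coe_mk]
        abel
      map_smul' := fun f a => by
        ext φ e
        simp [smul_sub] }
  leibniz a f φ := by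
    ext e
    simp only [LinearMap.coe_mk, AddHom.coe_mk, LinearMap.smul_apply, D₂.leibniz,
      LinearMap.add_apply, smul_sub]
    abel


/-- The exterior covariant derivative on families of forms. -/
def dForms (D : Connection R P N) : Forms R P N →ₗ[ℝ] Forms R P N :=
  LinearMap.pi fun n => match n with
    | 0 => 0
    | n + 1 => D.dLin n ∘ₗ LinearMap.proj n

/-- The curvature as a family of forms, concentrated in degree `2`. -/
def curvatureForms (D : Connection R P N) : Forms R P (Module.End R N)
  | 2 => D.curvature
  | _ => 0

/-- The `n`-forms `u` with `d u = 0`. -/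
def cocycles (D : Connection R P N) (n : ℕ) : Submodule ℝ (P [⋀^Fin n]→ₗ[R] N) :=
  LinearMap.ker (D.dLin n)

/-- The exact `n`-forms. -/
def coboundaries (D : Connection R P N) : (n : ℕ) → Submodule ℝ (P [⋀^Fin n]→ₗ[R] N)
  | 0 => ⊥
  | n + 1 => LinearMap.range (D.dLin n)

/-- The cohomology of the forms with values in `N`, for a flat connection on `N`. -/
def Cohomology (D : Connection R P N) (n : ℕ) : Type _ :=
  D.cocycles n ⧸ (D.coboundaries n).submoduleOf (D.cocycles n)

instance (D : Connection R P N) (n : ℕ) : AddCommGroup (D.Cohomology n) :=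
  Submodule.Quotient.addCommGroup _

instance (D : Connection R P N) (n : ℕ) : Module ℝ (D.Cohomology n) :=
  Submodule.Quotient.module _

/-- The cohomology class of a cocycle. -/
def cohomologyClass (D : Connection R P N) (n : ℕ) : D.cocycles n →ₗ[ℝ] D.Cohomology n :=
  Submodule.mkQ _

/-- The restriction of a connection to an invariant submodule. -/
def restrict (D : Connection R P N) (Z : Submodule R N) (hZ : ∀ a, ∀ e ∈ Z, D a e ∈ Z) :
    Connection R P Z where
  toFun :=
    { toFun := fun a =>
        { toFun := fun e => ⟨D a e.1, hZ a e.1 e.2⟩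
          map_add' := fun e e' => Subtype.ext (map_add (D a) _ _)
          map_smul' := fun c e => Subtype.ext (map_smul (D a) c _) }
      map_add' := fun a b => LinearMap.ext fun e => Subtype.ext
        (LinearMap.congr_fun (map_add D.toFun a b) e.1)
      map_smul' := fun f a => LinearMap.ext fun e => Subtype.ext
        (LinearMap.congr_fun (map_smul D.toFun f a) e.1) }
  leibniz a f e := Subtype.ext (D.leibniz a f e.1)

/-- The connection induced on the quotient by an invariant submodule. -/
def quotient (D : Connection R P N) (B : Submodule R N) (hB : ∀ a, ∀ e ∈ B, D a e ∈ B) :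
    Connection R P (N ⧸ B) where
  toFun :=
    { toFun := fun a => quotientMap B (D a) (hB a)
      map_add' := fun a b => LinearMap.ext fun e => by
        obtain ⟨e, rfl⟩ := Submodule.Quotient.mk_surjective _ e
        exact congrArg (Submodule.Quotient.mk (p := B))
          (LinearMap.congr_fun (map_add D.toFun a b) e)
      map_smul' := fun f a => LinearMap.ext fun e => by
        obtain ⟨e, rfl⟩ := Submodule.Quotient.mk_surjective _ e
        exact congrArg (Submodule.Quotient.mk (p := B))
          (LinearMap.congr_fun (map_smul D.toFun f a) e) }
  leibniz a f e := by
    obtain ⟨e, rfl⟩ := Submodule.Quotient.mk_surjective _ e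
    exact congrArg (Submodule.Quotient.mk (p := B)) (D.leibniz a f e)

end Connection
end Connections

section Superconnections

variable {R : Type*} [CommRing R]

/-- The endomorphisms of degree `j` of the graded module `⨁ i, X i`. -/
def endDeg (R : Type*) [CommRing R] (X : ℤ → Type*) [∀ i, AddCommGroup (X i)]
    [∀ i, Module R (X i)] (j : ℤ) : Submodule R (Module.End R (⨁ i, X i)) where
  carrier := {φ | ∀ (i : ℤ) (e : X i),
    φ (DirectSum.lof R ℤ X i e) ∈ LinearMap.range (DirectSum.lof R ℤ X (i + j))}
  add_mem' h h' i e := Submodule.add_mem _ (h i e) (h' i e)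
  zero_mem' _ _ := Submodule.zero_mem _
  smul_mem' c _ h i e := Submodule.smul_mem _ c (h i e)

variable (R) in
/-- A superconnection `D = ∂ + d^∇ + ω^(2) + ω^(3) + ⋯` on the graded module `⨁ i, X i` (the
sections of a graded vector bundle): a connection `∇` preserving degrees, a differential
`∂ = form 0` of degree `1`, and forms `ω^(k) = form k`, `k ≥ 2`, with values in the endomorphisms
of degree `1 - k`. The component of form degree one is absorbed in the connection. -/
structure Superconnection [Algebra ℝ R] (P : Type*)
    [LieRing P] [Module R P] [LieRingModule P R] [LieAlgebra ℝ P]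
    [LieRinehartRing R P] [LieRinehartAlgebra ℝ R P]
    (X : ℤ → Type*) [∀ i, AddCommGroup (X i)] [∀ i, Module R (X i)] [∀ i, Module ℝ (X i)]
    [∀ i, IsScalarTower ℝ R (X i)] where
  conn : Connection R P (⨁ i, X i)
  conn_degree : ∀ (a : P) (i : ℤ) (e : X i),
    conn a (DirectSum.lof R ℤ X i e) ∈ LinearMap.range (DirectSum.lof R ℤ X i)
  form : Forms R P (Module.End R (⨁ i, X i))
  form_degree : ∀ (k : ℕ) (a : Fin k → P), form k a ∈ endDeg R X (1 - k)
  form_one : form 1 = 0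

variable [Algebra ℝ R] {P : Type*}
    [LieRing P] [Module R P] [LieRingModule P R] [LieAlgebra ℝ P]
    [LieRinehartRing R P] [LieRinehartAlgebra ℝ R P]
    {X : ℤ → Type*} [∀ i, AddCommGroup (X i)] [∀ i, Module R (X i)] [∀ i, Module ℝ (X i)]
    [∀ i, IsScalarTower ℝ R (X i)]

namespace Superconnection

/-- The operator `∂`. -/
def diff (D : Superconnection R P X) : Module.End R (⨁ i, X i) := D.form 0 ![]

/-- The connection induced on endomorphisms. -/
def endConn (D : Superconnection R P X) : Connection R P (Module.End R (⨁ i, X i)) :=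
  D.conn.hom D.conn

/-- The square of `∂ + ω^(2) + ω^(3) + ⋯`, with the Koszul signs: an endomorphism of degree
`1 - s` is moved past a `t`-form. -/
def formSq (D : Superconnection R P X) : Forms R P (Module.End R (⨁ i, X i)) := fun k =>
  ∑ x ∈ (Finset.HasAntidiagonal.antidiagonal k).attach,
    Int.negOnePow ((1 - (x.1.1 : ℤ)) * (x.1.2 : ℤ)) •
      wedge (LinearMap.mul R (Module.End R (⨁ i, X i)))
        (Finset.HasAntidiagonal.mem_antidiagonal.1 x.2) (D.form x.1.1) (D.form x.1.2)

/-- The components of `D²`: in form degree `k` it is the sum of `R_∇` (for `k = 2`), of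
`d^∇ ω^(k-1)`, and of all `ω^(s) ∧ ω^(t)` with `s + t = k`, where `ω^(0) = ∂`. -/
def curv (D : Superconnection R P X) : Forms R P (Module.End R (⨁ i, X i)) := fun k =>
  D.conn.curvatureForms k + D.endConn.dForms D.form k + D.formSq k

/-- `D² = 0`, so that `D` makes `⨁ i, X i` a representation up to homotopy. -/
def IsFlat (D : Superconnection R P X) : Prop := ∀ k, D.curv k = 0


section Descent

variable (D : Superconnection R P X)

theorem conn_diff (hD : D.IsFlat) (a : P) (e : ⨁ i, X i) :
    D.conn a (D.diff e) = D.diff (D.conn a e) := by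
  have h := LinearMap.congr_fun (DFunLike.congr_fun (hD 1) ![a]) e
  have h0 : D.formSq 1 = 0 := by
    refine Finset.sum_eq_zero fun x _ => ?_
    obtain ⟨⟨p, q⟩, hx⟩ := x
    have hpq := Finset.HasAntidiagonal.mem_antidiagonal.1 hx
    simp only at hpq
    have : p = 1 ∨ q = 1 := by omega
    rcases this with rfl | rfl
    · simp only [D.form_one, wedge_zero_left, smul_zero]
    · simp only [D.form_one, wedge_zero_right, smul_zero]
  rw [curv, h0] at h
  have h1 : D.conn a (D.form 0 (Fin.removeNth 0 ![a]) e)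
      - D.form 0 (Fin.removeNth 0 ![a]) (D.conn a e) = 0 := by
    simpa [Connection.curvatureForms, Connection.dForms, Connection.dLin, Connection.d_apply,
      endConn, Connection.hom] using h
  rw [Subsingleton.elim (Fin.removeNth 0 ![a]) ![]] at h1
  exact sub_eq_zero.1 h1

/-- The restriction of the connection of `D` to the component of degree `i`. -/
def connAt (i : ℤ) : Connection R P (X i) where
  toFun :=
    { toFun := fun a =>
        { toFun := fun e => DirectSum.component R ℤ X i (D.conn a (DirectSum.lof R ℤ X i e))
          map_add' := fun e e' => by simp only [map_add]
          map_smul' := fun c e => by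
            have h : DirectSum.lof R ℤ X i (c • e) = c • DirectSum.lof R ℤ X i e := by
              rw [← algebraMap_smul R c e, map_smul, algebraMap_smul]
            rw [h, map_smul, ← algebraMap_smul R c (D.conn a _), map_smul, algebraMap_smul,
              RingHom.id_apply] }
      map_add' := fun a b => by
        ext e
        simp only [map_add, LinearMap.coe_mk, AddHom.coe_mk, LinearMap.add_apply]
      map_smul' := fun f a => by
        ext e
        simp only [map_smul, LinearMap.coe_mk, AddHom.coe_mk, LinearMap.smul_apply,
          RingHom.id_apply] }
  leibniz a f e := by
    simp only [map_smul, LinearMap.coe_mk, AddHom.coe_mk, D.conn.leibniz, map_add,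
      DirectSum.component.lof_self]

theorem lof_connAt (i : ℤ) (a : P) (e : X i) :
    DirectSum.lof R ℤ X i (D.connAt i a e) = D.conn a (DirectSum.lof R ℤ X i e) := by
  obtain ⟨e', he'⟩ := D.conn_degree a i e
  have : D.connAt i a e = e' := by
    change DirectSum.component R ℤ X i (D.conn a (DirectSum.lof R ℤ X i e)) = e'
    rw [← he', DirectSum.component.lof_self]
  rw [this, he']

/-- The kernel of `∂` in degree `i`. -/
def kerAt (i : ℤ) : Submodule R (X i) := LinearMap.ker (D.diff ∘ₗ DirectSum.lof R ℤ X i)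

/-- The image of `∂` in degree `i`. -/
def imAt (i : ℤ) : Submodule R (X i) := (LinearMap.range D.diff).comap (DirectSum.lof R ℤ X i)

/-- The degree `i` cohomology of `∂`. -/
abbrev Coh (i : ℤ) : Type _ := D.kerAt i ⧸ (D.imAt i).submoduleOf (D.kerAt i)

theorem connAt_mem_kerAt (hD : D.IsFlat) (i : ℤ) (a : P) {e : X i} (he : e ∈ D.kerAt i) :
    D.connAt i a e ∈ D.kerAt i := by
  change D.diff (DirectSum.lof R ℤ X i e) = 0 at he
  change D.diff (DirectSum.lof R ℤ X i (D.connAt i a e)) = 0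
  rw [lof_connAt, ← D.conn_diff hD, he, map_zero]

theorem connAt_mem_imAt (hD : D.IsFlat) (i : ℤ) (a : P) {e : X i} (he : e ∈ D.imAt i) :
    D.connAt i a e ∈ D.imAt i := by
  obtain ⟨t, ht⟩ := he
  refine ⟨D.conn a t, ?_⟩
  rw [lof_connAt, ← ht, ← D.conn_diff hD]

/-- The connection induced by `∇` on the cohomology of `∂`. -/
def connCoh (hD : D.IsFlat) (i : ℤ) : Connection R P (D.Coh i) :=
  ((D.connAt i).restrict (D.kerAt i) fun a _ he => D.connAt_mem_kerAt hD i a he).quotient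
    ((D.imAt i).submoduleOf (D.kerAt i)) fun a e he => D.connAt_mem_imAt hD i a (e := e.1) he

theorem connCoh_mk (hD : D.IsFlat) (i : ℤ) (a : P) (e : D.kerAt i) :
    D.connCoh hD i a (Submodule.Quotient.mk e)
      = Submodule.Quotient.mk ⟨D.connAt i a e.1, D.connAt_mem_kerAt hD i a e.2⟩ := rfl

theorem connCoh_curvature (hD : D.IsFlat) (i : ℤ) : (D.connCoh hD i).curvature = 0 := by
  refine AlternatingMap.ext fun v => LinearMap.ext fun e => ?_
  obtain ⟨e, rfl⟩ := Submodule.Quotient.mk_surjective _ e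
  rw [Connection.curvature_apply, connCoh_mk, connCoh_mk, connCoh_mk, connCoh_mk, connCoh_mk,
    ← Submodule.Quotient.mk_sub, ← Submodule.Quotient.mk_sub, AlternatingMap.zero_apply,
    LinearMap.zero_apply, Submodule.Quotient.mk_eq_zero]
  have he : D.diff (DirectSum.lof R ℤ X i e.1) = 0 := e.2
  have h := LinearMap.congr_fun (DFunLike.congr_fun (hD 2) v) (DirectSum.lof R ℤ X i e.1)
  have hd : D.endConn.dForms D.form 2 = 0 := by
    change D.endConn.dLin 1 (D.form 1) = 0
    rw [D.form_one, map_zero]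
  rw [curv, hd, add_zero] at h
  change DirectSum.lof R ℤ X i (_ - _ - _) ∈ LinearMap.range D.diff
  have h1 : DirectSum.lof R ℤ X i (D.connAt i (v 0) (D.connAt i (v 1) e.1)
        - D.connAt i (v 1) (D.connAt i (v 0) e.1) - D.connAt i ⁅v 0, v 1⁆ e.1)
      = D.conn.curvature v (DirectSum.lof R ℤ X i e.1) := by
    simp only [map_sub, lof_connAt, Connection.curvature_apply]
  refine h1 ▸ ?_
  have h2 := eq_neg_of_add_eq_zero_left h
  change D.conn.curvature v (DirectSum.lof R ℤ X i e.1) = _ at h2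
  rw [h2]
  refine Submodule.neg_mem _ ?_
  let S : Submodule R (Module.End R (⨁ i, X i)) :=
    (LinearMap.range D.diff).comap (LinearMap.applyₗ (DirectSum.lof R ℤ X i e.1))
  suffices hs : D.formSq 2 v ∈ S from hs
  change evalHom v (D.formSq 2) ∈ S
  rw [formSq, map_sum]
  refine Submodule.sum_mem _ fun x _ => ?_
  rw [Units.smul_def, map_zsmul]
  refine zsmul_mem ?_ _
  obtain ⟨⟨p, q⟩, hx⟩ := x
  have hpq := Finset.HasAntidiagonal.mem_antidiagonal.1 hx
  simp only at hpq
  refine wedge_mem _ _ _ _ _ (fun w w' => ?_) v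
  change D.form p w (D.form q w' (DirectSum.lof R ℤ X i e.1)) ∈ LinearMap.range D.diff
  have : p = 0 ∨ p = 1 ∨ q = 0 := by omega
  rcases this with rfl | rfl | rfl
  · rw [Subsingleton.elim w ![]]
    exact ⟨_, rfl⟩
  · rw [D.form_one]
    exact Submodule.zero_mem _
  · rw [Subsingleton.elim w' ![]]
    change D.form p w (D.diff _) ∈ _
    rw [he, map_zero]
    exact Submodule.zero_mem _

end Descent

end Superconnection

end Superconnections


section Pairs

variable {R PA PL N : Type*} [CommRing R] [Algebra ℝ R]
  [LieRing PA] [Module R PA] [LieRingModule PA R] [LieAlgebra ℝ PA]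
  [LieRinehartRing R PA] [LieRinehartAlgebra ℝ R PA]
  [LieRing PL] [Module R PL] [LieRingModule PL R] [LieAlgebra ℝ PL]
  [LieRinehartRing R PL] [LieRinehartAlgebra ℝ R PL]
  [AddCommGroup N] [Module R N]

variable (R PA PL) in
/-- A morphism of Lie algebroids over the identity, on sections: a `C^∞(M)`-linear map
preserving brackets and anchors. -/
structure LieRinehartHom where
  toLin : PA →ₗ[R] PL
  map_lie : ∀ a b : PA, toLin ⁅a, b⁆ = ⁅toLin a, toLin b⁆
  map_anchor : ∀ (a : PA) (f : R), ⁅toLin a, f⁆ = ⁅a, f⁆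

instance : CoeFun (LieRinehartHom R PA PL) (fun _ => PA → PL) := ⟨fun i => i.toLin⟩

/-- The sections `Γ(L/A) = Γ(L)/Γ(A)`. -/
abbrev Normal (ι : LieRinehartHom R PA PL) : Type _ := PL ⧸ LinearMap.range ι.toLin

instance (ι : LieRinehartHom R PA PL) : Module ℝ (Normal ι) := Submodule.Quotient.module' _

/-- The Bott connection `∇_a [ℓ] = [⁅a, ℓ⁆]` of `A` on `L/A`. -/
def bott (ι : LieRinehartHom R PA PL) : Connection R PA (Normal ι) where
  toFun :=
    { toFun := fun a => quotientMap (LinearMap.range ι.toLin)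
        { toFun := fun l => ⁅ι a, l⁆
          map_add' := lie_add _
          map_smul' := fun c l => lie_smul c _ l } (by
            rintro _ ⟨b, rfl⟩
            exact ⟨⁅a, b⁆, ι.map_lie a b⟩)
      map_add' := fun a b => LinearMap.ext fun l => by
        obtain ⟨l, rfl⟩ := Submodule.Quotient.mk_surjective _ l
        exact congrArg (Submodule.Quotient.mk (p := LinearMap.range ι.toLin))
          ((congrArg (⁅·, l⁆) (map_add ι.toLin a b)).trans (add_lie _ _ _))
      map_smul' := fun f a => LinearMap.ext fun l => by
        obtain ⟨l, rfl⟩ := Submodule.Quotient.mk_surjective _ l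
        change Submodule.Quotient.mk ⁅ι.toLin (f • a), l⁆
          = f • Submodule.Quotient.mk (p := LinearMap.range ι.toLin) ⁅ι a, l⁆
        rw [← Submodule.Quotient.mk_smul, Submodule.Quotient.eq]
        refine ⟨-⁅l, f⁆ • a, ?_⟩
        rw [map_smul, map_smul, ← lie_skew, LieRinehartRing.leibniz_smul_right, ← lie_skew _ l,
          smul_neg, neg_smul]
        abel }
  leibniz a f l := by
    obtain ⟨l, rfl⟩ := Submodule.Quotient.mk_surjective _ l
    refine (congrArg (Submodule.Quotient.mk (p := LinearMap.range ι.toLin))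
      (LieRinehartRing.leibniz_smul_right (ι a) l f)).trans ?_
    rw [ι.map_anchor, Submodule.Quotient.mk_add, Submodule.Quotient.mk_smul,
      Submodule.Quotient.mk_smul]
    rfl

/-- For a `(k+1)`-form `F` on `L` vanishing on `A`, the `k`-form on `A` with values in
`A° ⊗ N = Hom(L/A, N)` given by `(a₁, …, a_k; [ℓ]) ↦ F (a₁, …, a_k, ℓ)`. -/
def restrictForm (ι : LieRinehartHom R PA PL) {k : ℕ} (F : PL [⋀^Fin (k + 1)]→ₗ[R] N)
    (hF : ∀ v : Fin (k + 1) → PA, F (fun j => ι (v j)) = 0) :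
    PA [⋀^Fin k]→ₗ[R] (Normal ι →ₗ[R] N) where
  toFun v := (LinearMap.range ι.toLin).liftQ
    { toFun := fun l => F (Fin.snoc (α := fun _ => PL) (fun j => ι (v j)) l)
      map_add' := fun l l' => by
        simpa only [Fin.update_snoc_last] using
          F.map_update_add (Fin.snoc (α := fun _ => PL) (fun j => ι (v j)) l) (Fin.last k) l l'
      map_smul' := fun c l => by
        simpa only [Fin.update_snoc_last, RingHom.id_apply] using
          F.map_update_smul (Fin.snoc (α := fun _ => PL) (fun j => ι (v j)) l) (Fin.last k) c l }
    (by
      rintro _ ⟨b, rfl⟩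
      have h := hF (Fin.snoc (α := fun _ => PA) v b)
      have e : (fun j => ι ((Fin.snoc (α := fun _ => PA) v b : Fin (k + 1) → PA) j))
          = Fin.snoc (α := fun _ => PL) (fun j => ι (v j)) (ι b) := by
        ext j
        refine Fin.lastCases ?_ (fun j => ?_) j <;> simp
      rw [e] at h
      exact h)
  map_update_add' := by
    intro inst v i x y
    obtain rfl := Subsingleton.elim inst (instDecidableEqFin k)
    have hu : ∀ z, (fun j => ι (Function.update v i z j))
        = Function.update (fun j => ι (v j)) i (ι z) := by
      intro z; ext j
      by_cases h : j = i
      · subst h; simp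
      · simp [h]
    have hs : ∀ (w : Fin k → PL) (z l : PL), Fin.snoc (α := fun _ => PL) (Function.update w i z) l
        = Function.update (Fin.snoc (α := fun _ => PL) w l) i.castSucc z :=
      fun w z l => Fin.snoc_update (α := fun _ => PL) l w i z
    refine LinearMap.ext fun l => ?_
    obtain ⟨l, rfl⟩ := Submodule.Quotient.mk_surjective _ l
    change F (Fin.snoc (α := fun _ => PL) _ l) = F (Fin.snoc (α := fun _ => PL) _ l)
      + F (Fin.snoc (α := fun _ => PL) _ l)
    rw [hu, hu, hu, hs, hs, hs, map_add]
    exact F.map_update_add _ _ _ _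
  map_update_smul' := by
    intro inst v i c x
    obtain rfl := Subsingleton.elim inst (instDecidableEqFin k)
    have hu : ∀ z, (fun j => ι (Function.update v i z j))
        = Function.update (fun j => ι (v j)) i (ι z) := by
      intro z; ext j
      by_cases h : j = i
      · subst h; simp
      · simp [h]
    have hs : ∀ (w : Fin k → PL) (z l : PL), Fin.snoc (α := fun _ => PL) (Function.update w i z) l
        = Function.update (Fin.snoc (α := fun _ => PL) w l) i.castSucc z :=
      fun w z l => Fin.snoc_update (α := fun _ => PL) l w i z
    refine LinearMap.ext fun l => ?_
    obtain ⟨l, rfl⟩ := Submodule.Quotient.mk_surjective _ l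
    change F (Fin.snoc (α := fun _ => PL) _ l) = c • F (Fin.snoc (α := fun _ => PL) _ l)
    rw [hu, hu, hs, hs, map_smul]
    exact F.map_update_smul _ _ _ _
  map_eq_zero_of_eq' v i j hv hij := by
    refine LinearMap.ext fun l => ?_
    obtain ⟨l, rfl⟩ := Submodule.Quotient.mk_surjective _ l
    change F (Fin.snoc (α := fun _ => PL) _ l) = 0
    refine F.map_eq_zero_of_eq _ (i := i.castSucc) (j := j.castSucc) ?_ ?_
    · simp [hv]
    · simpa using hij

theorem restrictForm_apply (ι : LieRinehartHom R PA PL) {k : ℕ} (F : PL [⋀^Fin (k + 1)]→ₗ[R] N)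
    (hF : ∀ v : Fin (k + 1) → PA, F (fun j => ι (v j)) = 0) (v : Fin k → PA) (l : PL) :
    restrictForm ι F hF v (Submodule.Quotient.mk l)
      = F (Fin.snoc (α := fun _ => PL) (fun j => ι (v j)) l) := rfl

end Pairs

section AtiyahModule

variable {R PA PL N : Type*} [CommRing R] [Algebra ℝ R]
  [LieRing PA] [Module R PA] [LieRingModule PA R] [LieAlgebra ℝ PA]
  [LieRinehartRing R PA] [LieRinehartAlgebra ℝ R PA]
  [LieRing PL] [Module R PL] [LieRingModule PL R] [LieAlgebra ℝ PL]
  [LieRinehartRing R PL] [LieRinehartAlgebra ℝ R PL]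
  [AddCommGroup N] [Module R N] [Module ℝ N] [IsScalarTower ℝ R N]

namespace Connection

/-- The `L`-connection `DL` extends the `A`-connection `DA`. -/
def Extends (ι : LieRinehartHom R PA PL) (DA : Connection R PA N) (DL : Connection R PL N) :
    Prop := ∀ a, DL (ι a) = DA a

/-- The connection of `A` on `A° ⊗ End N = Hom(L/A, End N)` induced by the Bott connection and
the connection `DA` on `N`. -/
def hatConn (ι : LieRinehartHom R PA PL) (DA : Connection R PA N) :
    Connection R PA (Normal ι →ₗ[R] Module.End R N) := (bott ι).hom (DA.hom DA)

theorem Extends.curvature_comp {ι : LieRinehartHom R PA PL} {DA : Connection R PA N}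
    {DL : Connection R PL N} (h : Extends ι DA DL) (v : Fin 2 → PA) :
    DL.curvature (fun j => ι (v j)) = DA.curvature v := by
  refine LinearMap.ext fun e => ?_
  rw [curvature_apply, curvature_apply, ← ι.map_lie, h, h, h]

/-- The Atiyah cocycle of an `A`-module `N`: `at(a; [ℓ]) = R_∇(a, ℓ)`, for an `L`-connection `∇`
on `N` extending the flat `A`-connection. -/
def atiyahCocycle (ι : LieRinehartHom R PA PL) (DA : Connection R PA N) (DL : Connection R PL N)
    (hflat : DA.curvature = 0) (h : Extends ι DA DL) :
    PA [⋀^Fin 1]→ₗ[R] (Normal ι →ₗ[R] Module.End R N) :=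
  restrictForm ι DL.curvature fun v => by rw [h.curvature_comp, hflat]; rfl

end Connection

end AtiyahModule

section Multiplication

variable {R P S N : Type*} [CommRing R] [Algebra ℝ R] [AddCommGroup P] [Module R P]
  [AddCommGroup S] [Module R S] [AddCommGroup N] [Module R N] [Module ℝ N] [IsScalarTower ℝ R N]

/-- The map `u ↦ ε₁ • (η ∧ u) - ε₂ • (u ∧ η)`, for a `k`-form `η`, on `l`-forms `u`. -/
def wedgeCommutator (B₁ : S →ₗ[R] N →ₗ[R] N) (B₂ : N →ₗ[R] S →ₗ[R] N) (ε₁ ε₂ : ℤˣ) {k l n : ℕ}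
    (h : k + l = n) (η : P [⋀^Fin k]→ₗ[R] S) :
    (P [⋀^Fin l]→ₗ[R] N) →ₗ[ℝ] (P [⋀^Fin n]→ₗ[R] N) where
  toFun u := ε₁ • wedge B₁ h η u - ε₂ • wedge B₂ ((add_comm l k).trans h) u η
  map_add' u w := by
    rw [wedge_add_left, wedge_add_right, smul_add, smul_add]
    abel
  map_smul' c u := by
    rw [wedge_smul_left, wedge_smul_right, smul_comm _ c, smul_comm _ c,
      RingHom.id_apply, smul_sub]

variable (R) in
/-- Left composition `(φ, ψ) ↦ (q ↦ φ ∘ ψ q)`. -/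
def mulLeftHom (Q T : Type*) [AddCommGroup Q] [Module R Q] [AddCommGroup T] [Module R T] :
    Module.End R T →ₗ[R] (Q →ₗ[R] Module.End R T) →ₗ[R] (Q →ₗ[R] Module.End R T) :=
  LinearMap.mk₂ R (fun φ ψ => LinearMap.mulLeft R φ ∘ₗ ψ)
    (fun _ _ _ => LinearMap.ext fun _ => add_mul _ _ _)
    (fun _ _ _ => LinearMap.ext fun _ => smul_mul_assoc _ _ _)
    (fun _ _ _ => LinearMap.ext fun _ => mul_add _ _ _)
    (fun c φ ψ => LinearMap.ext fun q => mul_smul_comm c φ (ψ q))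

variable (R) in
/-- Right composition `(ψ, φ) ↦ (q ↦ ψ q ∘ φ)`. -/
def mulRightHom (Q T : Type*) [AddCommGroup Q] [Module R Q] [AddCommGroup T] [Module R T] :
    (Q →ₗ[R] Module.End R T) →ₗ[R] Module.End R T →ₗ[R] (Q →ₗ[R] Module.End R T) :=
  LinearMap.mk₂ R (fun ψ φ => LinearMap.mulRight R φ ∘ₗ ψ)
    (fun _ _ _ => LinearMap.ext fun _ => add_mul _ _ _)
    (fun c ψ φ => LinearMap.ext fun q => smul_mul_assoc c (ψ q) φ)
    (fun _ _ _ => LinearMap.ext fun _ => mul_add _ _ _)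
    (fun _ _ _ => LinearMap.ext fun _ => mul_smul_comm _ _ _)

end Multiplication

section AtiyahSuper

variable {R PA PL : Type*} [CommRing R] [Algebra ℝ R]
  [LieRing PA] [Module R PA] [LieRingModule PA R] [LieAlgebra ℝ PA]
  [LieRinehartRing R PA] [LieRinehartAlgebra ℝ R PA]
  [LieRing PL] [Module R PL] [LieRingModule PL R] [LieAlgebra ℝ PL]
  [LieRinehartRing R PL] [LieRinehartAlgebra ℝ R PL]
  {X : ℤ → Type*} [∀ i, AddCommGroup (X i)] [∀ i, Module R (X i)] [∀ i, Module ℝ (X i)]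
  [∀ i, IsScalarTower ℝ R (X i)]

namespace Superconnection

/-- The superconnection `DL` extends `DA`: it restricts to `DA` on arguments in `A`. -/
structure Extends (ι : LieRinehartHom R PA PL) (DA : Superconnection R PA X)
    (DL : Superconnection R PL X) : Prop where
  conn : ∀ a, DL.conn (ι a) = DA.conn a
  form : ∀ (k : ℕ) (v : Fin k → PA), DL.form k (fun j => ι (v j)) = DA.form k v

variable {ι : LieRinehartHom R PA PL} {DA : Superconnection R PA X} {DL : Superconnection R PL X}

theorem Extends.form_comp (h : Extends ι DA DL) (k : ℕ) :
    (DL.form k).compLinearMap ι.toLin = DA.form k :=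
  AlternatingMap.ext fun v => h.form k v

theorem Extends.d_comp (h : Extends ι DA DL) (k : ℕ) (v : Fin (k + 1) → PA) :
    DL.endConn.d (DL.form k) (fun j => ι (v j)) = DA.endConn.d (DA.form k) v := by
  rw [Connection.d_apply, Connection.d_apply]
  have hr : ∀ i : Fin (k + 1), (i.removeNth fun j => ι (v j) : Fin k → PL)
      = fun j => ι (i.removeNth v j) := fun i => rfl
  have hu : ∀ (w : Fin k → PA) (j : Fin k) (a : PA),
      (Function.update (fun j => ι (w j)) j ⁅ι a, ι (w j)⁆ : Fin k → PL)
        = fun i => ι (Function.update w j ⁅a, w j⁆ i) := by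
    intro w j a
    ext i
    by_cases hi : i = j
    · subst hi; simp [ι.map_lie]
    · simp [hi]
  have hc : ∀ a, DL.endConn (ι a) = DA.endConn a := by
    intro a
    refine LinearMap.ext fun φ => LinearMap.ext fun e => ?_
    change DL.conn (ι a) (φ e) - φ (DL.conn (ι a) e) = DA.conn a (φ e) - φ (DA.conn a e)
    rw [h.conn]
  refine Finset.sum_congr rfl fun i _ => ?_
  simp only [hr, hu, h.form, hc]

theorem Extends.curv_comp (h : Extends ι DA DL) (k : ℕ) (v : Fin k → PA) :
    DL.curv k (fun j => ι (v j)) = DA.curv k v := by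
  have h1 : DL.conn.curvatureForms k (fun j => ι (v j)) = DA.conn.curvatureForms k v := by
    match k with
    | 0 => rfl
    | 1 => rfl
    | 2 => exact Connection.Extends.curvature_comp (ι := ι) h.conn v
    | k + 3 => rfl
  have h2 : DL.endConn.dForms DL.form k (fun j => ι (v j)) = DA.endConn.dForms DA.form k v := by
    cases k with
    | zero => rfl
    | succ k => exact h.d_comp k v
  have h3 : DL.formSq k (fun j => ι (v j)) = DA.formSq k v := by
    change evalHom (fun j => ι (v j)) (DL.formSq k) = evalHom v (DA.formSq k)
    rw [formSq, formSq, map_sum, map_sum]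
    refine Finset.sum_congr rfl fun x _ => ?_
    rw [Units.smul_def, Units.smul_def, map_zsmul, map_zsmul]
    congr 1
    refine (wedge_comp ι.toLin _ _ _ _ v).trans ?_
    rw [h.form_comp, h.form_comp]
    rfl
  exact congrArg₂ (· + ·) (congrArg₂ (· + ·) h1 h2) h3

/-- The Atiyah cocycle `α`: the family of forms
`α^(k)(a₁, …, a_k; [ℓ]) = (D_L)²(a₁, …, a_k, ℓ)` on `A` with values in `A° ⊗ End E`. -/
def atiyahCocycle (hflat : DA.IsFlat) (h : Extends ι DA DL) :
    Forms R PA (Normal ι →ₗ[R] Module.End R (⨁ i, X i)) := fun k =>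
  restrictForm ι (DL.curv (k + 1)) fun v => by rw [h.curv_comp, hflat]; rfl

/-- The graded commutator of the forms `ω^(k)`, `k ≠ 1`, of `DA` with elements of total degree
`p`. An element of `A°` counts as a form on `L` of degree one, whose argument comes last; whence
the signs, which are the Koszul signs of the commutator `[D, u]` for such forms. -/
def hatBracket (ι : LieRinehartHom R PA PL) (DA : Superconnection R PA X) (p : ℤ) :
    Forms R PA (Normal ι →ₗ[R] Module.End R (⨁ i, X i)) →ₗ[ℝ]
      Forms R PA (Normal ι →ₗ[R] Module.End R (⨁ i, X i)) :=
  LinearMap.pi fun n => ∑ x ∈ (Finset.HasAntidiagonal.antidiagonal n).attach,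
    wedgeCommutator (N := Normal ι →ₗ[R] Module.End R (⨁ i, X i)) (mulLeftHom R (Normal ι) (⨁ i, X i)) (mulRightHom R (Normal ι) (⨁ i, X i))
      (Int.negOnePow ((1 - (x.1.1 : ℤ)) * (x.1.2 + 1)))
      (Int.negOnePow (p + 1 + (p - x.1.2 + 1) * x.1.1))
      (Finset.HasAntidiagonal.mem_antidiagonal.1 x.2) (DA.form x.1.1) ∘ₗ LinearMap.proj x.1.2

/-- The differential `s` on `Ω(A, A° ⊗ End E)`, on elements of total degree `p`: the exterior
covariant derivative plus the commutator with the forms of the superconnection. -/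
def hatDiff (ι : LieRinehartHom R PA PL) (DA : Superconnection R PA X) (p : ℤ) :
    Forms R PA (Normal ι →ₗ[R] Module.End R (⨁ i, X i)) →ₗ[ℝ]
      Forms R PA (Normal ι →ₗ[R] Module.End R (⨁ i, X i)) :=
  (Connection.hatConn ι DA.conn).dForms + hatBracket ι DA p

/-- The forms of total degree `p`: those whose component of form degree `n` takes values in the
endomorphisms of degree `p - n`. -/
def cochains (ι : LieRinehartHom R PA PL) (X : ℤ → Type*) [∀ i, AddCommGroup (X i)]
    [∀ i, Module R (X i)] [∀ i, Module ℝ (X i)] [∀ i, IsScalarTower ℝ R (X i)] (p : ℤ) :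
    Submodule ℝ (Forms R PA (Normal ι →ₗ[R] Module.End R (⨁ i, X i))) where
  carrier := {u | ∀ (n : ℕ) (v : Fin n → PA) (l : Normal ι), u n v l ∈ endDeg R X (p - n)}
  add_mem' h h' n v l := Submodule.add_mem _ (h n v l) (h' n v l)
  zero_mem' _ _ _ := Submodule.zero_mem _
  smul_mem' c u h n v l := by
    have e : (c • u) n v l = algebraMap ℝ R c • u n v l := by
      change c • (u n v l) = _
      rw [algebraMap_smul]
    rw [e]
    exact Submodule.smul_mem _ _ (h n v l)

/-- The `s`-cocycles of total degree `p`. -/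
def cocycles (ι : LieRinehartHom R PA PL) (DA : Superconnection R PA X) (p : ℤ) :
    Submodule ℝ (Forms R PA (Normal ι →ₗ[R] Module.End R (⨁ i, X i))) :=
  cochains ι X p ⊓ LinearMap.ker (hatDiff ι DA p)

/-- The `s`-coboundaries of total degree `p`. -/
def coboundaries (ι : LieRinehartHom R PA PL) (DA : Superconnection R PA X) (p : ℤ) :
    Submodule ℝ (Forms R PA (Normal ι →ₗ[R] Module.End R (⨁ i, X i))) :=
  (cochains ι X (p - 1)).map (hatDiff ι DA (p - 1))

/-- The cohomology of `s` in total degree `p`. -/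
def Cohomology (ι : LieRinehartHom R PA PL) (DA : Superconnection R PA X) (p : ℤ) : Type _ :=
  cocycles ι DA p ⧸ (coboundaries ι DA p).submoduleOf (cocycles ι DA p)

instance (ι : LieRinehartHom R PA PL) (DA : Superconnection R PA X) (p : ℤ) :
    AddCommGroup (Cohomology ι DA p) := Submodule.Quotient.addCommGroup _

instance (ι : LieRinehartHom R PA PL) (DA : Superconnection R PA X) (p : ℤ) :
    Module ℝ (Cohomology ι DA p) := Submodule.Quotient.module _

/-- The cohomology class of a cocycle. -/
def cohomologyClass (ι : LieRinehartHom R PA PL) (DA : Superconnection R PA X) (p : ℤ) :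
    cocycles ι DA p →ₗ[ℝ] Cohomology ι DA p := Submodule.mkQ _

end Superconnection

end AtiyahSuper


section Geometry

variable {EM : Type*} [NormedAddCommGroup EM] [NormedSpace ℝ EM]
  {H : Type*} [TopologicalSpace H] (I : ModelWithCorners ℝ EM H)
  {M : Type*} [TopologicalSpace M] [ChartedSpace H M]
  (F : Type*) [NormedAddCommGroup F] [NormedSpace ℝ F]
  (V : M → Type*) [TopologicalSpace (TotalSpace F V)]
  [∀ x, TopologicalSpace (V x)] [∀ x, AddCommGroup (V x)] [∀ x, Module ℝ (V x)]
  [FiberBundle F V] [VectorBundle ℝ F V]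
  (F' : Type*) [NormedAddCommGroup F'] [NormedSpace ℝ F']
  (V' : M → Type*) [TopologicalSpace (TotalSpace F' V')]
  [∀ x, TopologicalSpace (V' x)] [∀ x, AddCommGroup (V' x)] [∀ x, Module ℝ (V' x)]
  [FiberBundle F' V'] [VectorBundle ℝ F' V']

/-- A smooth morphism of vector bundles over the identity of `M`. -/
structure SmoothBundleMap where
  toFun : ∀ x, V x →ₗ[ℝ] V' x
  contMDiff : ContMDiff (I.prod 𝓘(ℝ, F)) (I.prod 𝓘(ℝ, F')) ∞
    (fun p : TotalSpace F V => (⟨p.1, toFun p.1 p.2⟩ : TotalSpace F' V'))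

namespace SmoothBundleMap

variable {I F V F' V'}

/-- The section `x ↦ φ_x (s x)`. -/
def onSection (φ : SmoothBundleMap I F V F' V') (s : Cₛ^∞⟮I; F, V⟯) : Cₛ^∞⟮I; F', V'⟯ :=
  ⟨fun x => φ.toFun x (s x), φ.contMDiff.comp s.contMDiff⟩

end SmoothBundleMap

variable {F V}

instance sectionSMul : SMul C^∞⟮I, M; 𝓘(ℝ, ℝ), ℝ⟯ Cₛ^∞⟮I; F, V⟯ :=
  ⟨fun f s => ⟨fun x => f x • s x, f.contMDiff.smul_section s.contMDiff⟩⟩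

variable {I} in
theorem section_smul_apply (f : C^∞⟮I, M; 𝓘(ℝ, ℝ), ℝ⟯) (s : Cₛ^∞⟮I; F, V⟯) (x : M) :
    (f • s) x = f x • s x := rfl

/-- Sections form a module over the ring of smooth functions. -/
instance sectionModule : Module C^∞⟮I, M; 𝓘(ℝ, ℝ), ℝ⟯ Cₛ^∞⟮I; F, V⟯ where
  one_smul s := ContMDiffSection.ext fun x => one_smul ℝ (s x)
  mul_smul f g s := ContMDiffSection.ext fun x => mul_smul (f x) (g x) (s x)
  smul_zero f := ContMDiffSection.ext fun x => smul_zero (f x)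
  smul_add f s t := ContMDiffSection.ext fun x => smul_add (f x) (s x) (t x)
  add_smul f g s := ContMDiffSection.ext fun x => add_smul (f x) (g x) (s x)
  zero_smul s := ContMDiffSection.ext fun x => zero_smul ℝ (s x)

instance sectionScalarTower : IsScalarTower ℝ C^∞⟮I, M; 𝓘(ℝ, ℝ), ℝ⟯ Cₛ^∞⟮I; F, V⟯ :=
  ⟨fun c f s => ContMDiffSection.ext fun x => mul_smul c (f x) (s x)⟩

variable [IsManifold I ∞ M]

variable {I}

/-- The derivative `x ↦ d f_x (ρ (a x))` of a function along the image of a section under a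
bundle map to the tangent bundle. -/
def anchorDeriv (ρ : SmoothBundleMap I F V EM (TangentSpace I : M → Type _)) (a : Cₛ^∞⟮I; F, V⟯)
    (f : C^∞⟮I, M; 𝓘(ℝ, ℝ), ℝ⟯) : C^∞⟮I, M; 𝓘(ℝ, ℝ), ℝ⟯ :=
  ⟨fun x => mvfderiv I f x (ρ.toFun x (a x)), by
    have h1 : ContMDiff I.tangent 𝓘(ℝ, ℝ).tangent ∞ (tangentMap I 𝓘(ℝ, ℝ) f) :=
      f.contMDiff.contMDiff_tangentMap le_rfl
    have h2 : ContMDiff I I.tangent ∞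
        (fun x => (⟨x, ρ.toFun x (a x)⟩ : TangentBundle I M)) := (ρ.onSection a).contMDiff
    exact (contMDiff_snd_tangentBundle_modelSpace ℝ 𝓘(ℝ, ℝ)).comp (h1.comp h2)⟩

variable (I F V) in
/-- A Lie algebroid structure on the vector bundle `V → M`: an anchor `V → TM` and a Lie bracket
on the sections which satisfies the Leibniz rule and which the anchor preserves. -/
class LieAlgebroid where
  anchor : SmoothBundleMap I F V EM (TangentSpace I : M → Type _)
  bracket : Cₛ^∞⟮I; F, V⟯ → Cₛ^∞⟮I; F, V⟯ → Cₛ^∞⟮I; F, V⟯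
  add_bracket : ∀ a b c, bracket (a + b) c = bracket a c + bracket b c
  bracket_add : ∀ a b c, bracket a (b + c) = bracket a b + bracket a c
  bracket_self : ∀ a, bracket a a = 0
  jacobi : ∀ a b c, bracket a (bracket b c) = bracket (bracket a b) c + bracket b (bracket a c)
  leibniz : ∀ a (f : C^∞⟮I, M; 𝓘(ℝ, ℝ), ℝ⟯) b,
    bracket a (f • b) = f • bracket a b + anchorDeriv anchor a f • b
  anchor_bracket : ∀ a b (f : C^∞⟮I, M; 𝓘(ℝ, ℝ), ℝ⟯),
    anchorDeriv anchor (bracket a b) f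
      = anchorDeriv anchor a (anchorDeriv anchor b f) - anchorDeriv anchor b (anchorDeriv anchor a f)

theorem mdiff (f : C^∞⟮I, M; 𝓘(ℝ, ℝ), ℝ⟯) (x : M) : MDifferentiableAt I 𝓘(ℝ, ℝ) f x :=
  f.mdifferentiableAt

section

variable (ρ : SmoothBundleMap I F V EM (TangentSpace I : M → Type _)) (a b : Cₛ^∞⟮I; F, V⟯)
  (f g : C^∞⟮I, M; 𝓘(ℝ, ℝ), ℝ⟯) (c : ℝ)

theorem anchorDeriv_add : anchorDeriv ρ a (f + g) = anchorDeriv ρ a f + anchorDeriv ρ a g := by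
  ext x
  exact congrArg (fun L => L (ρ.toFun x (a x))) (mvfderiv_add (mdiff f x) (mdiff g x))

theorem anchorDeriv_mul :
    anchorDeriv ρ a (f * g) = f * anchorDeriv ρ a g + anchorDeriv ρ a f * g := by
  ext x
  refine (congrArg (fun L => L (ρ.toFun x (a x))) (mvfderiv_mul (mdiff f x) (mdiff g x))).trans ?_
  change f x * mvfderiv I g x _ + g x * mvfderiv I f x _ = f x * mvfderiv I g x _ + mvfderiv I f x _ * g x
  ring

theorem anchorDeriv_algebraMap : anchorDeriv ρ a (algebraMap ℝ _ c) = 0 := by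
  ext x
  exact congrArg (fun L => L (ρ.toFun x (a x))) (mvfderiv_const (I := I) c)

theorem add_anchorDeriv : anchorDeriv ρ (a + b) f = anchorDeriv ρ a f + anchorDeriv ρ b f := by
  ext x
  change mvfderiv I f x (ρ.toFun x (a x + b x)) = mvfderiv I f x _ + mvfderiv I f x _
  rw [map_add, map_add]

theorem smul_anchorDeriv : anchorDeriv ρ (f • a) g = f * anchorDeriv ρ a g := by
  ext x
  change mvfderiv I g x (ρ.toFun x (f x • a x)) = f x * mvfderiv I g x _
  rw [map_smul, map_smul, smul_eq_mul]

end

section Instances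

variable [LieAlgebroid I F V]

instance : LieRing Cₛ^∞⟮I; F, V⟯ where
  bracket := LieAlgebroid.bracket
  add_lie := LieAlgebroid.add_bracket
  lie_add := LieAlgebroid.bracket_add
  lie_self := LieAlgebroid.bracket_self
  leibniz_lie := LieAlgebroid.jacobi

instance : LieRingModule Cₛ^∞⟮I; F, V⟯ C^∞⟮I, M; 𝓘(ℝ, ℝ), ℝ⟯ where
  bracket a f := anchorDeriv LieAlgebroid.anchor a f
  add_lie := add_anchorDeriv _
  lie_add := anchorDeriv_add _
  leibniz_lie a b f := by
    change anchorDeriv _ a (anchorDeriv _ b f)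
      = anchorDeriv _ (LieAlgebroid.bracket a b) f + anchorDeriv _ b (anchorDeriv _ a f)
    rw [LieAlgebroid.anchor_bracket, sub_add_cancel]

instance : LieRinehartRing C^∞⟮I, M; 𝓘(ℝ, ℝ), ℝ⟯ Cₛ^∞⟮I; F, V⟯ where
  lie_smul_eq_mul' f g a := smul_anchorDeriv _ a f g
  leibniz_mul_right' a f g := anchorDeriv_mul _ a f g
  leibniz_smul_right' a b f := LieAlgebroid.leibniz a f b

instance : LieAlgebra ℝ Cₛ^∞⟮I; F, V⟯ where
  lie_smul c a b := by
    rw [← algebraMap_smul C^∞⟮I, M; 𝓘(ℝ, ℝ), ℝ⟯ c b, LieRinehartRing.leibniz_smul_right]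
    have h : ⁅a, algebraMap ℝ C^∞⟮I, M; 𝓘(ℝ, ℝ), ℝ⟯ c⁆ = 0 := anchorDeriv_algebraMap _ a c
    rw [h, zero_smul, add_zero, algebraMap_smul]

instance : LieRinehartAlgebra ℝ C^∞⟮I, M; 𝓘(ℝ, ℝ), ℝ⟯ Cₛ^∞⟮I; F, V⟯ where
  smul_lie c a f := by
    rw [← algebraMap_smul C^∞⟮I, M; 𝓘(ℝ, ℝ), ℝ⟯ c a, LieRinehartRing.lie_smul_eq_mul,
      ← Algebra.smul_def]
  lie_smul c a f := by
    have h : ⁅a, algebraMap ℝ C^∞⟮I, M; 𝓘(ℝ, ℝ), ℝ⟯ c⁆ = 0 := anchorDeriv_algebraMap _ a c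
    rw [Algebra.smul_def, LieRinehartRing.leibniz_mul_right, h, zero_mul, add_zero,
      algebraMap_smul]

end Instances

variable {F' V'}

/-- A Lie pair `A ↪ L`: a fiberwise injective morphism of Lie algebroids over the identity of
`M`. -/
structure LiePair (I : ModelWithCorners ℝ EM H) [IsManifold I ∞ M] (F : Type*)
    [NormedAddCommGroup F] [NormedSpace ℝ F]
    (A : M → Type*) [TopologicalSpace (TotalSpace F A)]
    [∀ x, TopologicalSpace (A x)] [∀ x, AddCommGroup (A x)] [∀ x, Module ℝ (A x)]
    [FiberBundle F A] [VectorBundle ℝ F A] [LieAlgebroid I F A]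
    (F' : Type*) [NormedAddCommGroup F'] [NormedSpace ℝ F']
    (L : M → Type*) [TopologicalSpace (TotalSpace F' L)]
    [∀ x, TopologicalSpace (L x)] [∀ x, AddCommGroup (L x)] [∀ x, Module ℝ (L x)]
    [FiberBundle F' L] [VectorBundle ℝ F' L] [LieAlgebroid I F' L]
    extends SmoothBundleMap I F A F' L where
  injective : ∀ x, Function.Injective (toFun x)
  anchor_comp : ∀ (x : M) (a : A x), (LieAlgebroid.anchor (I := I) (F := F') (V := L)).toFun x
    (toFun x a) = (LieAlgebroid.anchor (I := I) (F := F) (V := A)).toFun x a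
  map_lie : ∀ a b : Cₛ^∞⟮I; F, A⟯,
    toSmoothBundleMap.onSection ⁅a, b⁆
      = ⁅toSmoothBundleMap.onSection a, toSmoothBundleMap.onSection b⁆

/-- The map on sections of a Lie pair. -/
def LiePair.toHom [LieAlgebroid I F V] [LieAlgebroid I F' V'] (i : LiePair I F V F' V') :
    LieRinehartHom C^∞⟮I, M; 𝓘(ℝ, ℝ), ℝ⟯ Cₛ^∞⟮I; F, V⟯ Cₛ^∞⟮I; F', V'⟯ where
  toLin :=
    { toFun := i.onSection
      map_add' := fun a b => ContMDiffSection.ext fun x => map_add (i.toFun x) (a x) (b x)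
      map_smul' := fun f a => ContMDiffSection.ext fun x => map_smul (i.toFun x) (f x) (a x) }
  map_lie := i.map_lie
  map_anchor a f := by
    ext x
    exact congrArg (mvfderiv I f x) (i.anchor_comp x (a x))

end Geometry

section Graded

variable {EM : Type*} [NormedAddCommGroup EM] [NormedSpace ℝ EM]
  {H : Type*} [TopologicalSpace H] {I : ModelWithCorners ℝ EM H}
  {M : Type*} [TopologicalSpace M] [ChartedSpace H M]
  {F : ℤ → Type*} [∀ i, NormedAddCommGroup (F i)] [∀ i, NormedSpace ℝ (F i)]
  {E : ℤ → M → Type*} [∀ i, TopologicalSpace (TotalSpace (F i) (E i))]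
  [∀ i x, TopologicalSpace (E i x)] [∀ i x, AddCommGroup (E i x)] [∀ i x, Module ℝ (E i x)]
  [∀ i, FiberBundle (F i) (E i)] [∀ i, VectorBundle ℝ (F i) (E i)]
  {P : Type*} [LieRing P] [Module C^∞⟮I, M; 𝓘(ℝ, ℝ), ℝ⟯ P]
  [LieRingModule P C^∞⟮I, M; 𝓘(ℝ, ℝ), ℝ⟯] [LieAlgebra ℝ P]
  [LieRinehartRing C^∞⟮I, M; 𝓘(ℝ, ℝ), ℝ⟯ P] [LieRinehartAlgebra ℝ C^∞⟮I, M; 𝓘(ℝ, ℝ), ℝ⟯ P]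

namespace Superconnection

/-- The image of `∂_x` in the fiber `(E_i)_x`: the values at `x` of the sections `(∂ t)_i`. -/
def fiberIm (D : Superconnection C^∞⟮I, M; 𝓘(ℝ, ℝ), ℝ⟯ P fun i => Cₛ^∞⟮I; F i, E i⟯)
    (i : ℤ) (x : M) : Submodule ℝ (E i x) where
  carrier := {v | ∃ t : ⨁ j, Cₛ^∞⟮I; F j, E j⟯, (D.diff t i) x = v}
  add_mem' := by
    rintro _ _ ⟨t, rfl⟩ ⟨t', rfl⟩
    refine ⟨t + t', ?_⟩
    rw [map_add]
    rfl
  zero_mem' := ⟨0, by rw [map_zero]; rfl⟩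
  smul_mem' := by
    rintro c _ ⟨t, rfl⟩
    refine ⟨algebraMap ℝ C^∞⟮I, M; 𝓘(ℝ, ℝ), ℝ⟯ c • t, ?_⟩
    rw [map_smul]
    rfl

/-- The kernel of `∂_x` in the fiber `(E_i)_x`: the values at `x` of the sections `e` of `E_i`
for which `∂ e` vanishes at `x`. -/
def fiberKer (D : Superconnection C^∞⟮I, M; 𝓘(ℝ, ℝ), ℝ⟯ P fun i => Cₛ^∞⟮I; F i, E i⟯)
    (i : ℤ) (x : M) : Submodule ℝ (E i x) where
  carrier := {v | ∃ e : Cₛ^∞⟮I; F i, E i⟯, (D.diff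
    (DirectSum.lof C^∞⟮I, M; 𝓘(ℝ, ℝ), ℝ⟯ ℤ (fun j => Cₛ^∞⟮I; F j, E j⟯) i e) (i + 1)) x = 0 ∧
      e x = v}
  add_mem' := by
    rintro _ _ ⟨t, ht, rfl⟩ ⟨t', ht', rfl⟩
    refine ⟨t + t', ?_, rfl⟩
    rw [map_add, map_add]
    exact (congrArg₂ (· + ·) ht ht').trans (add_zero _)
  zero_mem' := ⟨0, by rw [map_zero, map_zero]; rfl, rfl⟩
  smul_mem' := by
    rintro c _ ⟨t, ht, rfl⟩
    refine ⟨algebraMap ℝ C^∞⟮I, M; 𝓘(ℝ, ℝ), ℝ⟯ c • t, ?_, rfl⟩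
    rw [map_smul, map_smul]
    exact (congrArg (c • ·) ht).trans (smul_zero _)

/-- `∂` has constant rank. -/
def IsRegular (D : Superconnection C^∞⟮I, M; 𝓘(ℝ, ℝ), ℝ⟯ P fun i => Cₛ^∞⟮I; F i, E i⟯) :
    Prop :=
  ∀ i, ∃ r : ℕ, ∀ x, Module.finrank ℝ (D.fiberIm i x) = r

/-- The cohomology of the complex of vector bundles `(E, ∂)` vanishes outside degree `0`. -/
def IsResolution (D : Superconnection C^∞⟮I, M; 𝓘(ℝ, ℝ), ℝ⟯ P fun i => Cₛ^∞⟮I; F i, E i⟯) :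
    Prop :=
  ∀ i, i ≠ 0 → ∀ x, D.fiberKer i x ≤ D.fiberIm i x

end Superconnection

end Graded

end LiePairAtiyah

end

open LiePairAtiyah

noncomputable section
namespace LiePairAtiyah

/-! ### Contraction of a wedge product with a vector. -/

section WedgeContraction

/-! The freedom lies in the choice of the extension `D_L`. If `η` is a family of forms on `L` of
total degree one that vanishes on `A`, then `(D_L - η)² = D_L² - [D_L, η] + η²`. On arguments from
`A` and a single `ℓ`, each term of `η²` contains a factor evaluated on `A` alone and so vanishes,
while `[D_L, η]` becomes `s` of the restriction of `η`. A splitting of `Γ(A) → Γ(L)` extends every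
cochain `u` of degree 0 to such an `η`, so `α_E` can be changed by exactly `-s u`
(`exists_modification`). Hence `[α_E] = 0` if and only if some extension has `α = 0` on the nose.

The link with `K` is in the first two components. Since `α^(0) = [∇_L, ∂]`, its vanishing lets `∇_L`
descend to `K`. In form degree two, `D_L²` and the curvature of `∇_L` differ by terms with `∂` on
the left or on the right, so the descended connection has zero Atiyah cocycle precisely when `α^(1)`
carries `ker ∂` into `im ∂` (`atiyahCocycle_inducedConn_eq_zero_iff`). Two connections on `K`
extending `∇^K` have cohomologous cocycles (`Connection.atiyahCocycle_sub`). This settles the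
direction from `E` to `K`.

For the converse, constant rank and the vanishing of cohomology outside degree 0 give a homotopy `h`
and a projection `q` onto harmonic elements with `q + ∂h + h∂ = 1`
(`IsResolution.exists_contraction`). An endomorphism `φ` that commutes with `∂` in the graded sense
is then a graded commutator with `∂` as soon as `qφq = 0` (`commutator_homotopyEnd`). The equation
`s α = 0` says that the lowest component `α^(m)` commutes with `∂`, so it can be removed when `q
α^(m) q = 0` (`exists_modification_lowest`). For `m ≠ 1` this holds because `α^(m)` has nonzero
degree and `q` lives in degree 0. Thus `α^(0)` is removed first. The induced connection on `K` is
then moved to one with zero Atiyah cocycle by lifting an `End K`-valued form to `E`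
(`exists_modification_coh`). Now `q α^(1) q = 0`, so `α^(1)` and all later components can be
removed, and boundedness of `E` makes the process finite.

The signs are handled by a calculus of contractions: a family of forms is determined by its 0-form
and its contractions, so associativity, Leibniz rules, Cartan formulas and `d² = R` follow by
induction on the form degree. `hatDiff_res_even` and `hatDiff_res_odd` identify `s` with the graded
commutator with `D_L`, whence `s α = 0` is the Bianchi identity. -/

/-- Permutations are sorted by the position `j` at which `x` lands. Each one is uniquely a
permutation fixing 0 times `j.cycleRange`, and the cycle has sign `(-1)^j`. -/
theorem sum_perm_cons {P N : Type*} [AddCommGroup N] {n : ℕ} (m : (Fin (n + 1) → P) → N) (x : P)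
    (w : Fin n → P) :
    ∑ σ : Equiv.Perm (Fin (n + 1)), Equiv.Perm.sign σ • m ((Fin.cons x w : Fin (n + 1) → P) ∘ σ)
      = ∑ j : Fin (n + 1), (-1 : ℤ) ^ (j : ℕ) • ∑ e : Equiv.Perm (Fin n),
          Equiv.Perm.sign e • m (j.insertNth x (w ∘ e)) := by
  have hbij : Function.Bijective (fun je : Fin (n + 1) × Equiv.Perm (Fin n) =>
      Equiv.Perm.decomposeFin.symm (0, je.2) * je.1.cycleRange) := by
    refine (Fintype.bijective_iff_injective_and_card _).2 ⟨?_, ?_⟩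
    · rintro ⟨j, e⟩ ⟨j', e'⟩ h
      simp only at h
      have hj : j = j' := by
        have h1 : (Equiv.Perm.decomposeFin.symm (0, e') * j'.cycleRange) j = 0 := by
          rw [← h]; simp
        have h2 : (Equiv.Perm.decomposeFin.symm (0, e') * j'.cycleRange) j' = 0 := by simp
        exact (Equiv.injective _) (h1.trans h2.symm)
      subst hj
      have := Equiv.Perm.decomposeFin.symm.injective (mul_right_cancel h)
      simpa using this
    · simp [Fintype.card_perm, Nat.factorial_succ]
  rw [← hbij.sum_comp, Fintype.sum_prod_type]
  refine Finset.sum_congr rfl fun j _ => ?_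
  rw [Finset.smul_sum]
  refine Finset.sum_congr rfl fun e _ => ?_
  have hv : (Fin.cons x w : Fin (n + 1) → P)
      ∘ (Equiv.Perm.decomposeFin.symm (0, e) * j.cycleRange : Equiv.Perm (Fin (n + 1)))
      = j.insertNth x (w ∘ e) := by
    ext i
    refine j.succAboveCases ?_ (fun i => ?_) i
    · simp
    · simp
  rw [hv, map_mul, Equiv.Perm.decomposeFin.symm_sign, Fin.sign_cycleRange]
  simp only [if_true, one_mul, Units.smul_def, Units.val_mul, Units.val_pow_eq_pow_val,
    Units.val_neg, Units.val_one, smul_smul]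
  rw [mul_comm]

variable {R P N₁ N₂ N₃ : Type*} [CommRing R] [AddCommGroup P] [Module R P]
  [AddCommGroup N₁] [Module R N₁] [AddCommGroup N₂] [Module R N₂] [AddCommGroup N₃] [Module R N₃]

/-- This replaces the quotient by shuffles with a sum over all permutations, which is easier to
reindex. The factorials are cancelled afterwards because the values form a real vector space. -/
theorem factorial_smul_wedge (B : N₁ →ₗ[R] N₂ →ₗ[R] N₃) {k l n : ℕ} (h : k + l = n)
    (f : P [⋀^Fin k]→ₗ[R] N₁) (g : P [⋀^Fin l]→ₗ[R] N₂) (v : Fin n → P) :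
    (k.factorial * l.factorial) • wedge B h f g v
      = ∑ σ : Equiv.Perm (Fin n), Equiv.Perm.sign σ •
          B (f fun i => v (σ ⟨i, by omega⟩)) (g fun i => v (σ ⟨k + i, by omega⟩)) := by
  subst h
  have h1 := congrArg (fun F => TensorProduct.lift B
      (F fun i => v (finCongr rfl (finSumFinEquiv i))))
    (MultilinearMap.domCoprod_alternization_eq f g)
  simp only [AlternatingMap.smul_apply, map_nsmul, Fintype.card_fin] at h1
  rw [wedge_apply, ← h1, MultilinearMap.alternatization_apply, map_sum,
    ← (finSumFinEquiv.permCongr).sum_comp]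
  refine Finset.sum_congr rfl fun σ _ => ?_
  rw [Equiv.Perm.sign_permCongr, Units.smul_def, Units.smul_def, map_zsmul,
    MultilinearMap.domDomCongr_apply, MultilinearMap.domCoprod_apply, TensorProduct.lift.tmul]
  have e1 : ∀ i : Fin k, (finSumFinEquiv.symm ⟨(i : ℕ), by omega⟩ : Fin k ⊕ Fin l) = Sum.inl i := by
    intro i; rw [Equiv.symm_apply_eq]; ext; simp
  have e2 : ∀ i : Fin l, (finSumFinEquiv.symm ⟨k + (i : ℕ), by omega⟩ : Fin k ⊕ Fin l) = Sum.inr i := by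
    intro i; rw [Equiv.symm_apply_eq]; ext; simp
  simp [Equiv.permCongr_apply, e1, e2]

section Real

variable [Module ℝ N₃]

theorem nsmul_factorial_cancel {a : ℕ} (ha : a ≠ 0) {x y : N₃} (h : a • x = a • y) : x = y := by
  rw [← Nat.cast_smul_eq_nsmul ℝ, ← Nat.cast_smul_eq_nsmul ℝ a y] at h
  exact (smul_right_injective N₃ (Nat.cast_ne_zero.2 ha)) h

theorem sum_perm_smul {n : ℕ} (g : P [⋀^Fin n]→ₗ[R] N₂) (L : N₂ →ₗ[R] N₃) (v : Fin n → P) :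
    ∑ σ : Equiv.Perm (Fin n), Equiv.Perm.sign σ • L (g fun i => v (σ i))
      = n.factorial • L (g v) := by
  rw [Finset.sum_congr rfl (g := fun _ => L (g v)) fun σ _ => ?_]
  · simp [Fintype.card_perm]
  · have : g (fun i => v (σ i)) = Equiv.Perm.sign σ • g v := g.map_perm v σ
    rw [this, Units.smul_def, Units.smul_def, map_zsmul, smul_smul]
    simp

theorem wedge_zero_form_left (B : N₁ →ₗ[R] N₂ →ₗ[R] N₃) {n l : ℕ} (h : 0 + l = n)
    (f : P [⋀^Fin 0]→ₗ[R] N₁) (g : P [⋀^Fin l]→ₗ[R] N₂) (v : Fin n → P) :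
    wedge B h f g v = B (f ![]) (g fun i => v ⟨i, by omega⟩) := by
  obtain rfl : n = l := by omega
  refine nsmul_factorial_cancel (Nat.factorial_ne_zero n) ?_
  have h1 := factorial_smul_wedge B h f g v
  rw [Nat.factorial_zero, one_mul] at h1
  rw [h1, ← sum_perm_smul g (B (f ![])) v]
  refine Finset.sum_congr rfl fun σ _ => ?_
  congr 2
  · rw [Subsingleton.elim ![] _]
  · congr 1; ext i; congr 2; ext; simp

theorem wedge_zero_form_right (B : N₁ →ₗ[R] N₂ →ₗ[R] N₃) {n k : ℕ} (h : k + 0 = n)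
    (f : P [⋀^Fin k]→ₗ[R] N₁) (g : P [⋀^Fin 0]→ₗ[R] N₂) (v : Fin n → P) :
    wedge B h f g v = B (f fun i => v ⟨i, by omega⟩) (g ![]) := by
  obtain rfl : n = k := by omega
  refine nsmul_factorial_cancel (Nat.factorial_ne_zero n) ?_
  have h1 := factorial_smul_wedge B h f g v
  rw [Nat.factorial_zero, mul_one] at h1
  rw [h1]
  have := sum_perm_smul f (B.flip (g ![])) v
  simp only [LinearMap.flip_apply] at this
  rw [← this]
  refine Finset.sum_congr rfl fun σ _ => ?_
  rw [Subsingleton.elim (fun i : Fin 0 => v (σ ⟨n + i, by omega⟩)) ![]]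

/-- Contraction is an antiderivation: in the sum over permutations, `x` is an argument either of `f`
or of `g`, and reaching `g` means passing the `k + 1` slots of `f`. -/
theorem curryLeft_wedge (B : N₁ →ₗ[R] N₂ →ₗ[R] N₃) {k l n : ℕ} (h : (k + 1) + (l + 1) = n + 1)
    (f : P [⋀^Fin (k + 1)]→ₗ[R] N₁) (g : P [⋀^Fin (l + 1)]→ₗ[R] N₂) (x : P) :
    (wedge B h f g).curryLeft x
      = wedge B (by omega : k + (l + 1) = n) (f.curryLeft x) g
        + (-1 : ℤ) ^ (k + 1) • wedge B (by omega : (k + 1) + l = n) f (g.curryLeft x) := by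
  ext w
  refine nsmul_factorial_cancel
    (mul_ne_zero (Nat.factorial_ne_zero (k + 1)) (Nat.factorial_ne_zero (l + 1))) ?_
  change ((k + 1).factorial * (l + 1).factorial) • wedge B h f g (Fin.cons x w) = _
  rw [factorial_smul_wedge]
  have h0 := sum_perm_cons (fun u : Fin (n + 1) → P =>
    B (f fun i => u ⟨i, by omega⟩) (g fun i => u ⟨k + 1 + i, by omega⟩)) x w
  simp only [Function.comp_apply] at h0
  rw [h0]
  -- The four facts `hL`, `hL'`, `hR`, `hR'` list the arguments received by `f` and by `g` when `x`
  -- is inserted in the first block at `i` or in the second block at `k + 1 + i`.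
  have hL : ∀ (i : Fin (k + 1)) (w : Fin n → P),
      (fun i' : Fin (k + 1) => (Fin.insertNth (⟨i, by omega⟩ : Fin (n + 1)) x w : Fin (n + 1) → P)
        ⟨i', by omega⟩) = i.insertNth x (fun i' : Fin k => w ⟨i', by omega⟩) := by
    intro i w; ext i'
    refine i.succAboveCases ?_ (fun i' => ?_) i'
    · refine Eq.trans ?_ (Fin.insertNth_apply_same (α := fun _ => P) i x _).symm
      exact Fin.insertNth_apply_same (α := fun _ => P) (⟨i, by omega⟩ : Fin (n + 1)) x w
    · rw [Fin.insertNth_apply_succAbove]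
      rw [← Fin.insertNth_apply_succAbove (α := fun _ => P) (⟨i, by omega⟩ : Fin (n + 1)) x w ⟨i', by omega⟩]
      congr 1
      ext
      simp only [Fin.succAbove, Fin.lt_def, Fin.val_castSucc]
      split_ifs <;> rfl
  have hL' : ∀ (i : Fin (k + 1)) (w : Fin n → P),
      (fun i' : Fin (l + 1) => (Fin.insertNth (⟨i, by omega⟩ : Fin (n + 1)) x w : Fin (n + 1) → P)
        ⟨k + 1 + i', by omega⟩) = (fun i' : Fin (l + 1) => w ⟨k + i', by omega⟩) := by
    intro i w; ext i'
    rw [← Fin.insertNth_apply_succAbove (α := fun _ => P) (⟨i, by omega⟩ : Fin (n + 1)) x w ⟨k + i', by omega⟩]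
    congr 1
    ext
    simp only [Fin.succAbove, Fin.lt_def, Fin.val_castSucc]
    rw [if_neg (by omega)]
    simp only [Fin.val_succ]; omega
  have hR : ∀ (i : Fin (l + 1)) (w : Fin n → P),
      (fun i' : Fin (l + 1) => (Fin.insertNth (⟨k + 1 + i, by omega⟩ : Fin (n + 1)) x w : Fin (n + 1) → P)
        ⟨k + 1 + i', by omega⟩) = i.insertNth x (fun i' : Fin l => w ⟨k + 1 + i', by omega⟩) := by
    intro i w; ext i'
    refine i.succAboveCases ?_ (fun i' => ?_) i'
    · refine Eq.trans ?_ (Fin.insertNth_apply_same (α := fun _ => P) i x _).symm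
      exact Fin.insertNth_apply_same (α := fun _ => P) (⟨k + 1 + i, by omega⟩ : Fin (n + 1)) x w
    · rw [Fin.insertNth_apply_succAbove]
      rw [← Fin.insertNth_apply_succAbove (α := fun _ => P) (⟨k + 1 + i, by omega⟩ : Fin (n + 1)) x w ⟨k + 1 + i', by omega⟩]
      congr 1
      ext
      simp only [Fin.succAbove, Fin.lt_def, Fin.val_castSucc, Nat.add_lt_add_iff_left]
      split_ifs
      · simp
      · simp; omega
  have hR' : ∀ (i : Fin (l + 1)) (w : Fin n → P),
      (fun i' : Fin (k + 1) => (Fin.insertNth (⟨k + 1 + i, by omega⟩ : Fin (n + 1)) x w : Fin (n + 1) → P)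
        ⟨i', by omega⟩) = (fun i' : Fin (k + 1) => w ⟨i', by omega⟩) := by
    intro i w; ext i'
    rw [← Fin.insertNth_apply_succAbove (α := fun _ => P) (⟨k + 1 + i, by omega⟩ : Fin (n + 1)) x w ⟨i', by omega⟩]
    congr 1
    ext
    simp only [Fin.succAbove, Fin.lt_def, Fin.val_castSucc]
    rw [if_pos (by omega)]
    rfl
  have hsplit : ∀ F : Fin (n + 1) → N₃, ∑ j, F j
      = ∑ i : Fin (k + 1), F ⟨i, by omega⟩ + ∑ i : Fin (l + 1), F ⟨k + 1 + i, by omega⟩ := by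
    intro F
    rw [← (finCongr h).sum_comp, Fin.sum_univ_add]
    rfl
  rw [hsplit]
  simp only [hL, hL', hR, hR', AlternatingMap.map_insertNth, AlternatingMap.add_apply,
    AlternatingMap.smul_apply, smul_add]
  congr 1
  -- The `k + 1` positions of `x` inside `f` contribute equally, since the sign of bringing `x` to
  -- the front cancels the sign of the position. This accounts for the quotient of `(k + 1)!` by
  -- `k!`; the second block is analogous and leaves the sign `(-1)^(k+1)`.
  · have h1 := factorial_smul_wedge B (by omega : k + (l + 1) = n) (f.curryLeft x) g w
    rw [Nat.factorial_succ k, mul_assoc, mul_smul, h1]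
    rw [Finset.sum_congr rfl fun i _ => ?_, Finset.sum_const, Finset.card_univ, Fintype.card_fin]
    rw [Finset.smul_sum]
    refine Finset.sum_congr rfl fun e _ => ?_
    rw [map_zsmul, LinearMap.smul_apply, smul_comm, smul_smul, ← mul_pow]
    simp
  · have h1 := factorial_smul_wedge B (by omega : (k + 1) + l = n) f (g.curryLeft x) w
    rw [Nat.factorial_succ l, mul_left_comm, mul_smul, smul_comm _ ((-1 : ℤ) ^ (k + 1)), h1]
    rw [Finset.sum_congr rfl fun i _ => ?_, Finset.sum_const, Finset.card_univ, Fintype.card_fin]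
    rw [Finset.smul_sum, Finset.smul_sum]
    refine Finset.sum_congr rfl fun e _ => ?_
    rw [map_zsmul, smul_comm _ ((-1 : ℤ) ^ (i : ℕ)), smul_smul, pow_add, mul_assoc, ← mul_pow]
    simp

end Real

end WedgeContraction


/-! ### Families of forms of all degrees and their signed product. -/

section FormAlgebra

variable {R P N N₁ N₂ N₃ : Type*} [CommRing R] [AddCommGroup P] [Module R P]
  [AddCommGroup N] [Module R N]
  [AddCommGroup N₁] [Module R N₁] [AddCommGroup N₂] [Module R N₂] [AddCommGroup N₃] [Module R N₃]

variable (R P N) in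
/-- Families of alternating forms of all degrees. -/
abbrev Fam : Type _ := ∀ n : ℕ, P [⋀^Fin n]→ₗ[R] N

namespace Forms

/-- Contraction of the first argument of a family of forms with `x`. -/
def ctr (x : P) : Fam R P N →+ Fam R P N where
  toFun f n := (f (n + 1)).curryLeft x
  map_zero' := rfl
  map_add' _ _ := rfl

theorem ctr_sub_left (x y : P) (f : Fam R P N) : ctr (x - y) f = ctr x f - ctr y f := by
  ext1 n
  exact map_sub (f (n + 1)).curryLeft x y

theorem ctr_apply (x : P) (f : Fam R P N) (n : ℕ) (v : Fin n → P) :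
    ctr x f n v = f (n + 1) (Fin.cons x v) := rfl

/-- The parity operator, multiplication by `(-1)ⁿ` on `n`-forms. -/
def eps : Fam R P N →+ Fam R P N where
  toFun f n := (-1 : ℤ) ^ n • f n
  map_zero' := by ext; simp
  map_add' _ _ := by ext; simp

theorem eps_apply (f : Fam R P N) (n : ℕ) : eps f n = (-1 : ℤ) ^ n • f n := rfl

theorem eps_zero_form (f : Fam R P N) : eps f 0 = f 0 := by simp [eps_apply]

@[simp] theorem eps_eps (f : Fam R P N) : eps (eps f) = f := by
  ext n v
  simp only [eps_apply, smul_smul, ← mul_pow]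
  simp

theorem ctr_eps (x : P) (f : Fam R P N) : ctr x (eps f) = -eps (ctr x f) := by
  ext n v
  simp [eps_apply, ctr_apply, pow_succ]

theorem ext_zero {f g : Fam R P N} (h : f 0 ![] = g 0 ![]) :
    f 0 = g 0 := by
  ext v
  rw [Subsingleton.elim v ![], h]

/-- Together with `ext_zero` this is the induction principle of the calculus: identities are checked
on 0-forms and then after one contraction. -/
theorem ext_succ {n : ℕ} {f g : Fam R P N} (h : ∀ x, ctr x f n = ctr x g n) :
    f (n + 1) = g (n + 1) := by
  ext v
  have := DFunLike.congr_fun (h (v 0)) (Fin.tail v)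
  rwa [ctr_apply, ctr_apply, Fin.cons_self_tail] at this

/-- The wedge product of the components of degrees `k` and `l`, in degree `n = k + l`. -/
def wedgeAt (B : N₁ →ₗ[R] N₂ →ₗ[R] N₃) (f : Fam R P N₁)
    (g : Fam R P N₂) (n k l : ℕ) : P [⋀^Fin n]→ₗ[R] N₃ :=
  if h : k + l = n then wedge B h (f k) (g l) else 0

/-- The product of families of forms with the sign `(-1)^(k l)` on forms of degrees `k`, `l`. -/
def star (B : N₁ →ₗ[R] N₂ →ₗ[R] N₃) :
    Fam R P N₁ →+ Fam R P N₂ →+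
      Fam R P N₃ :=
  AddMonoidHom.mk' (fun f => AddMonoidHom.mk' (fun g n =>
    ∑ x ∈ Finset.HasAntidiagonal.antidiagonal n, (-1 : ℤ) ^ (x.1 * x.2) • wedgeAt B f g n x.1 x.2)
      (fun g g' => by
        ext1 n
        simp only [Pi.add_apply, ← Finset.sum_add_distrib]
        refine Finset.sum_congr rfl fun x hx => ?_
        simp only [wedgeAt, Pi.add_apply]
        split_ifs
        · rw [wedge_add_right, smul_add]
        · simp))
    (fun f f' => by
      ext1 g
      ext1 n
      simp only [AddMonoidHom.add_apply, AddMonoidHom.mk'_apply, Pi.add_apply,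
        ← Finset.sum_add_distrib]
      refine Finset.sum_congr rfl fun x hx => ?_
      simp only [wedgeAt, Pi.add_apply]
      split_ifs
      · rw [wedge_add_left, smul_add]
      · simp)

theorem star_apply (B : N₁ →ₗ[R] N₂ →ₗ[R] N₃) (f : Fam R P N₁)
    (g : Fam R P N₂) (n : ℕ) : star B f g n =
    ∑ x ∈ Finset.HasAntidiagonal.antidiagonal n,
      (-1 : ℤ) ^ (x.1 * x.2) • wedgeAt B f g n x.1 x.2 := rfl

/-- Passing to `wedgeAt`, which needs no proof that the degrees add up, allows the summation indices
to be shifted or swapped freely. -/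
theorem sum_attach_wedge (B : N₁ →ₗ[R] N₂ →ₗ[R] N₃) (f : Fam R P N₁)
    (g : Fam R P N₂) (n : ℕ) (c : ℕ → ℕ → ℤ) :
    ∑ x ∈ (Finset.HasAntidiagonal.antidiagonal n).attach, c x.1.1 x.1.2 •
        wedge B (Finset.HasAntidiagonal.mem_antidiagonal.1 x.2) (f x.1.1) (g x.1.2)
      = ∑ x ∈ Finset.HasAntidiagonal.antidiagonal n, c x.1 x.2 • wedgeAt B f g n x.1 x.2 := by
  rw [← Finset.sum_attach (Finset.HasAntidiagonal.antidiagonal n)]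
  refine Finset.sum_congr rfl fun x _ => ?_
  rw [wedgeAt, dif_pos (Finset.HasAntidiagonal.mem_antidiagonal.1 x.2)]

theorem wedge_zsmul_left (B : N₁ →ₗ[R] N₂ →ₗ[R] N₃) {k l n : ℕ} (h : k + l = n) (c : ℤ)
    (f : P [⋀^Fin k]→ₗ[R] N₁) (g : P [⋀^Fin l]→ₗ[R] N₂) :
    wedge B h (c • f) g = c • wedge B h f g :=
  map_zsmul (AddMonoidHom.mk' (fun f => wedge B h f g) fun f f' => wedge_add_left B h f f' g) c f

theorem wedge_zsmul_right (B : N₁ →ₗ[R] N₂ →ₗ[R] N₃) {k l n : ℕ} (h : k + l = n) (c : ℤ)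
    (f : P [⋀^Fin k]→ₗ[R] N₁) (g : P [⋀^Fin l]→ₗ[R] N₂) :
    wedge B h f (c • g) = c • wedge B h f g :=
  map_zsmul (AddMonoidHom.mk' (fun g => wedge B h f g) fun g g' => wedge_add_right B h f g g') c g

theorem wedgeAt_eps_right (B : N₁ →ₗ[R] N₂ →ₗ[R] N₃) (f : Fam R P N₁)
    (g : Fam R P N₂) (n k l : ℕ) :
    wedgeAt B f (eps g) n k l = (-1 : ℤ) ^ l • wedgeAt B f g n k l := by
  unfold wedgeAt
  split_ifs
  · exact wedge_zsmul_right _ _ _ _ _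
  · simp

theorem wedgeAt_eps_left (B : N₁ →ₗ[R] N₂ →ₗ[R] N₃) (f : Fam R P N₁)
    (g : Fam R P N₂) (n k l : ℕ) :
    wedgeAt B (eps f) g n k l = (-1 : ℤ) ^ k • wedgeAt B f g n k l := by
  unfold wedgeAt
  split_ifs
  · exact wedge_zsmul_left _ _ _ _ _
  · simp

theorem eps_star (B : N₁ →ₗ[R] N₂ →ₗ[R] N₃) (f : Fam R P N₁)
    (g : Fam R P N₂) : eps (star B f g) = star B (eps f) (eps g) := by
  ext1 n
  rw [eps_apply, star_apply, star_apply, Finset.smul_sum]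
  refine Finset.sum_congr rfl fun x hx => ?_
  rw [wedgeAt_eps_left, wedgeAt_eps_right, ← Finset.HasAntidiagonal.mem_antidiagonal.1 hx]
  simp only [smul_smul, pow_add]
  congr 1
  ring

section Real

variable [Module ℝ N₃]

theorem star_zero_form (B : N₁ →ₗ[R] N₂ →ₗ[R] N₃) (f : Fam R P N₁)
    (g : Fam R P N₂) (v : Fin 0 → P) :
    star B f g 0 v = B (f 0 ![]) (g 0 ![]) := by
  have h : star B f g 0 = wedgeAt B f g 0 0 0 := by
    rw [star_apply, Finset.Nat.antidiagonal_zero, Finset.sum_singleton]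
    simp
  rw [h, wedgeAt, dif_pos (add_zero 0), wedge_zero_form_left]
  congr 2
  exact Subsingleton.elim _ _

/-- Shift of a sequence, with value `0` at `0`. -/
def shift {G : Type*} [Zero G] (a : ℕ → G) : ℕ → G
  | 0 => 0
  | k + 1 => a k

/-- If one of the forms has degree 0, its contraction term is absent; `shift` inserts the zero so
that all cases share one formula. -/
theorem curryLeft_wedgeAt (B : N₁ →ₗ[R] N₂ →ₗ[R] N₃) (f : Fam R P N₁)
    (g : Fam R P N₂) (n k l : ℕ) (h : k + l = n + 1) (x : P) :
    (wedgeAt B f g (n + 1) k l).curryLeft x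
      = shift (fun k => wedgeAt B (ctr x f) g n k l) k
        + (-1 : ℤ) ^ k • shift (fun l => wedgeAt B f (ctr x g) n k l) l := by
  match k, l with
  | 0, 0 => omega
  | 0, l + 1 =>
    ext v
    obtain rfl : l = n := by omega
    simp only [shift]
    rw [wedgeAt, dif_pos h, wedgeAt, dif_pos (by omega), pow_zero, one_smul, zero_add,
      AlternatingMap.curryLeft_apply_apply, wedge_zero_form_left, wedge_zero_form_left]
    rfl
  | k + 1, 0 =>
    ext v
    obtain rfl : k = n := by omega
    simp only [shift]
    rw [wedgeAt, dif_pos h, wedgeAt, dif_pos (by omega), smul_zero, add_zero,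
      AlternatingMap.curryLeft_apply_apply, wedge_zero_form_right, wedge_zero_form_right]
    rfl
  | k + 1, l + 1 =>
    simp only [shift]
    rw [wedgeAt, dif_pos h, wedgeAt, dif_pos (by omega), wedgeAt, dif_pos (by omega)]
    exact curryLeft_wedge B h (f (k + 1)) (g (l + 1)) x

/-- The sign `(-1)^(kl)` in `star` is chosen for this rule: lowering `k` leaves `(-1)^l`, which is
`eps` on the right factor, and lowering `l` leaves a sign `(-1)^k` that cancels the one of the
antiderivation. -/
theorem ctr_star (B : N₁ →ₗ[R] N₂ →ₗ[R] N₃) (x : P) (f : Fam R P N₁)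
    (g : Fam R P N₂) :
    ctr x (star B f g) = star B (ctr x f) (eps g) + star B f (ctr x g) := by
  ext1 n
  have h0 : ctr x (star B f g) n = ∑ y ∈ Finset.HasAntidiagonal.antidiagonal (n + 1),
      (-1 : ℤ) ^ (y.1 * y.2) • (wedgeAt B f g (n + 1) y.1 y.2).curryLeft x := by
    ext v
    change evalHom (Fin.cons x v) (∑ y ∈ Finset.HasAntidiagonal.antidiagonal (n + 1), _)
      = evalHom v (∑ y ∈ Finset.HasAntidiagonal.antidiagonal (n + 1), _)
    rw [map_sum, map_sum]
    rfl
  rw [h0, Finset.sum_congr rfl (g := fun y => (-1 : ℤ) ^ (y.1 * y.2) •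
    (shift (fun k => wedgeAt B (ctr x f) g n k y.2) y.1
        + (-1 : ℤ) ^ y.1 • shift (fun l => wedgeAt B f (ctr x g) n y.1 l) y.2)) fun y hy => by
    rw [curryLeft_wedgeAt B f g n y.1 y.2 (Finset.HasAntidiagonal.mem_antidiagonal.1 hy) x]]
  simp only [smul_add, Finset.sum_add_distrib]
  rw [Finset.Nat.sum_antidiagonal_succ, Finset.Nat.sum_antidiagonal_succ']
  simp only [shift, smul_zero, zero_add, Pi.add_apply, star_apply, wedgeAt_eps_right, smul_smul]
  congr 1
  · refine Finset.sum_congr rfl fun y _ => ?_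
    congr 1
    ring
  · refine Finset.sum_congr rfl fun y _ => ?_
    congr 1
    rw [mul_add, mul_one, pow_add, mul_assoc, ← mul_pow]
    simp

end Real

end Forms

end FormAlgebra


/-! ### Associativity of the product and compatibility with pullback. -/

namespace Forms

section Assoc

variable {R P N₁ N₂ N₃ N₁₂ N₂₃ N : Type*} [CommRing R] [AddCommGroup P] [Module R P]
  [AddCommGroup N₁] [Module R N₁] [AddCommGroup N₂] [Module R N₂] [AddCommGroup N₃] [Module R N₃]
  [AddCommGroup N₁₂] [Module R N₁₂] [AddCommGroup N₂₃] [Module R N₂₃] [AddCommGroup N] [Module R N]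
  [Module ℝ N₁₂] [Module ℝ N₂₃] [Module ℝ N]

/-- Contracting either bracketing yields the same three terms, each covered by the induction
hypothesis in lower degree. -/
theorem star_assoc (B₁ : N₁ →ₗ[R] N₂ →ₗ[R] N₁₂) (B₂ : N₁₂ →ₗ[R] N₃ →ₗ[R] N)
    (B₃ : N₂ →ₗ[R] N₃ →ₗ[R] N₂₃) (B₄ : N₁ →ₗ[R] N₂₃ →ₗ[R] N)
    (hB : ∀ x y z, B₂ (B₁ x y) z = B₄ x (B₃ y z)) (f : Fam R P N₁) (g : Fam R P N₂)
    (h : Fam R P N₃) : star B₂ (star B₁ f g) h = star B₄ f (star B₃ g h) := by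
  ext1 n
  induction n generalizing f g h with
  | zero => exact ext_zero (by simp only [star_zero_form, hB])
  | succ n ih =>
    refine ext_succ fun x => ?_
    simp only [ctr_star, map_add, AddMonoidHom.add_apply, eps_star, Pi.add_apply, ih]
    abel

/-- The condition `hf` says that `f` has no component of positive degree. -/
theorem star_of_ctr_left (B : N₁ →ₗ[R] N₂ →ₗ[R] N) (f : Fam R P N₁) (hf : ∀ x, ctr x f = 0)
    (g : Fam R P N₂) (n : ℕ) (v : Fin n → P) : star B f g n v = B (f 0 ![]) (g n v) := by
  induction n generalizing g with
  | zero => rw [star_zero_form, Subsingleton.elim v ![]]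
  | succ n ih =>
    have h := ih (ctr (v 0) g) (Fin.tail v)
    rw [ctr_apply, Fin.cons_self_tail] at h
    rw [← h, ← Fin.cons_self_tail v, ← ctr_apply, ctr_star, hf]
    simp

theorem star_of_ctr_right (B : N₁ →ₗ[R] N₂ →ₗ[R] N) (f : Fam R P N₁)
    (g : Fam R P N₂) (hg : ∀ x, ctr x g = 0) (n : ℕ) (v : Fin n → P) :
    star B f g n v = B (f n v) (g 0 ![]) := by
  induction n generalizing f g with
  | zero => rw [star_zero_form, Subsingleton.elim v ![]]
  | succ n ih =>
    have h := ih (ctr (v 0) f) (eps g) (by simp [ctr_eps, hg]) (Fin.tail v)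
    rw [ctr_apply, Fin.cons_self_tail, eps_zero_form] at h
    rw [← h, ← Fin.cons_self_tail v, ← ctr_apply, ctr_star, hg]
    simp

/-- Composition of a family of forms with a linear map of the values. -/
def map (L : N₁ →ₗ[R] N₂) : Fam R P N₁ →+ Fam R P N₂ where
  toFun f n := L.compAlternatingMap (f n)
  map_zero' := by ext; simp
  map_add' _ _ := by ext; simp

theorem ctr_map (L : N₁ →ₗ[R] N₂) (x : P) (f : Fam R P N₁) :
    ctr x (map L f) = map L (ctr x f) := rfl

variable {P' : Type*} [AddCommGroup P'] [Module R P']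

/-- Pullback of a family of forms. -/
def pull (i : P' →ₗ[R] P) : Fam R P N₁ →+ Fam R P' N₁ where
  toFun f n := (f n).compLinearMap i
  map_zero' := by ext; simp
  map_add' _ _ := by ext; simp

theorem pull_apply (i : P' →ₗ[R] P) (f : Fam R P N₁) (n : ℕ) (v : Fin n → P') :
    pull i f n v = f n fun j => i (v j) := rfl

theorem ctr_pull (i : P' →ₗ[R] P) (x : P') (f : Fam R P N₁) :
    ctr x (pull i f) = pull i (ctr (i x) f) := by
  ext n v
  rw [ctr_apply, pull_apply, pull_apply, ctr_apply]
  congr 1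
  ext j
  refine Fin.cases ?_ (fun j => ?_) j <;> simp

theorem eps_pull (i : P' →ₗ[R] P) (f : Fam R P N₁) : eps (pull i f) = pull i (eps f) := by
  ext n v
  simp [eps_apply, pull_apply]

theorem pull_star (i : P' →ₗ[R] P) (B : N₁ →ₗ[R] N₂ →ₗ[R] N) (f : Fam R P N₁)
    (g : Fam R P N₂) : pull i (star B f g) = star B (pull i f) (pull i g) := by
  ext1 n
  induction n generalizing f g with
  | zero =>
    refine ext_zero ?_
    simp only [pull_apply, star_zero_form]
    congr 2 <;> congr 1 <;> exact Subsingleton.elim _ _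
  | succ n ih =>
    refine ext_succ fun x => ?_
    simp only [ctr_pull, ctr_star, map_add, eps_pull, Pi.add_apply, ih]

end Assoc

end Forms

/-! ### Cartan calculus for a linear connection. -/

namespace Connection

variable {R P N N₁ N₂ N₃ : Type*} [CommRing R] [Algebra ℝ R]
  [LieRing P] [Module R P] [LieRingModule P R] [LieAlgebra ℝ P]
  [LieRinehartRing R P] [LieRinehartAlgebra ℝ R P]
  [AddCommGroup N] [Module R N] [Module ℝ N] [IsScalarTower ℝ R N]
  [AddCommGroup N₁] [Module R N₁] [Module ℝ N₁] [IsScalarTower ℝ R N₁]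
  [AddCommGroup N₂] [Module R N₂] [Module ℝ N₂] [IsScalarTower ℝ R N₂]
  [AddCommGroup N₃] [Module R N₃] [Module ℝ N₃] [IsScalarTower ℝ R N₃]

open Forms

variable (D : Connection R P N)

theorem dForms_zero (x : Forms R P N) : D.dForms x 0 = 0 := rfl

theorem dForms_succ (x : Forms R P N) (n : ℕ) : D.dForms x (n + 1) = D.d (x n) := rfl

theorem dForms_eps (x : Forms R P N) : D.dForms (eps x) = -eps (D.dForms x) := by
  ext1 n
  cases n with
  | zero => simp [dForms_zero, eps_apply]
  | succ n =>
    change D.dLin n ((-1 : ℤ) ^ n • x n) = -((-1 : ℤ) ^ (n + 1) • D.dLin n (x n))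
    rw [map_zsmul, pow_succ, mul_neg_one, neg_smul, neg_neg]

/-- The Lie derivative on families of forms, given by Cartan's formula. -/
def lieD (a : P) : Forms R P N →+ Forms R P N where
  toFun x := ctr a (D.dForms x) + D.dForms (ctr a x)
  map_zero' := by simp
  map_add' x y := by simp only [map_add]; abel

theorem lieD_def (a : P) (x : Forms R P N) :
    D.lieD a x = ctr a (D.dForms x) + D.dForms (ctr a x) := rfl

theorem ctr_dForms (a : P) (x : Forms R P N) :
    ctr a (D.dForms x) = D.lieD a x - D.dForms (ctr a x) := by
  rw [lieD_def, add_sub_cancel_right]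

theorem map_update_eq {n : ℕ} (u : P [⋀^Fin (n + 1)]→ₗ[R] N) (w : Fin (n + 1) → P)
    (i : Fin (n + 1)) (x : P) :
    u (Function.update w i x) = (-1 : ℤ) ^ (i : ℕ) • u (Fin.cons x (Fin.removeNth i w)) := by
  have := u.map_insertNth i x (Fin.removeNth i w)
  rwa [Fin.insertNth_removeNth] at this

/-- Cartan's formula is thereby matched with the classical Lie derivative; this is the only place
where the explicit formula for `d` is unfolded against a contraction. -/
theorem lieD_apply (a : P) (x : Forms R P N) (n : ℕ) (v : Fin n → P) :
    D.lieD a x n v = D a (x n v) - ∑ j, x n (Function.update v j ⁅a, v j⁆) := by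
  cases n with
  | zero =>
    rw [lieD_def, Pi.add_apply, dForms_zero, add_zero, ctr_apply, dForms_succ, d_apply]
    simp
  | succ m =>
    rw [lieD_def, Pi.add_apply, AlternatingMap.add_apply, ctr_apply, dForms_succ, d_apply,
      dForms_succ, d_apply]
    rw [Fin.sum_univ_succ]
    have hrem : ∀ (i : Fin (m + 1)), Fin.removeNth i.succ (Fin.cons a v : Fin (m + 2) → P)
        = Fin.cons a (Fin.removeNth i v) := by
      intro i
      ext j
      refine Fin.cases ?_ (fun j => ?_) j <;> simp [Fin.removeNth]
    have hrem0 : Fin.removeNth 0 (Fin.cons a v : Fin (m + 2) → P) = v := by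
      ext j; simp [Fin.removeNth]
    have hneg : ∀ i : Fin (m + 1), x (m + 1) (Fin.cons ⁅v i, a⁆ (Fin.removeNth i v))
        = -((-1 : ℤ) ^ (i : ℕ) • x (m + 1) (Function.update v i ⁅a, v i⁆)) := by
      intro i
      rw [map_update_eq, smul_smul, ← mul_pow, ← lie_skew]
      have := (x (m + 1)).map_update_neg (Fin.cons ⁅a, v i⁆ (Fin.removeNth i v)) 0 ⁅a, v i⁆
      simpa using this
    -- The slot containing `a` is split off from the bracket sum; it contributes `⁅v i, a⁆`.
    have hin : ∀ i : Fin (m + 1), ∑ j, x (m + 1) (Function.update (Fin.cons a (Fin.removeNth i v)) j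
        ⁅v i, (Fin.cons a (Fin.removeNth i v) : Fin (m + 1) → P) j⁆)
        = -((-1 : ℤ) ^ (i : ℕ) • x (m + 1) (Function.update v i ⁅a, v i⁆))
          + ∑ j, ctr a x m (Function.update (Fin.removeNth i v) j ⁅v i, Fin.removeNth i v j⁆) := by
      intro i
      rw [Fin.sum_univ_succ, ← hneg]
      simp only [Fin.cons_zero, Fin.cons_succ, Fin.update_cons_zero, ← Fin.cons_update, ctr_apply]
    simp only [hrem, hrem0, Fin.cons_zero, Fin.cons_succ, Fin.val_zero, pow_zero, one_smul,
      Fin.val_succ, hin, ctr_apply]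
    rw [add_assoc, ← Finset.sum_add_distrib, sub_add, sub_right_inj]
    -- The derivative terms of `d (ctr a x)` cancel. One half of each bracket of `a` with `v i`
    -- survives here, and the other half comes from the term of `d` that differentiates along `a`.
    have hs : ∀ i : Fin (m + 1), (-1 : ℤ) ^ ((i : ℕ) + 1) •
          (D (v i) (x (m + 1) (Fin.cons a (Fin.removeNth i v)))
            - (2⁻¹ : ℝ) • (-((-1 : ℤ) ^ (i : ℕ) • x (m + 1) (Function.update v i ⁅a, v i⁆))
              + ∑ j, x (m + 1) (Fin.cons a (Function.update (Fin.removeNth i v) j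
                  ⁅v i, Fin.removeNth i v j⁆))))
        + (-1 : ℤ) ^ (i : ℕ) • (D (v i) (x (m + 1) (Fin.cons a (Fin.removeNth i v)))
            - (2⁻¹ : ℝ) • ∑ j, x (m + 1) (Fin.cons a (Function.update (Fin.removeNth i v) j
                  ⁅v i, Fin.removeNth i v j⁆)))
        = -((2⁻¹ : ℝ) • x (m + 1) (Function.update v i ⁅a, v i⁆)) := by
      intro i
      rcases neg_one_pow_eq_or ℤ (i : ℕ) with h | h <;>
        simp only [pow_succ, h] <;> module
    rw [Finset.sum_congr rfl fun i _ => hs i, Finset.sum_neg_distrib, sub_neg_eq_add,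
      ← Finset.smul_sum]
    module

theorem lieD_zero_form (a : P) (x : Forms R P N) (v : Fin 0 → P) :
    D.lieD a x 0 v = D a (x 0 ![]) := by
  rw [lieD_apply, Finset.univ_eq_empty, Finset.sum_empty, sub_zero, Subsingleton.elim v ![]]

theorem lieD_eps (a : P) (x : Forms R P N) : D.lieD a (eps x) = eps (D.lieD a x) := by
  simp only [lieD_def, ctr_eps, dForms_eps, map_neg, map_add]
  abel

theorem ctr_lieD (a b : P) (x : Forms R P N) :
    ctr b (D.lieD a x) = D.lieD a (ctr b x) - ctr ⁅a, b⁆ x := by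
  ext n v
  rw [ctr_apply, lieD_apply, Pi.sub_apply, AlternatingMap.sub_apply, lieD_apply, ctr_apply,
    Fin.sum_univ_succ, ctr_apply]
  simp only [Fin.cons_zero, Fin.update_cons_zero, Fin.cons_succ, ← Fin.cons_update, ctr_apply]
  abel

section Leibniz

variable {D₁ : Connection R P N₁} {D₂ : Connection R P N₂} {D₃ : Connection R P N₃}
  {B : N₁ →ₗ[R] N₂ →ₗ[R] N₃}

/-- The commutator of a Lie derivative with a contraction is again a contraction, along `⁅a, b⁆`, so
the derivation property passes through the induction on the form degree. -/
theorem lieD_star (hB : ∀ a x y, D₃ a (B x y) = B (D₁ a x) y + B x (D₂ a y)) (a : P)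
    (f : Forms R P N₁) (g : Forms R P N₂) :
    D₃.lieD a (star B f g) = star B (D₁.lieD a f) g + star B f (D₂.lieD a g) := by
  ext1 n
  induction n generalizing f g with
  | zero =>
    refine ext_zero ?_
    rw [Pi.add_apply, AlternatingMap.add_apply]
    simp only [lieD_zero_form, star_zero_form, hB]
  | succ n ih =>
    refine ext_succ fun x => ?_
    simp only [ctr_lieD, ctr_star, map_add, map_sub, AddMonoidHom.sub_apply,
      Pi.add_apply, Pi.sub_apply, ih, lieD_eps]
    abel

/-- By Cartan's formula a contraction of `d` is a Lie derivative minus `d` of a contraction, so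
`lieD_star` and the lower degree case suffice. -/
theorem dForms_star (hB : ∀ a x y, D₃ a (B x y) = B (D₁ a x) y + B x (D₂ a y))
    (f : Forms R P N₁) (g : Forms R P N₂) :
    D₃.dForms (star B f g) = star B (D₁.dForms f) (eps g) + star B f (D₂.dForms g) := by
  ext1 n
  induction n generalizing f g with
  | zero =>
    refine ext_zero ?_
    rw [Pi.add_apply, AlternatingMap.add_apply]
    simp [star_zero_form, dForms_zero]
  | succ n ih =>
    refine ext_succ fun x => ?_
    have h1 := ih (ctr x f) (eps g)
    have h2 := ih f (ctr x g)
    simp only [Pi.add_apply] at h1 h2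
    simp only [ctr_dForms, ctr_star, map_add, map_sub, AddMonoidHom.sub_apply, eps_eps,
      Pi.add_apply, Pi.sub_apply, h1, h2, lieD_star hB, ctr_eps, dForms_eps, map_neg, Pi.neg_apply]
    abel

end Leibniz

/-- The evaluation pairing. -/
abbrev ev (R N : Type*) [CommRing R] [AddCommGroup N] [Module R N] :
    Module.End R N →ₗ[R] N →ₗ[R] N := LinearMap.id

theorem ctr_ctr_curvatureForms (a b : P) :
    ctr b (ctr a D.curvatureForms) 0 ![] = D.curvature ![a, b] := by
  rw [ctr_apply, ctr_apply]
  change D.curvature _ = _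
  congr 1

theorem ctr_ctr_ctr_curvatureForms (a b c : P) :
    ctr c (ctr b (ctr a D.curvatureForms)) = 0 := by
  ext n v
  rfl

/-- This is the first of three commutation relations, each proved by contracting and applying the
preceding one: `[L_a, L_b] - L_⁅a,b⁆ = R(a, b)`, then `[L_a, d] = i_a R`, then `d² = R`. Contracting
the first relation itself only uses the Jacobi identity. -/
theorem lieD_lieD (a b : P) (x : Forms R P N) :
    D.lieD a (D.lieD b x) - D.lieD b (D.lieD a x) - D.lieD ⁅a, b⁆ x
      = star (ev R N) (ctr b (ctr a D.curvatureForms)) x := by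
  ext1 n
  induction n generalizing x with
  | zero =>
    refine ext_zero ?_
    rw [star_zero_form, ctr_ctr_curvatureForms, Pi.sub_apply, Pi.sub_apply,
      AlternatingMap.sub_apply, AlternatingMap.sub_apply]
    simp only [lieD_zero_form]
    rfl
  | succ n ih =>
    refine ext_succ fun c => ?_
    rw [ctr_star, ctr_ctr_ctr_curvatureForms, map_zero, AddMonoidHom.zero_apply, zero_add, ← ih]
    simp only [map_sub, ctr_lieD, lie_lie, ctr_sub_left, Pi.sub_apply]
    abel

theorem lieD_dForms (a : P) (x : Forms R P N) :
    D.lieD a (D.dForms x) - D.dForms (D.lieD a x)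
      = star (ev R N) (ctr a D.curvatureForms) (eps x) := by
  ext1 n
  induction n generalizing x with
  | zero =>
    refine ext_zero ?_
    rw [star_zero_form, Pi.sub_apply, AlternatingMap.sub_apply, lieD_zero_form, dForms_zero,
      dForms_zero]
    simp [ctr_apply]
    rfl
  | succ n ih =>
    refine ext_succ fun b => ?_
    have h := ih (ctr b x)
    have h2 := congrFun (D.lieD_lieD a b x) n
    rw [ctr_star, eps_eps, ctr_eps, map_neg, ← sub_eq_add_neg, Pi.sub_apply, ← h, ← h2]
    simp only [map_sub, ctr_lieD, ctr_dForms, Pi.sub_apply]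
    abel

theorem dForms_dForms (x : Forms R P N) :
    D.dForms (D.dForms x) = star (ev R N) D.curvatureForms x := by
  ext1 n
  induction n generalizing x with
  | zero =>
    refine ext_zero ?_
    rw [star_zero_form, dForms_zero]
    rfl
  | succ n ih =>
    refine ext_succ fun b => ?_
    rw [ctr_star, Pi.add_apply, ← ih, ← D.lieD_dForms]
    simp only [map_sub, ctr_dForms, Pi.sub_apply]
    abel

end Connection


namespace Forms

section

variable {R P N N₁ N₂ N₃ : Type*} [CommRing R] [AddCommGroup P] [Module R P]
  [AddCommGroup N] [Module R N] [AddCommGroup N₁] [Module R N₁] [AddCommGroup N₂] [Module R N₂]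
  [AddCommGroup N₃] [Module R N₃]

theorem ctr_ctr (x y : P) (f : Fam R P N) : ctr x (ctr y f) = -ctr y (ctr x f) := by
  ext n v
  rw [Pi.neg_apply, AlternatingMap.neg_apply, ctr_apply, ctr_apply, ctr_apply, ctr_apply]
  have h : (Fin.cons y (Fin.cons x v) : Fin (n + 2) → P)
      = (Fin.cons x (Fin.cons y v) : Fin (n + 2) → P) ∘ Equiv.swap 0 1 := by
    ext i
    refine Fin.cases ?_ (fun i => Fin.cases ?_ (fun i => ?_) i) i
    · simp
    · simp
    · rw [Function.comp_apply, Equiv.swap_apply_of_ne_of_ne (by simp) (by simp [Fin.ext_iff])]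
      simp
  rw [h, (f (n + 2)).map_swap _ (by simp)]

/-- The family of forms with a given component of degree `0` and no others. -/
def const (P : Type*) [AddCommGroup P] [Module R P] (e : N) : Fam R P N
  | 0 => AlternatingMap.constOfIsEmpty R P (Fin 0) e
  | _ + 1 => 0

theorem ctr_const (e : N) (x : P) : ctr x (const (R := R) P e) = 0 := rfl

theorem sum_zsmul_apply {ι : Type*} (s : Finset ι) (c : ι → ℤ) {n : ℕ}
    (W : ι → P [⋀^Fin n]→ₗ[R] N) (v : Fin n → P) :
    (∑ x ∈ s, c x • W x) v = ∑ x ∈ s, c x • W x v := by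
  change evalHom v (∑ x ∈ s, c x • W x) = _
  rw [map_sum]
  rfl

theorem star_apply_apply (B : N₁ →ₗ[R] N₂ →ₗ[R] N₃) (f : Fam R P N₁) (g : Fam R P N₂) (n : ℕ)
    (v : Fin n → P) : star B f g n v = ∑ x ∈ Finset.HasAntidiagonal.antidiagonal n,
      (-1 : ℤ) ^ (x.1 * x.2) • wedgeAt B f g n x.1 x.2 v := sum_zsmul_apply _ _ _ _

theorem wedgeAt_eps_left_apply (B : N₁ →ₗ[R] N₂ →ₗ[R] N₃) (f : Fam R P N₁) (g : Fam R P N₂)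
    (n k l : ℕ) (v : Fin n → P) :
    wedgeAt B (eps f) g n k l v = (-1 : ℤ) ^ k • wedgeAt B f g n k l v := by
  rw [wedgeAt_eps_left]; rfl

theorem wedgeAt_eps_right_apply (B : N₁ →ₗ[R] N₂ →ₗ[R] N₃) (f : Fam R P N₁) (g : Fam R P N₂)
    (n k l : ℕ) (v : Fin n → P) :
    wedgeAt B f (eps g) n k l v = (-1 : ℤ) ^ l • wedgeAt B f g n k l v := by
  rw [wedgeAt_eps_right]; rfl

theorem star_mem (B : N₁ →ₗ[R] N₂ →ₗ[R] N₃) (f : Fam R P N₁) (g : Fam R P N₂) (n : ℕ)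
    (S : Submodule R N₃) (hS : ∀ k l, k + l = n → ∀ v w, B (f k v) (g l w) ∈ S) (v : Fin n → P) :
    star B f g n v ∈ S := by
  change evalHom v (star B f g n) ∈ S
  rw [star_apply, map_sum]
  refine Submodule.sum_mem _ fun x hx => ?_
  rw [map_zsmul]
  have h := Finset.HasAntidiagonal.mem_antidiagonal.1 hx
  rw [wedgeAt, dif_pos h]
  exact zsmul_mem (wedge_mem _ _ _ _ _ (hS _ _ h) v) _

variable [Module ℝ N]

/-- Identities between endomorphism-valued families become identities between operators, where
associativity of composition is automatic; constant 0-forms already detect equality. -/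
theorem ev_ext {f g : Fam R P (Module.End R N)}
    (h : ∀ x, star (Connection.ev R N) f x = star (Connection.ev R N) g x) : f = g := by
  ext n v e
  have := DFunLike.congr_fun (congrFun (h (const P e)) n) v
  rwa [star_of_ctr_right _ _ _ (ctr_const e), star_of_ctr_right _ _ _ (ctr_const e)] at this

end

end Forms

open Forms

theorem negOnePow_one_sub_mul (s t : ℕ) :
    (((1 - (s : ℤ)) * (t : ℤ)).negOnePow : ℤ) = (-1) ^ (s * t) * (-1) ^ t := by
  have h : ((1 - (s : ℤ)) * (t : ℤ)).negOnePow = ((s * t + t : ℕ) : ℤ).negOnePow := by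
    rw [Int.negOnePow_eq_iff]
    refine ⟨-(s * t : ℤ), ?_⟩
    push_cast
    ring
  rw [h, ← pow_add]
  rw [Int.negOnePow_def, zpow_natCast]
  simp

/-! ### Superconnections as operators: square, Bianchi identity, perturbation. -/

namespace Superconnection

variable {R : Type*} [CommRing R] [Algebra ℝ R] {P : Type*}
    [LieRing P] [Module R P] [LieRingModule P R] [LieAlgebra ℝ P]
    [LieRinehartRing R P] [LieRinehartAlgebra ℝ R P]
    {X : ℤ → Type*} [∀ i, AddCommGroup (X i)] [∀ i, Module R (X i)] [∀ i, Module ℝ (X i)]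
    [∀ i, IsScalarTower ℝ R (X i)] (D : Superconnection R P X)

variable (R X) in
/-- The composition pairing of endomorphisms. -/
abbrev compEnd : Module.End R (⨁ i, X i) →ₗ[R] Module.End R (⨁ i, X i) →ₗ[R]
    Module.End R (⨁ i, X i) := LinearMap.mul R (Module.End R (⨁ i, X i))

variable (R X) in
/-- The evaluation pairing of endomorphisms. -/
abbrev evEnd : Module.End R (⨁ i, X i) →ₗ[R] (⨁ i, X i) →ₗ[R] (⨁ i, X i) :=
  Connection.ev R (⨁ i, X i)

/-- The Koszul exponent `(1 - s) t` is congruent to `st + t` modulo 2: the first summand is built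
into `star`, the second is `eps` on the right factor. -/
theorem formSq_eq : D.formSq = star (compEnd R X) D.form (eps D.form) := by
  ext1 n
  rw [star_apply]
  refine (Forms.sum_attach_wedge (compEnd R X) D.form D.form n
    (fun s t => (((1 - (s : ℤ)) * (t : ℤ)).negOnePow : ℤ))).trans ?_
  refine Finset.sum_congr rfl fun x _ => ?_
  rw [wedgeAt_eps_right, negOnePow_one_sub_mul, mul_smul]

theorem curv_eq : D.curv = D.conn.curvatureForms + D.endConn.dForms D.form
    + star (compEnd R X) D.form (eps D.form) := by
  rw [← formSq_eq]
  rfl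

/-- The operator of the superconnection on forms with values in `⨁ i, X i`. -/
def op (x : Fam R P (⨁ i, X i)) : Fam R P (⨁ i, X i) :=
  D.conn.dForms x + star (evEnd R X) D.form (eps x)

theorem star_evEnd (f g : Fam R P (Module.End R (⨁ i, X i))) (x : Fam R P (⨁ i, X i)) :
    star (evEnd R X) f (star (evEnd R X) g x) = star (evEnd R X) (star (compEnd R X) f g) x :=
  (star_assoc _ _ _ _ (fun _ _ _ => rfl) f g x).symm

theorem dForms_evEnd (f : Fam R P (Module.End R (⨁ i, X i))) (x : Fam R P (⨁ i, X i)) :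
    D.conn.dForms (star (evEnd R X) f x)
      = star (evEnd R X) (D.endConn.dForms f) (eps x) + star (evEnd R X) f (D.conn.dForms x) :=
  Connection.dForms_star (fun a φ e => by
    change _ = (D.conn a (φ e) - φ (D.conn a e)) + φ (D.conn a e)
    rw [sub_add_cancel]
    rfl) f x

/-- The terms in which `d^∇` meets `dForms x` appear twice with opposite signs, because `d^∇`
anticommutes with `eps`; the rest is multiplication by `D.curv`. -/
theorem op_op (x : Fam R P (⨁ i, X i)) : D.op (D.op x) = star (evEnd R X) D.curv x := by
  rw [curv_eq]
  simp only [op, map_add, AddMonoidHom.add_apply, dForms_evEnd, eps_star, star_evEnd, eps_eps,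
    Connection.dForms_dForms, Connection.dForms_eps, map_neg]
  abel

/-- The graded commutator with families of even total degree. -/
def brEven (η : Fam R P (Module.End R (⨁ i, X i))) : Fam R P (Module.End R (⨁ i, X i)) :=
  D.endConn.dForms η + star (compEnd R X) D.form (eps η) - star (compEnd R X) η D.form

/-- The graded commutator with families of odd total degree. -/
def brOdd (η : Fam R P (Module.End R (⨁ i, X i))) : Fam R P (Module.End R (⨁ i, X i)) :=
  D.endConn.dForms η + star (compEnd R X) D.form (eps η) + star (compEnd R X) η (eps D.form)

/-- The Bianchi identity. -/
theorem brEven_curv : D.brEven D.curv = 0 := by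
  refine ev_ext fun x => ?_
  -- The cube of the operator is read as `D ∘ D²` and as `D² ∘ D`.
  have h : D.op (D.op (D.op (eps x))) = star (evEnd R X) D.curv (D.op (eps x)) := D.op_op _
  rw [D.op_op (eps x)] at h
  simp only [op, dForms_evEnd, eps_star, star_evEnd, eps_eps, map_add] at h
  simp only [brEven, map_sub, map_add, AddMonoidHom.sub_apply, AddMonoidHom.add_apply, map_zero,
    AddMonoidHom.zero_apply]
  rw [sub_eq_zero]
  refine add_right_cancel (b := star (evEnd R X) D.curv (D.conn.dForms (eps x))) ?_
  rw [add_comm (star (evEnd R X) (star (compEnd R X) D.curv D.form) x), ← h]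
  abel

/-- For an odd family the graded commutator is an anticommutator of operators; acting by an odd
family includes `eps` on the argument. -/
theorem op_odd (η : Fam R P (Module.End R (⨁ i, X i))) (x : Fam R P (⨁ i, X i)) :
    D.op (star (evEnd R X) η (eps x)) + star (evEnd R X) η (eps (D.op x))
      = star (evEnd R X) (D.brOdd η) x := by
  simp only [op, brOdd, map_add, AddMonoidHom.add_apply, dForms_evEnd, eps_star, star_evEnd,
    eps_eps, Connection.dForms_eps, map_neg]
  abel

/-- The part of form degree one. -/
def partOne (η : Fam R P (Module.End R (⨁ i, X i))) : Fam R P (Module.End R (⨁ i, X i)) :=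
  fun k => if k = 1 then η k else 0

/-- The superconnection `D - η`, for a family `η` of total degree one. -/
def subFam (η : Fam R P (Module.End R (⨁ i, X i)))
    (hη : ∀ (k : ℕ) (a : Fin k → P), η k a ∈ endDeg R X (1 - k)) : Superconnection R P X where
  conn :=
    { toFun :=
        { toFun := fun a => D.conn a - (η 1 ![a]).restrictScalars ℝ
          map_add' := fun a b => by
            have h : η 1 ![a + b] = η 1 ![a] + η 1 ![b] :=
              DFunLike.congr_fun (map_add (η 1).curryLeft a b) ![]
            rw [h, map_add]
            ext e
            simp
            abel
          map_smul' := fun c a => by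
            have h : η 1 ![c • a] = c • η 1 ![a] :=
              DFunLike.congr_fun (map_smul (η 1).curryLeft c a) ![]
            rw [h, map_smul]
            ext e
            simp [smul_sub] }
      leibniz := fun a f e => by
        change D.conn a (f • e) - η 1 ![a] (f • e)
          = f • (D.conn a e - η 1 ![a] e) + ⁅a, f⁆ • e
        rw [D.conn.leibniz, map_smul, smul_sub]
        abel }
  conn_degree a i e := by
    refine Submodule.sub_mem _ (D.conn_degree a i e) ?_
    have h := hη 1 ![a] i e
    have h0 : i + (1 - ((1 : ℕ) : ℤ)) = i := by simp
    rwa [h0] at h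
  -- The component of `η` of form degree one is absorbed in the connection, so it is added back here
  -- to keep `form 1 = 0`.
  form := D.form - η + partOne η
  form_degree k a := by
    by_cases h : k = 1
    · subst h
      have : (D.form - η + partOne η) 1 = 0 := by
        simp [partOne, D.form_one, sub_eq_add_neg]
      rw [this]
      exact Submodule.zero_mem _
    · have : (D.form - η + partOne η) k = D.form k - η k := by
        simp [partOne, h]
      rw [this]
      exact Submodule.sub_mem _ (D.form_degree k a) (hη k a)
  form_one := by simp [partOne, D.form_one, sub_eq_add_neg]

variable (η : Fam R P (Module.End R (⨁ i, X i)))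
    (hη : ∀ (k : ℕ) (a : Fin k → P), η k a ∈ endDeg R X (1 - k))

theorem subFam_conn (a : P) (e : ⨁ i, X i) :
    (D.subFam η hη).conn a e = D.conn a e - η 1 ![a] e := rfl

theorem ctr_ctr_partOne (a b : P) : ctr b (ctr a (partOne η)) = 0 := by
  ext n v
  rfl

theorem subFam_lieD (a : P) (x : Fam R P (⨁ i, X i)) :
    (D.subFam η hη).conn.lieD a x
      = D.conn.lieD a x - star (evEnd R X) (ctr a (partOne η)) x := by
  ext n v
  rw [Pi.sub_apply, AlternatingMap.sub_apply, star_of_ctr_left _ _ (ctr_ctr_partOne η a),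
    Connection.lieD_apply, Connection.lieD_apply, subFam_conn, sub_right_comm]
  congr 3

theorem subFam_dForms (x : Fam R P (⨁ i, X i)) :
    (D.subFam η hη).conn.dForms x
      = D.conn.dForms x - star (evEnd R X) (partOne η) (eps x) := by
  ext1 n
  induction n generalizing x with
  | zero =>
    refine ext_zero ?_
    rw [Pi.sub_apply, AlternatingMap.sub_apply, star_zero_form, Connection.dForms_zero,
      Connection.dForms_zero]
    simp [partOne]
  | succ n ih =>
    refine ext_succ fun a => ?_
    have h := ih (ctr a x)
    simp only [Pi.sub_apply] at h
    simp only [Connection.ctr_dForms, map_sub, Pi.sub_apply, h, subFam_lieD, ctr_star, eps_eps,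
      ctr_eps, map_neg, Pi.add_apply, Pi.neg_apply]
    abel

theorem subFam_op (x : Fam R P (⨁ i, X i)) :
    (D.subFam η hη).op x = D.op x - star (evEnd R X) η (eps x) := by
  rw [op, op, subFam_dForms]
  change _ + star (evEnd R X) (D.form - η + partOne η) (eps x) = _
  simp only [map_sub, map_add, AddMonoidHom.sub_apply, AddMonoidHom.add_apply]
  abel

theorem op_sub (x y : Fam R P (⨁ i, X i)) : D.op (x - y) = D.op x - D.op y := by
  simp only [op, map_sub]
  abel

/-- This is the expansion of the square of `D - η`, obtained from the operators so that the
splitting into connection and forms plays no role. -/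
theorem subFam_curv : (D.subFam η hη).curv
    = D.curv - D.brOdd η + star (compEnd R X) η (eps η) := by
  refine ev_ext fun x => ?_
  rw [← op_op, subFam_op, subFam_op, op_sub, map_sub, map_sub]
  simp only [map_sub, map_add, AddMonoidHom.sub_apply, AddMonoidHom.add_apply]
  rw [← op_op, ← op_odd, eps_star, eps_eps, star_evEnd]
  abel

end Superconnection


open Forms

/-! ### Forms with values in `Hom(L/A, N)` as restrictions of forms on `L`. -/

section HatComplex

variable {R PA PL N : Type*} [CommRing R] [Algebra ℝ R]
  [LieRing PA] [Module R PA] [LieRingModule PA R] [LieAlgebra ℝ PA]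
  [LieRinehartRing R PA] [LieRinehartAlgebra ℝ R PA]
  [LieRing PL] [Module R PL] [LieRingModule PL R] [LieAlgebra ℝ PL]
  [LieRinehartRing R PL] [LieRinehartAlgebra ℝ R PL]
  [AddCommGroup N] [Module R N] [Module ℝ N] [IsScalarTower ℝ R N]

/-- The value of a family of forms with values in `Hom(L/A, N)` at the class of `l`. -/
def slice (ι : LieRinehartHom R PA PL) (N : Type*) [AddCommGroup N] [Module R N] (l : PL) :
    Fam R PA (Normal ι →ₗ[R] N) →+ Fam R PA N :=
  Forms.map (LinearMap.applyₗ (Submodule.Quotient.mk (p := LinearMap.range ι.toLin) l))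

theorem slice_apply (ι : LieRinehartHom R PA PL) (l : PL) (u : Fam R PA (Normal ι →ₗ[R] N))
    (n : ℕ) (v : Fin n → PA) : slice ι N l u n v = u n v (Submodule.Quotient.mk l) := rfl

theorem slice_ext (ι : LieRinehartHom R PA PL) {u w : Fam R PA (Normal ι →ₗ[R] N)}
    (h : ∀ l, slice ι N l u = slice ι N l w) : u = w := by
  ext n v l
  exact DFunLike.congr_fun (congrFun (h l) n) v

/-- The family of forms on `A` with values in `Hom(L/A, N)` given by a family of forms on `L`
which vanishes on `A`. -/
def res (ι : LieRinehartHom R PA PL) (η : Fam R PL N) (hη : pull ι.toLin η = 0) :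
    Fam R PA (Normal ι →ₗ[R] N) := fun k =>
  restrictForm ι (η (k + 1)) fun v => DFunLike.congr_fun (congrFun hη (k + 1)) v

/-- In `restrictForm` the argument from `L` comes last, whereas `ctr` inserts it first; moving it
past `n` arguments produces `eps`. -/
theorem slice_res (ι : LieRinehartHom R PA PL) (η : Fam R PL N) (hη : pull ι.toLin η = 0)
    (l : PL) : slice ι N l (res ι η hη) = pull ι.toLin (eps (ctr l η)) := by
  ext n v
  rw [slice_apply, pull_apply, eps_apply, AlternatingMap.smul_apply, ctr_apply]
  have h := (η (n + 1)).map_insertNth (Fin.last n) l fun j => ι (v j)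
  rw [Fin.insertNth_last'] at h
  exact h

theorem res_congr (ι : LieRinehartHom R PA PL) {η η' : Fam R PL N} (h : η = η')
    (hη : pull ι.toLin η = 0) : res ι η hη = res ι η' (h ▸ hη) := by
  subst h; rfl

theorem res_zero (ι : LieRinehartHom R PA PL) : res ι (0 : Fam R PL N) (map_zero _) = 0 :=
  slice_ext ι fun l => by rw [slice_res]; simp

theorem Connection.Extends.lieD_pull {ι : LieRinehartHom R PA PL} {DA : Connection R PA N}
    {DL : Connection R PL N} (h : Connection.Extends ι DA DL) (a : PA) (x : Fam R PL N) :
    pull ι.toLin (DL.lieD (ι a) x) = DA.lieD a (pull ι.toLin x) := by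
  ext n v
  rw [pull_apply, Connection.lieD_apply, Connection.lieD_apply, h, pull_apply]
  congr 1
  refine Finset.sum_congr rfl fun j _ => ?_
  rw [pull_apply, ← ι.map_lie]
  congr 1
  ext i
  by_cases hi : i = j
  · subst hi; simp
  · simp [hi]

theorem Connection.Extends.dForms_pull {ι : LieRinehartHom R PA PL} {DA : Connection R PA N}
    {DL : Connection R PL N} (h : Connection.Extends ι DA DL) (x : Fam R PL N) :
    pull ι.toLin (DL.dForms x) = DA.dForms (pull ι.toLin x) := by
  ext1 n
  induction n generalizing x with
  | zero => rfl
  | succ n ih =>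
    refine ext_succ fun a => ?_
    rw [ctr_pull, Connection.ctr_dForms, map_sub, Connection.ctr_dForms, ctr_pull,
      Connection.Extends.lieD_pull h, Pi.sub_apply, ih, Pi.sub_apply]

/-- The additional term is the derivative of the class of `l` under the Bott connection. -/
theorem slice_lieD (ι : LieRinehartHom R PA PL) (D : Connection R PA N) (a : PA) (l : PL)
    (u : Fam R PA (Normal ι →ₗ[R] N)) :
    slice ι N l (((bott ι).hom D).lieD a u)
      = D.lieD a (slice ι N l u) - slice ι N ⁅ι a, l⁆ u := by
  ext n v
  rw [Pi.sub_apply, AlternatingMap.sub_apply, slice_apply, slice_apply, Connection.lieD_apply,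
    Connection.lieD_apply]
  change (D a (u n v (Submodule.Quotient.mk l)) - u n v (Submodule.Quotient.mk ⁅ι a, l⁆))
    - (LinearMap.applyₗ (Submodule.Quotient.mk (p := LinearMap.range ι.toLin) l) :
        (Normal ι →ₗ[R] N) →ₗ[R] N) (∑ j, u n (Function.update v j ⁅a, v j⁆))
    = (D a (u n v (Submodule.Quotient.mk l)) - ∑ j, slice ι N l u n (Function.update v j ⁅a, v j⁆))
      - u n v (Submodule.Quotient.mk ⁅ι a, l⁆)
  rw [map_sum, sub_right_comm]
  rfl

/-- The Bott term is exactly the commutator of the Lie derivative along `ι a` with contraction by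
`l`. Hence the covariant derivative on `Hom(L/A, N)` is the restriction of the one on `L`, by
induction over contractions with elements of `A`. -/
theorem slice_dForms_res {ι : LieRinehartHom R PA PL} {DA : Connection R PA N}
    {DL : Connection R PL N} (h : Connection.Extends ι DA DL) (η : Fam R PL N)
    (hη : pull ι.toLin η = 0) (l : PL) :
    slice ι N l (((bott ι).hom DA).dForms (res ι η hη))
      = pull ι.toLin (eps (ctr l (DL.dForms η))) := by
  ext1 n
  induction n generalizing η with
  | zero =>
    refine ext_zero ?_
    rw [slice_apply, Connection.dForms_zero, pull_apply, eps_zero_form,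
      Subsingleton.elim (fun j => ι.toLin (![] j)) ![], Connection.ctr_dForms, Pi.sub_apply,
      Connection.dForms_zero, sub_zero, Connection.lieD_zero_form]
    -- A 0-form has no arguments, so vanishing on `A` forces it to vanish.
    have h0 : η 0 ![] = 0 := by
      rw [← Subsingleton.elim (fun j => ι.toLin (![] j)) ![]]
      exact DFunLike.congr_fun (congrFun hη 0) ![]
    rw [h0, map_zero]
    rfl
  | succ n ih =>
    refine ext_succ fun a => ?_
    have hη' : pull ι.toLin (ctr (ι a) η) = 0 := by rw [← ctr_pull, hη, map_zero]
    have hr : ctr a (res ι η hη) = res ι (ctr (ι a) η) hη' := by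
      refine slice_ext ι fun l' => ?_
      rw [slice_res, slice, ← ctr_map]
      change ctr a (slice ι N l' (res ι η hη)) = _
      rw [slice_res, ctr_pull, ctr_eps, ctr_ctr, map_neg, map_neg, map_neg, neg_neg]
    have h1 : ctr a (slice ι N l (((bott ι).hom DA).dForms (res ι η hη)))
        = slice ι N l (ctr a (((bott ι).hom DA).dForms (res ι η hη))) := rfl
    have h2 := ih (ctr (ι a) η) hη'
    rw [h1, Connection.ctr_dForms, map_sub, slice_lieD, slice_res, slice_res, hr, Pi.sub_apply, h2,
      ctr_pull, ctr_eps, ctr_ctr, Connection.ctr_dForms DL (ι a) η, map_sub, Connection.ctr_lieD,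
      ← Connection.Extends.lieD_pull h, Connection.lieD_eps]
    simp only [map_sub, map_neg, neg_neg, Pi.sub_apply]

end HatComplex

/-! ### The differential `s` as the graded commutator with `D_L`. -/

namespace Superconnection

variable {R PA PL : Type*} [CommRing R] [Algebra ℝ R]
  [LieRing PA] [Module R PA] [LieRingModule PA R] [LieAlgebra ℝ PA]
  [LieRinehartRing R PA] [LieRinehartAlgebra ℝ R PA]
  [LieRing PL] [Module R PL] [LieRingModule PL R] [LieAlgebra ℝ PL]
  [LieRinehartRing R PL] [LieRinehartAlgebra ℝ R PL]
  {X : ℤ → Type*} [∀ i, AddCommGroup (X i)] [∀ i, Module R (X i)] [∀ i, Module ℝ (X i)]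
  [∀ i, IsScalarTower ℝ R (X i)]

theorem wedge_map {P N₁ N₂ N₃ M₁ M₂ M₃ : Type*} [AddCommGroup P] [Module R P]
    [AddCommGroup N₁] [Module R N₁] [AddCommGroup N₂] [Module R N₂] [AddCommGroup N₃] [Module R N₃]
    [AddCommGroup M₁] [Module R M₁] [AddCommGroup M₂] [Module R M₂] [AddCommGroup M₃] [Module R M₃]
    (B : N₁ →ₗ[R] N₂ →ₗ[R] N₃) (B' : M₁ →ₗ[R] M₂ →ₗ[R] M₃) (L₁ : N₁ →ₗ[R] M₁) (L₂ : N₂ →ₗ[R] M₂)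
    (L : N₃ →ₗ[R] M₃) (hL : ∀ x y, L (B x y) = B' (L₁ x) (L₂ y)) {k l n : ℕ} (h : k + l = n)
    (f : P [⋀^Fin k]→ₗ[R] N₁) (g : P [⋀^Fin l]→ₗ[R] N₂) (v : Fin n → P) :
    L (wedge B h f g v)
      = wedge B' h (L₁.compAlternatingMap f) (L₂.compAlternatingMap g) v := by
  rw [wedge_apply, wedge_apply]
  simp only [AlternatingMap.domCoprod_apply, sum_apply, map_sum]
  refine Finset.sum_congr rfl fun σ _ => ?_
  induction σ using Quotient.inductionOn' with | _ σ
  rw [AlternatingMap.domCoprod.summand_mk'', AlternatingMap.domCoprod.summand_mk'']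
  change L (TensorProduct.lift B ((Equiv.Perm.sign σ : ℤ) •
      ((f fun i => v (finCongr h (finSumFinEquiv (σ (Sum.inl i))))) ⊗ₜ[R]
        (g fun i => v (finCongr h (finSumFinEquiv (σ (Sum.inr i))))))))
    = TensorProduct.lift B' ((Equiv.Perm.sign σ : ℤ) •
      ((L₁ (f fun i => v (finCongr h (finSumFinEquiv (σ (Sum.inl i)))))) ⊗ₜ[R]
        (L₂ (g fun i => v (finCongr h (finSumFinEquiv (σ (Sum.inr i))))))))
  rw [map_zsmul, map_zsmul, map_zsmul, TensorProduct.lift.tmul, TensorProduct.lift.tmul, hL]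

theorem wedgeCommutator_apply {P S N : Type*} [AddCommGroup P] [Module R P]
    [AddCommGroup S] [Module R S] [AddCommGroup N] [Module R N] [Module ℝ N] [IsScalarTower ℝ R N]
    (B₁ : S →ₗ[R] N →ₗ[R] N) (B₂ : N →ₗ[R] S →ₗ[R] N) (ε₁ ε₂ : ℤˣ) {k l n : ℕ}
    (h : k + l = n) (η : P [⋀^Fin k]→ₗ[R] S) (u : P [⋀^Fin l]→ₗ[R] N) (v : Fin n → P) :
    wedgeCommutator B₁ B₂ ε₁ ε₂ h η u v = (ε₁ : ℤ) • wedge B₁ h η u v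
      - (ε₂ : ℤ) • wedge B₂ ((add_comm l k).trans h) u η v := rfl

theorem slice_hatBracket (ι : LieRinehartHom R PA PL) (DA : Superconnection R PA X) (p : ℤ) (l : PL)
    (u : Fam R PA (Normal ι →ₗ[R] Module.End R (⨁ i, X i))) (n : ℕ) (v : Fin n → PA) :
    slice ι _ l (hatBracket ι DA p u) n v =
      ∑ x ∈ Finset.HasAntidiagonal.antidiagonal n,
        (((1 - (x.1 : ℤ)) * (x.2 + 1)).negOnePow : ℤ) •
          wedgeAt (compEnd R X) DA.form (slice ι _ l u) n x.1 x.2 v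
      - ∑ x ∈ Finset.HasAntidiagonal.antidiagonal n,
        ((p + 1 + (p - x.1 + 1) * x.2).negOnePow : ℤ) •
          wedgeAt (compEnd R X) (slice ι _ l u) DA.form n x.1 x.2 v := by
  -- The antidiagonal is swapped in the second sum so that the first index is the form degree of the
  -- left factor `u`.
  rw [← Finset.Nat.sum_antidiagonal_swap (n := n) (f := fun x : ℕ × ℕ =>
    ((p + 1 + (p - (x.1 : ℤ) + 1) * (x.2 : ℤ)).negOnePow : ℤ) •
          wedgeAt (compEnd R X) (slice ι _ l u) DA.form n x.1 x.2 v), ← Finset.sum_sub_distrib]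
  rw [← Finset.sum_attach]
  have h0 : hatBracket ι DA p u n = ∑ x ∈ (Finset.HasAntidiagonal.antidiagonal n).attach,
      wedgeCommutator (N := Normal ι →ₗ[R] Module.End R (⨁ i, X i))
        (mulLeftHom R (Normal ι) (⨁ i, X i)) (mulRightHom R (Normal ι) (⨁ i, X i))
        (Int.negOnePow ((1 - (x.1.1 : ℤ)) * (x.1.2 + 1)))
        (Int.negOnePow (p + 1 + (p - x.1.2 + 1) * x.1.1))
        (Finset.HasAntidiagonal.mem_antidiagonal.1 x.2) (DA.form x.1.1) (u x.1.2) := by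
    simp only [hatBracket, LinearMap.pi_apply, LinearMap.sum_apply]
    rfl
  rw [slice_apply, h0]
  let L : (Normal ι →ₗ[R] Module.End R (⨁ i, X i)) →ₗ[R] Module.End R (⨁ i, X i) :=
    LinearMap.applyₗ (Submodule.Quotient.mk (p := LinearMap.range ι.toLin) l)
  let I : Module.End R (⨁ i, X i) →ₗ[R] Module.End R (⨁ i, X i) := LinearMap.id
  change L (evalHom v (∑ x ∈ (Finset.HasAntidiagonal.antidiagonal n).attach, _)) = _
  rw [map_sum, map_sum]
  refine Finset.sum_congr rfl fun x _ => ?_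
  have h1 := wedgeCommutator_apply (N := Normal ι →ₗ[R] Module.End R (⨁ i, X i))
        (mulLeftHom R (Normal ι) (⨁ i, X i)) (mulRightHom R (Normal ι) (⨁ i, X i))
        (Int.negOnePow ((1 - (x.1.1 : ℤ)) * (x.1.2 + 1)))
        (Int.negOnePow (p + 1 + (p - x.1.2 + 1) * x.1.1))
        (Finset.HasAntidiagonal.mem_antidiagonal.1 x.2) (DA.form x.1.1) (u x.1.2) v
  refine (congrArg L h1).trans ?_
  rw [map_sub, map_zsmul, map_zsmul, wedgeAt,
    dif_pos (Finset.HasAntidiagonal.mem_antidiagonal.1 x.2), wedgeAt,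
    dif_pos (show x.1.swap.1 + x.1.swap.2 = n from
      (add_comm _ _).trans (Finset.HasAntidiagonal.mem_antidiagonal.1 x.2))]
  congr 2
  · have hL : ∀ (φ : Module.End R (⨁ i, X i)) (ψ : Normal ι →ₗ[R] Module.End R (⨁ i, X i)),
        L (mulLeftHom R (Normal ι) (⨁ i, X i) φ ψ) = compEnd R X (I φ) (L ψ) :=
      fun _ _ => rfl
    exact wedge_map (P := PA) (N₁ := Module.End R (⨁ i, X i))
      (N₂ := Normal ι →ₗ[R] Module.End R (⨁ i, X i))
      (N₃ := Normal ι →ₗ[R] Module.End R (⨁ i, X i)) (M₁ := Module.End R (⨁ i, X i))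
      (M₂ := Module.End R (⨁ i, X i)) (M₃ := Module.End R (⨁ i, X i))
      _ (compEnd R X) I L L hL _ _ _ _
  · have hL : ∀ (ψ : Normal ι →ₗ[R] Module.End R (⨁ i, X i)) (φ : Module.End R (⨁ i, X i)),
        L (mulRightHom R (Normal ι) (⨁ i, X i) ψ φ) = compEnd R X (L ψ) (I φ) :=
      fun _ _ => rfl
    exact wedge_map (P := PA) (N₂ := Module.End R (⨁ i, X i))
      (N₁ := Normal ι →ₗ[R] Module.End R (⨁ i, X i))
      (N₃ := Normal ι →ₗ[R] Module.End R (⨁ i, X i)) (M₁ := Module.End R (⨁ i, X i))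
      (M₂ := Module.End R (⨁ i, X i)) (M₃ := Module.End R (⨁ i, X i))
      _ (compEnd R X) L I L hL _ _ _ _

theorem coe_negOnePow_eq {a : ℤ} {b : ℕ} (h : Even (a - b)) : (a.negOnePow : ℤ) = (-1) ^ b := by
  rw [(Int.negOnePow_eq_iff a b).2 h, Int.coe_negOnePow_natCast]

theorem star_eps_eps_apply (f g : Fam R PA (Module.End R (⨁ i, X i))) (n : ℕ) (v : Fin n → PA) :
    -star (compEnd R X) (eps f) (eps g) n v
      = ∑ x ∈ Finset.HasAntidiagonal.antidiagonal n,
        (((1 - (x.1 : ℤ)) * (x.2 + 1)).negOnePow : ℤ) • wedgeAt (compEnd R X) f g n x.1 x.2 v := by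
  rw [star_apply_apply, ← Finset.sum_neg_distrib]
  refine Finset.sum_congr rfl fun x _ => ?_
  rw [wedgeAt_eps_left_apply, wedgeAt_eps_right_apply, smul_smul, smul_smul, ← neg_smul,
    coe_negOnePow_eq (b := x.1 * x.2 + x.1 + x.2 + 1) ⟨-(x.1 * x.2) - x.1, by push_cast; ring⟩]
  congr 1
  ring

/-- Only total degrees 0 and 1 occur in the theorem; for each of them the exponents are reduced
modulo 2 to the signs of `star` and `eps`. -/
theorem slice_hatBracket_one (ι : LieRinehartHom R PA PL) (DA : Superconnection R PA X) (l : PL)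
    (u : Fam R PA (Normal ι →ₗ[R] Module.End R (⨁ i, X i))) :
    slice ι _ l (hatBracket ι DA 1 u)
      = -star (compEnd R X) (eps DA.form) (eps (slice ι _ l u))
        - star (compEnd R X) (slice ι _ l u) DA.form := by
  ext1 n
  refine AlternatingMap.ext fun v => ?_
  rw [slice_hatBracket, Pi.sub_apply, Pi.neg_apply, AlternatingMap.sub_apply,
    AlternatingMap.neg_apply, star_eps_eps_apply, star_apply_apply]
  congr 1
  refine Finset.sum_congr rfl fun x _ => ?_
  rw [coe_negOnePow_eq (b := x.1 * x.2) ⟨1 + x.2 - x.1 * x.2, by push_cast; ring⟩]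

theorem slice_hatBracket_zero (ι : LieRinehartHom R PA PL) (DA : Superconnection R PA X) (l : PL)
    (u : Fam R PA (Normal ι →ₗ[R] Module.End R (⨁ i, X i))) :
    slice ι _ l (hatBracket ι DA 0 u)
      = -star (compEnd R X) (eps DA.form) (eps (slice ι _ l u))
        + star (compEnd R X) (slice ι _ l u) (eps DA.form) := by
  ext1 n
  refine AlternatingMap.ext fun v => ?_
  rw [slice_hatBracket, Pi.add_apply, Pi.neg_apply, AlternatingMap.add_apply,
    AlternatingMap.neg_apply, star_eps_eps_apply, star_apply_apply, sub_eq_add_neg,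
    ← Finset.sum_neg_distrib]
  congr 1
  refine Finset.sum_congr rfl fun x _ => ?_
  rw [wedgeAt_eps_right_apply, smul_smul, ← neg_smul,
    coe_negOnePow_eq (b := x.1 * x.2 + x.2 + 1) ⟨-(x.1 * x.2), by push_cast; ring⟩]
  congr 1
  ring

variable {ι : LieRinehartHom R PA PL} {DA : Superconnection R PA X} {DL : Superconnection R PL X}

theorem Extends.form_pull (h : Extends ι DA DL) : pull ι.toLin DL.form = DA.form :=
  funext h.form_comp

theorem Extends.endConn (h : Extends ι DA DL) : Connection.Extends ι DA.endConn DL.endConn := by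
  intro a
  refine LinearMap.ext fun φ => LinearMap.ext fun e => ?_
  change DL.conn (ι a) (φ e) - φ (DL.conn (ι a) e) = DA.conn a (φ e) - φ (DA.conn a e)
  rw [h.conn]

theorem Extends.brEven_pull (h : Extends ι DA DL) (η : Fam R PL (Module.End R (⨁ i, X i)))
    (hη : pull ι.toLin η = 0) : pull ι.toLin (DL.brEven η) = 0 := by
  rw [brEven, map_sub, map_add, Connection.Extends.dForms_pull h.endConn, pull_star, pull_star,
    ← eps_pull, hη]
  simp

theorem Extends.brOdd_pull (h : Extends ι DA DL) (η : Fam R PL (Module.End R (⨁ i, X i)))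
    (hη : pull ι.toLin η = 0) : pull ι.toLin (DL.brOdd η) = 0 := by
  rw [brOdd, map_add, map_add, Connection.Extends.dForms_pull h.endConn, pull_star, pull_star,
    ← eps_pull, hη]
  simp

/-- After contraction with `l`, a product of `D_L.form` and `η` is a sum of two terms, and the one
in which `η` receives only arguments of `A` vanishes. What remains is the commutator with the forms
of `D_A`. A family of even total degree restricts to an odd one, since `A°` absorbs one form degree.
-/
theorem Extends.hatDiff_res_even (h : Extends ι DA DL) (η : Fam R PL (Module.End R (⨁ i, X i)))
    (hη : pull ι.toLin η = 0) :
    hatDiff ι DA 1 (res ι η hη) = res ι (DL.brEven η) (h.brEven_pull η hη) := by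
  refine slice_ext ι fun l => ?_
  rw [slice_res]
  change slice ι _ l (((bott ι).hom DA.endConn).dForms (res ι η hη)
    + hatBracket ι DA 1 (res ι η hη)) = _
  rw [map_add, slice_dForms_res h.endConn, slice_hatBracket_one, slice_res]
  simp only [brEven, map_add, map_sub, ctr_star, eps_star, pull_star, eps_eps, ctr_eps, map_neg,
    ← eps_pull, hη, h.form_pull, map_zero, AddMonoidHom.zero_apply]
  abel

theorem Extends.hatDiff_res_odd (h : Extends ι DA DL) (η : Fam R PL (Module.End R (⨁ i, X i)))
    (hη : pull ι.toLin η = 0) :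
    hatDiff ι DA 0 (res ι η hη) = res ι (DL.brOdd η) (h.brOdd_pull η hη) := by
  refine slice_ext ι fun l => ?_
  rw [slice_res]
  change slice ι _ l (((bott ι).hom DA.endConn).dForms (res ι η hη)
    + hatBracket ι DA 0 (res ι η hη)) = _
  rw [map_add, slice_dForms_res h.endConn, slice_hatBracket_zero, slice_res]
  simp only [brOdd, map_add, ctr_star, eps_star, pull_star, eps_eps, ctr_eps, map_neg,
    ← eps_pull, hη, h.form_pull, map_zero, AddMonoidHom.zero_apply]
  abel

theorem Extends.curv_pull (hflat : DA.IsFlat) (h : Extends ι DA DL) :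
    pull ι.toLin DL.curv = 0 := by
  ext1 k
  refine AlternatingMap.ext fun v => ?_
  exact (h.curv_comp k v).trans (DFunLike.congr_fun (hflat k) v)

/-- The cocycle is the restriction of `D_L²`, so its differential is the restriction of `[D_L, D_L²]
= 0`. -/
theorem hatDiff_atiyahCocycle (hflat : DA.IsFlat) (h : Extends ι DA DL) :
    hatDiff ι DA 1 (atiyahCocycle hflat h) = 0 := by
  have h1 := h.hatDiff_res_even DL.curv (h.curv_pull hflat)
  rw [res_congr ι DL.brEven_curv, res_zero] at h1
  exact h1

end Superconnection


open Forms

/-! ### Total degrees, and the change of the extending superconnection. -/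

section Degrees

variable {R : Type*} [CommRing R] {X : ℤ → Type*} [∀ i, AddCommGroup (X i)] [∀ i, Module R (X i)]

theorem lof_range_congr {i j : ℤ} (h : i = j) {x : ⨁ i, X i}
    (hx : x ∈ LinearMap.range (DirectSum.lof R ℤ X i)) :
    x ∈ LinearMap.range (DirectSum.lof R ℤ X j) := h ▸ hx

theorem endDeg_congr {i j : ℤ} (h : i = j) {φ : Module.End R (⨁ i, X i)}
    (hφ : φ ∈ endDeg R X i) : φ ∈ endDeg R X j := h ▸ hφ

theorem endDeg_apply {j i k : ℤ} {φ : Module.End R (⨁ i, X i)} (hφ : φ ∈ endDeg R X j)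
    {x : ⨁ i, X i} (hx : x ∈ LinearMap.range (DirectSum.lof R ℤ X i)) (h : i + j = k) :
    φ x ∈ LinearMap.range (DirectSum.lof R ℤ X k) := by
  obtain ⟨e, rfl⟩ := hx
  exact lof_range_congr h (hφ i e)

theorem endDeg_mul {i j k : ℤ} {φ ψ : Module.End R (⨁ i, X i)} (hφ : φ ∈ endDeg R X i)
    (hψ : ψ ∈ endDeg R X j) (h : i + j = k) : φ * ψ ∈ endDeg R X k := fun m e =>
  endDeg_apply hφ (hψ m e) (by omega)

theorem endDeg_real_smul [Algebra ℝ R] [∀ i, Module ℝ (X i)] [∀ i, IsScalarTower ℝ R (X i)] {j : ℤ}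
    {φ : Module.End R (⨁ i, X i)} (hφ : φ ∈ endDeg R X j) (c : ℝ) : c • φ ∈ endDeg R X j := by
  rw [← algebraMap_smul R c φ]
  exact Submodule.smul_mem _ _ hφ

end Degrees

namespace Superconnection

section

variable {R : Type*} [CommRing R] [Algebra ℝ R] {P : Type*}
    [LieRing P] [Module R P] [LieRingModule P R] [LieAlgebra ℝ P]
    [LieRinehartRing R P] [LieRinehartAlgebra ℝ R P]
    {X : ℤ → Type*} [∀ i, AddCommGroup (X i)] [∀ i, Module R (X i)] [∀ i, Module ℝ (X i)]
    [∀ i, IsScalarTower ℝ R (X i)] (D : Superconnection R P X)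

theorem conn_mem_range (a : P) {i : ℤ} {x : ⨁ i, X i}
    (hx : x ∈ LinearMap.range (DirectSum.lof R ℤ X i)) :
    D.conn a x ∈ LinearMap.range (DirectSum.lof R ℤ X i) := by
  obtain ⟨e, rfl⟩ := hx
  exact D.conn_degree a i e

theorem endConn_mem (a : P) {j : ℤ} {φ : Module.End R (⨁ i, X i)} (hφ : φ ∈ endDeg R X j) :
    D.endConn a φ ∈ endDeg R X j := fun i e =>
  Submodule.sub_mem _ (D.conn_mem_range a (hφ i e))
    (endDeg_apply hφ (D.conn_degree a i e) rfl)

theorem d_mem {n : ℕ} {j : ℤ} {u : P [⋀^Fin n]→ₗ[R] Module.End R (⨁ i, X i)}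
    (hu : ∀ v, u v ∈ endDeg R X j) (v : Fin (n + 1) → P) : D.endConn.d u v ∈ endDeg R X j := by
  rw [Connection.d_apply]
  refine Submodule.sum_mem _ fun i _ => zsmul_mem (Submodule.sub_mem _ (D.endConn_mem _ (hu _)) ?_) _
  exact endDeg_real_smul (Submodule.sum_mem _ fun j _ => hu _) _

/-- The square of an operator of total degree one has total degree two; each of the three summands
is checked separately. -/
theorem curv_mem (k : ℕ) (v : Fin k → P) : D.curv k v ∈ endDeg R X (2 - k) := by
  rw [curv_eq]
  refine Submodule.add_mem _ (Submodule.add_mem _ ?_ ?_) ?_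
  · match k with
    | 0 => exact Submodule.zero_mem _
    | 1 => exact Submodule.zero_mem _
    | 2 =>
      intro i e
      refine lof_range_congr (i := i) (by simp) ?_
      refine Submodule.sub_mem _ (Submodule.sub_mem _ ?_ ?_) (D.conn_degree _ i e)
      · exact D.conn_mem_range _ (D.conn_degree _ i e)
      · exact D.conn_mem_range _ (D.conn_degree _ i e)
    | k + 3 => exact Submodule.zero_mem _
  · cases k with
    | zero => exact Submodule.zero_mem _
    | succ k =>
      refine endDeg_congr ?_ (D.d_mem (D.form_degree k) v)
      push_cast; ring
  · refine star_mem _ _ _ _ _ (fun s t hst v w => ?_) v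
    refine endDeg_mul (D.form_degree s v) (j := 1 - t) ?_ (by push_cast [← hst]; ring)
    exact zsmul_mem (D.form_degree t w) _

end

variable {R PA PL : Type*} [CommRing R] [Algebra ℝ R]
  [LieRing PA] [Module R PA] [LieRingModule PA R] [LieAlgebra ℝ PA]
  [LieRinehartRing R PA] [LieRinehartAlgebra ℝ R PA]
  [LieRing PL] [Module R PL] [LieRingModule PL R] [LieAlgebra ℝ PL]
  [LieRinehartRing R PL] [LieRinehartAlgebra ℝ R PL]
  {X : ℤ → Type*} [∀ i, AddCommGroup (X i)] [∀ i, Module R (X i)] [∀ i, Module ℝ (X i)]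
  [∀ i, IsScalarTower ℝ R (X i)]
  {ι : LieRinehartHom R PA PL} {DA : Superconnection R PA X} {DL : Superconnection R PL X}

theorem atiyahCocycle_mem_cochains (hflat : DA.IsFlat) (h : Extends ι DA DL) :
    atiyahCocycle hflat h ∈ cochains ι X 1 := by
  intro n v l
  obtain ⟨l, rfl⟩ := Submodule.Quotient.mk_surjective _ l
  refine endDeg_congr ?_ (DL.curv_mem (n + 1) (Fin.snoc (α := fun _ => PL) (fun j => ι (v j)) l))
  push_cast; ring

theorem atiyahCocycle_mem_cocycles (hflat : DA.IsFlat) (h : Extends ι DA DL) :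
    atiyahCocycle hflat h ∈ cocycles ι DA 1 :=
  ⟨atiyahCocycle_mem_cochains hflat h, hatDiff_atiyahCocycle hflat h⟩

/-- The projection `Γ(L) → Γ(L/A)` as a family of forms. -/
def projForm (ι : LieRinehartHom R PA PL) : Fam R PL (Normal ι)
  | 1 => AlternatingMap.ofSubsingleton R PL (Normal ι) (0 : Fin 1)
      (Submodule.mkQ (LinearMap.range ι.toLin))
  | _ => 0

theorem ctr_projForm (ι : LieRinehartHom R PA PL) (l : PL) :
    ctr l (projForm ι) = const PL (Submodule.Quotient.mk l) := by
  ext1 n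
  match n with
  | 0 => rfl
  | n + 1 => rfl

theorem pull_projForm (ι : LieRinehartHom R PA PL) : pull ι.toLin (projForm ι) = 0 := by
  ext1 n
  refine AlternatingMap.ext fun v => ?_
  match n with
  | 0 => rfl
  | 1 => exact (Submodule.Quotient.mk_eq_zero _).2 ⟨_, rfl⟩
  | n + 2 => rfl

/-- The family of forms on `L` with a given restriction, for a projection `r` of `L` onto `A`. -/
def liftFam (r : PL →ₗ[R] PA) (u : Fam R PA (Normal ι →ₗ[R] Module.End R (⨁ i, X i))) :
    Fam R PL (Module.End R (⨁ i, X i)) :=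
  star (LinearMap.id : (Normal ι →ₗ[R] Module.End R (⨁ i, X i)) →ₗ[R] _)
    (pull r (eps u)) (projForm ι)

variable (r : PL →ₗ[R] PA) (hr : ∀ a, r (ι a) = a)
  (u : Fam R PA (Normal ι →ₗ[R] Module.End R (⨁ i, X i)))

theorem pull_liftFam : pull ι.toLin (liftFam r u) = 0 := by
  rw [liftFam, pull_star, pull_projForm, map_zero]

include hr in
-- When `l` is contracted into the projection factor, `u` remains with arguments projected by `r`,
-- which is the identity on `A`. The `eps` in `liftFam` undoes the sign of `slice_res`. The other
-- term carries the projection restricted to `A` and vanishes.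
theorem res_liftFam : res ι (liftFam r u) (pull_liftFam r u) = u := by
  refine slice_ext ι fun l => ?_
  rw [slice_res, liftFam, ctr_star, map_add, map_add, eps_star, pull_star, eps_eps, pull_projForm,
    map_zero, zero_add, eps_star, pull_star, ctr_projForm]
  ext1 n
  refine AlternatingMap.ext fun v => ?_
  rw [star_of_ctr_right]
  · have h1 : pull ι.toLin (eps (pull r (eps u))) = u := by
      rw [eps_pull, eps_eps]
      ext n v
      rw [pull_apply, pull_apply]
      simp only [hr]
    rw [h1, pull_apply, eps_zero_form, Subsingleton.elim (fun j => ι.toLin ((![] : Fin 0 → PA) j)) ![]]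
    rfl
  · intro x
    rw [ctr_pull, ctr_eps, ctr_const]
    simp

theorem liftFam_one (l : PL) : liftFam r u 1 ![l] = u 0 ![] (Submodule.Quotient.mk l) := by
  have h : liftFam r u 1 ![l] = ctr l (liftFam r u) 0 ![] := rfl
  rw [h, liftFam, ctr_star, Pi.add_apply, AlternatingMap.add_apply, star_zero_form, star_zero_form,
    ctr_projForm, eps_zero_form]
  have h0 : projForm ι 0 ![] = 0 := rfl
  rw [h0, map_zero, zero_add, pull_apply, eps_zero_form, Subsingleton.elim (fun j => r (![] j)) ![]]
  rfl

theorem liftFam_mem (hu : u ∈ cochains ι X 0) (k : ℕ) (v : Fin k → PL) :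
    liftFam r u k v ∈ endDeg R X (1 - k) := by
  refine star_mem _ _ _ _ _ (fun s t hst v w => ?_) v
  by_cases ht : t = 1
  · subst ht
    rw [pull_apply, eps_apply]
    refine endDeg_congr (i := 0 - s) (by push_cast [← hst]; ring) ?_
    exact zsmul_mem (hu s _ _) _
  · have : projForm ι t = 0 := by
      match t, ht with
      | 0, _ => rfl
      | t + 2, _ => rfl
    rw [this, AlternatingMap.zero_apply, map_zero]
    exact Submodule.zero_mem _

theorem Extends.subFam (h : Extends ι DA DL) (η : Fam R PL (Module.End R (⨁ i, X i)))
    (hη : ∀ (k : ℕ) (a : Fin k → PL), η k a ∈ endDeg R X (1 - k)) (h0 : pull ι.toLin η = 0) :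
    Extends ι DA (DL.subFam η hη) where
  conn a := by
    refine LinearMap.ext fun e => ?_
    have h1 : η 1 ![ι a] = 0 := by
      have := DFunLike.congr_fun (congrFun h0 1) ![a]
      rw [pull_apply] at this
      rw [← show η 1 (fun j => ι.toLin (![a] j)) = η 1 ![ι a] by
        congr 1; ext j; fin_cases j; rfl]
      exact this
    change DL.conn (ι a) e - η 1 ![ι a] e = _
    rw [h1, h.conn]
    exact sub_zero _
  form k v := by
    have h1 : η k (fun j => ι (v j)) = 0 := DFunLike.congr_fun (congrFun h0 k) v
    change DL.form k (fun j => ι (v j)) - η k (fun j => ι (v j))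
      + partOne η k (fun j => ι (v j)) = _
    have h2 : partOne η k (fun j => ι (v j)) = 0 := by
      unfold partOne
      split_ifs
      · exact h1
      · rfl
    rw [h1, h2, h.form, sub_zero, add_zero]

include hr in
-- The change is exact rather than first order: one contraction of `η ∧ η` leaves a factor `η`
-- evaluated on `A`, which is zero. The formula for the new connection is recorded to follow its
-- effect on the cohomology of `∂`.
theorem exists_modification (hflat : DA.IsFlat) (h : Extends ι DA DL) (hu : u ∈ cochains ι X 0) :
    ∃ (DL' : Superconnection R PL X) (h' : Extends ι DA DL'),
      atiyahCocycle hflat h' = atiyahCocycle hflat h - hatDiff ι DA 0 u ∧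
      ∀ l e, DL'.conn l e = DL.conn l e - u 0 ![] (Submodule.Quotient.mk l) e := by
  refine ⟨DL.subFam (liftFam r u) (liftFam_mem r u hu),
    h.subFam _ _ (pull_liftFam r u), ?_, fun l e => ?_⟩
  · have h1 := h.hatDiff_res_odd (liftFam r u) (pull_liftFam r u)
    rw [res_liftFam r hr u] at h1
    rw [h1]
    refine slice_ext ι fun l => ?_
    rw [map_sub]
    have e1 := slice_res ι _ (h.curv_pull hflat) l
    have e2 := slice_res ι _ ((h.subFam _ (liftFam_mem r u hu) (pull_liftFam r u)).curv_pull hflat) l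
    refine e2.trans ?_
    refine Eq.trans ?_ (congrArg₂ (· - ·) e1.symm (slice_res ι _ _ l).symm)
    rw [subFam_curv]
    -- Here the quadratic term of `subFam_curv` disappears.
    simp only [map_add, map_sub, ctr_star, eps_star, pull_star, ← eps_pull, pull_liftFam, map_zero,
      AddMonoidHom.zero_apply, add_zero]
  · rw [← liftFam_one r u l]
    rfl

end Superconnection


open Forms

/-! ### The Atiyah cocycle of an `A`-module. -/

namespace Connection

section Bianchi

variable {R P N : Type*} [CommRing R] [Algebra ℝ R]
  [LieRing P] [Module R P] [LieRingModule P R] [LieAlgebra ℝ P]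
  [LieRinehartRing R P] [LieRinehartAlgebra ℝ R P]
  [AddCommGroup N] [Module R N] [Module ℝ N] [IsScalarTower ℝ R N]

/-- The second Bianchi identity. -/
theorem dForms_curvatureForms (D : Connection R P N) :
    (D.hom D).dForms D.curvatureForms = 0 := by
  refine ev_ext fun x => ?_
  -- The cube of `d` is computed in two ways, and the difference is the derivative of the curvature.
  have h := D.dForms_dForms (D.dForms (eps x))
  rw [D.dForms_dForms (eps x), dForms_star (D₁ := D.hom D) (D₂ := D) (fun a φ e => by
    change _ = (D a (φ e) - φ (D a e)) + φ (D a e)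
    rw [sub_add_cancel]
    rfl), eps_eps] at h
  rw [map_zero, AddMonoidHom.zero_apply]
  exact add_eq_right.1 h

end Bianchi

variable {R PA PL N : Type*} [CommRing R] [Algebra ℝ R]
  [LieRing PA] [Module R PA] [LieRingModule PA R] [LieAlgebra ℝ PA]
  [LieRinehartRing R PA] [LieRinehartAlgebra ℝ R PA]
  [LieRing PL] [Module R PL] [LieRingModule PL R] [LieAlgebra ℝ PL]
  [LieRinehartRing R PL] [LieRinehartAlgebra ℝ R PL]
  [AddCommGroup N] [Module R N] [Module ℝ N] [IsScalarTower ℝ R N]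
  {ι : LieRinehartHom R PA PL} {DA : Connection R PA N} {DL DL' : Connection R PL N}

theorem Extends.hom (h : Extends ι DA DL) : Extends ι (DA.hom DA) (DL.hom DL) := by
  intro a
  refine LinearMap.ext fun φ => LinearMap.ext fun e => ?_
  change DL (ι a) (φ e) - φ (DL (ι a) e) = DA a (φ e) - φ (DA a e)
  rw [h]

/-- The cocycle is the restriction of the curvature of the `L`-connection, which vanishes on `A` by
flatness; the claim is the restricted Bianchi identity. -/
theorem atiyahCocycle_mem_cocycles (hflat : DA.curvature = 0) (h : Extends ι DA DL) :
    atiyahCocycle ι DA DL hflat h ∈ (hatConn ι DA).cocycles 1 := by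
  have h0 : pull ι.toLin DL.curvatureForms = 0 := by
    ext1 k
    refine AlternatingMap.ext fun v => ?_
    match k with
    | 0 => rfl
    | 1 => rfl
    | 2 => exact (h.curvature_comp v).trans (by rw [hflat]; rfl)
    | k + 3 => rfl
  have h1 : (hatConn ι DA).dForms (res ι DL.curvatureForms h0) = 0 := by
    refine slice_ext ι fun l => ?_
    refine (slice_dForms_res h.hom DL.curvatureForms h0 l).trans ?_
    rw [dForms_curvatureForms, map_zero, map_zero, map_zero, map_zero]
  exact congrFun h1 2

theorem d_zero_form_apply (D : Connection R PA N) (c : N) (v : Fin 1 → PA) :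
    D.d (AlternatingMap.constOfIsEmpty R PA (Fin 0) c) v = D (v 0) c := by
  rw [d_apply]
  simp

theorem snoc_eq_vec (v : Fin 1 → PA) (l : PL) :
    (Fin.snoc (α := fun _ => PL) (fun j => ι (v j)) l : Fin 2 → PL) = ![ι (v 0), l] := by
  ext j
  fin_cases j <;> rfl

/-- The Atiyah cocycle changes by a coboundary with the extension of the connection. -/
theorem atiyahCocycle_sub (hflat : DA.curvature = 0) (h : Extends ι DA DL) (h' : Extends ι DA DL')
    (c : Normal ι →ₗ[R] Module.End R N)
    (hc : ∀ l e, DL' l e = DL l e - c (Submodule.Quotient.mk l) e)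
    (v : Fin 1 → PA) (x : Normal ι) (e : N) :
    atiyahCocycle ι DA DL' hflat h' v x e = atiyahCocycle ι DA DL hflat h v x e
      - (hatConn ι DA).dLin 0 (AlternatingMap.constOfIsEmpty R PA (Fin 0) c) v x e := by
  obtain ⟨l, rfl⟩ := Submodule.Quotient.mk_surjective _ x
  change DL'.curvature (Fin.snoc (α := fun _ => PL) (fun j => ι (v j)) l) e
    = DL.curvature (Fin.snoc (α := fun _ => PL) (fun j => ι (v j)) l) e
      - (hatConn ι DA).d (AlternatingMap.constOfIsEmpty R PA (Fin 0) c) v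
        (Submodule.Quotient.mk l) e
  rw [d_zero_form_apply, snoc_eq_vec]
  change DL' (ι (v 0)) (DL' l e) - DL' l (DL' (ι (v 0)) e) - DL' ⁅ι (v 0), l⁆ e
    = DL (ι (v 0)) (DL l e) - DL l (DL (ι (v 0)) e) - DL ⁅ι (v 0), l⁆ e
      - ((DA (v 0) (c (Submodule.Quotient.mk l) e) - c (Submodule.Quotient.mk l) (DA (v 0) e))
        - c (Submodule.Quotient.mk ⁅ι (v 0), l⁆) e)
  -- No quadratic term in `c` arises: along `ι (v 0)` both connections equal `DA`.
  rw [h', h, hc, hc, hc, map_sub]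
  abel

/-- The difference of two extensions of a connection. -/
def Extends.diff (h : Extends ι DA DL) (h' : Extends ι DA DL') :
    Normal ι →ₗ[R] Module.End R N :=
  (LinearMap.range ι.toLin).liftQ
    { toFun := fun l =>
        { toFun := fun e => DL l e - DL' l e
          map_add' := fun e e' => by simp only [map_add]; abel
          map_smul' := fun f e => by
            rw [DL.leibniz, DL'.leibniz, RingHom.id_apply, smul_sub]
            abel }
      map_add' := fun l l' => LinearMap.ext fun e => by
        simp only [map_add, LinearMap.add_apply, LinearMap.coe_mk, AddHom.coe_mk]
        abel
      map_smul' := fun c l => LinearMap.ext fun e => by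
        simp [smul_sub] }
    (by
      rintro _ ⟨a, rfl⟩
      refine LinearMap.ext fun e => ?_
      change DL (ι a) e - DL' (ι a) e = 0
      rw [h, h', sub_self])

theorem Extends.diff_mk (h : Extends ι DA DL) (h' : Extends ι DA DL') (l : PL) (e : N) :
    h.diff h' (Submodule.Quotient.mk l) e = DL l e - DL' l e := rfl

/-- The connection `DL - c`, for a form `c` on `L/A`. -/
def subHom (DL : Connection R PL N) (c : Normal ι →ₗ[R] Module.End R N) : Connection R PL N where
  toFun :=
    { toFun := fun l => DL l - (c (Submodule.Quotient.mk l)).restrictScalars ℝ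
      map_add' := fun l l' => by
        ext e
        simp
        abel
      map_smul' := fun f l => by
        ext e
        simp [smul_sub] }
  leibniz l f e := by
    change DL l (f • e) - c (Submodule.Quotient.mk l) (f • e)
      = f • (DL l e - c (Submodule.Quotient.mk l) e) + ⁅l, f⁆ • e
    rw [DL.leibniz, map_smul, smul_sub]
    abel

theorem subHom_apply (c : Normal ι →ₗ[R] Module.End R N) (l : PL) (e : N) :
    DL.subHom c l e = DL l e - c (Submodule.Quotient.mk l) e := rfl

theorem Extends.subHom (h : Extends ι DA DL) (c : Normal ι →ₗ[R] Module.End R N) :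
    Extends ι DA (DL.subHom c) := by
  intro a
  refine LinearMap.ext fun e => ?_
  have h0 : (Submodule.Quotient.mk (ι a) : Normal ι) = 0 :=
    (Submodule.Quotient.mk_eq_zero _).2 ⟨a, rfl⟩
  rw [subHom_apply, h0, map_zero, h]
  exact sub_zero _

end Connection

/-! ### The connection induced on the cohomology of `∂`. -/

namespace Superconnection

section Induced

variable {R : Type*} [CommRing R] [Algebra ℝ R] {P : Type*}
    [LieRing P] [Module R P] [LieRingModule P R] [LieAlgebra ℝ P]
    [LieRinehartRing R P] [LieRinehartAlgebra ℝ R P]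
    {X : ℤ → Type*} [∀ i, AddCommGroup (X i)] [∀ i, Module R (X i)] [∀ i, Module ℝ (X i)]
    [∀ i, IsScalarTower ℝ R (X i)] (D : Superconnection R P X)

theorem curv_one_apply (a : P) (e : ⨁ i, X i) :
    D.curv 1 ![a] e = D.conn a (D.diff e) - D.diff (D.conn a e) := by
  have h0 : D.formSq 1 = 0 := by
    refine Finset.sum_eq_zero fun x _ => ?_
    obtain ⟨⟨p, q⟩, hx⟩ := x
    have hpq := Finset.HasAntidiagonal.mem_antidiagonal.1 hx
    simp only at hpq
    have : p = 1 ∨ q = 1 := by omega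
    rcases this with rfl | rfl
    · simp only [D.form_one, wedge_zero_left, smul_zero]
    · simp only [D.form_one, wedge_zero_right, smul_zero]
  have h1 : D.curv 1 ![a] e = D.conn a (D.form 0 (Fin.removeNth 0 ![a]) e)
      - D.form 0 (Fin.removeNth 0 ![a]) (D.conn a e) := by
    rw [curv, h0]
    simp [Connection.curvatureForms, Connection.dForms, Connection.dLin, Connection.d_apply,
      endConn, Connection.hom]
  rw [h1, Subsingleton.elim (Fin.removeNth 0 ![a]) ![]]
  rfl

/-- The products of form degree two are `∂` after `ω^(2)`, the zero product of 1-forms, and `ω^(2)`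
after `∂`. On a `∂`-closed element only the first survives. -/
theorem formSq_two_mem (v : Fin 2 → P) {x : ⨁ i, X i} (hx : D.diff x = 0) :
    D.formSq 2 v x ∈ LinearMap.range D.diff := by
  let S : Submodule R (Module.End R (⨁ i, X i)) :=
    (LinearMap.range D.diff).comap (LinearMap.applyₗ x)
  suffices hs : D.formSq 2 v ∈ S from hs
  change evalHom v (D.formSq 2) ∈ S
  rw [formSq, map_sum]
  refine Submodule.sum_mem _ fun y _ => ?_
  rw [Units.smul_def, map_zsmul]
  refine zsmul_mem ?_ _
  obtain ⟨⟨p, q⟩, hy⟩ := y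
  have hpq := Finset.HasAntidiagonal.mem_antidiagonal.1 hy
  simp only at hpq
  refine wedge_mem _ _ _ _ _ (fun w w' => ?_) v
  change D.form p w (D.form q w' x) ∈ LinearMap.range D.diff
  have : p = 0 ∨ p = 1 ∨ q = 0 := by omega
  rcases this with rfl | rfl | rfl
  · rw [Subsingleton.elim w ![]]
    exact ⟨_, rfl⟩
  · rw [D.form_one]
    exact Submodule.zero_mem _
  · rw [Subsingleton.elim w' ![]]
    change D.form p w (D.diff _) ∈ _
    rw [hx, map_zero]
    exact Submodule.zero_mem _

theorem curv_two_apply (v : Fin 2 → P) (x : ⨁ i, X i) :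
    D.curv 2 v x = D.conn.curvature v x + D.formSq 2 v x := by
  have hd : D.endConn.dForms D.form 2 = 0 := by
    change D.endConn.dLin 1 (D.form 1) = 0
    rw [D.form_one, map_zero]
  rw [curv, hd, add_zero]
  rfl

theorem curv_two_mem_iff (v : Fin 2 → P) {x : ⨁ i, X i} (hx : D.diff x = 0) :
    D.curv 2 v x ∈ LinearMap.range D.diff ↔ D.conn.curvature v x ∈ LinearMap.range D.diff := by
  rw [curv_two_apply]
  exact Submodule.add_mem_iff_left _ (D.formSq_two_mem v hx)

end Induced

variable {R PA PL : Type*} [CommRing R] [Algebra ℝ R]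
  [LieRing PA] [Module R PA] [LieRingModule PA R] [LieAlgebra ℝ PA]
  [LieRinehartRing R PA] [LieRinehartAlgebra ℝ R PA]
  [LieRing PL] [Module R PL] [LieRingModule PL R] [LieAlgebra ℝ PL]
  [LieRinehartRing R PL] [LieRinehartAlgebra ℝ R PL]
  {X : ℤ → Type*} [∀ i, AddCommGroup (X i)] [∀ i, Module R (X i)] [∀ i, Module ℝ (X i)]
  [∀ i, IsScalarTower ℝ R (X i)]
  {ι : LieRinehartHom R PA PL} {DA : Superconnection R PA X} {DL : Superconnection R PL X}

theorem Extends.diff_eq (h : Extends ι DA DL) : DL.diff = DA.diff := by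
  have := h.form 0 ![]
  rwa [Subsingleton.elim (fun j => ι ((![] : Fin 0 → PA) j)) ![]] at this

/-- The component of `D_L²` in form degree one is `[∇_L, ∂]`, and it is `α^(0)`. -/
theorem Extends.conn_diff (hflat : DA.IsFlat) (h : Extends ι DA DL)
    (h0 : atiyahCocycle hflat h 0 = 0) (l : PL) (e : ⨁ i, X i) :
    DL.conn l (DA.diff e) = DA.diff (DL.conn l e) := by
  have h1 : atiyahCocycle hflat h 0 ![] (Submodule.Quotient.mk l) = DL.curv 1 ![l] := by
    refine (restrictForm_apply ι (DL.curv 1) _ ![] l).trans ?_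
    congr 1
    ext j
    fin_cases j
    rfl
  have h2 := DL.curv_one_apply l e
  rw [← h1, h0, h.diff_eq] at h2
  exact (sub_eq_zero.1 h2.symm)

/-- The connection on the cohomology induced by the connection of `DL`, when it commutes with
`∂`. -/
def inducedConn (DA : Superconnection R PA X) (DL : Superconnection R PL X)
    (hc : ∀ l e, DL.conn l (DA.diff e) = DA.diff (DL.conn l e)) (i : ℤ) :
    Connection R PL (DA.Coh i) :=
  ((DL.connAt i).restrict (DA.kerAt i) fun l e he => by
    change DA.diff (DirectSum.lof R ℤ X i e) = 0 at he
    change DA.diff (DirectSum.lof R ℤ X i (DL.connAt i l e)) = 0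
    rw [lof_connAt, ← hc, he, map_zero]).quotient
    ((DA.imAt i).submoduleOf (DA.kerAt i)) fun l e he => by
      obtain ⟨t, ht⟩ := he
      refine ⟨DL.conn l t, ?_⟩
      rw [← hc, ht]
      exact (DL.lof_connAt i l e.1).symm

theorem inducedConn_mk (hc : ∀ l e, DL.conn l (DA.diff e) = DA.diff (DL.conn l e)) (i : ℤ) (l : PL)
    (e f : DA.kerAt i) (hf : DirectSum.lof R ℤ X i f.1 = DL.conn l (DirectSum.lof R ℤ X i e.1)) :
    inducedConn DA DL hc i l (Submodule.Quotient.mk e) = Submodule.Quotient.mk f := by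
  have h1 : DL.connAt i l e.1 = f.1 := by
    change DirectSum.component R ℤ X i _ = _
    rw [← hf, DirectSum.component.lof_self]
  exact congrArg Submodule.Quotient.mk (Subtype.ext h1)

theorem Extends.inducedConn (hflat : DA.IsFlat) (h : Extends ι DA DL)
    (hc : ∀ l e, DL.conn l (DA.diff e) = DA.diff (DL.conn l e)) (i : ℤ) :
    Connection.Extends ι (DA.connCoh hflat i) (inducedConn DA DL hc i) := by
  intro a
  refine LinearMap.ext fun e => ?_
  obtain ⟨e, rfl⟩ := Submodule.Quotient.mk_surjective _ e
  refine inducedConn_mk hc i (ι a) e _ ?_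
  rw [h.conn]
  exact DA.lof_connAt i a e.1

/-- On cohomology the curvature of the connection and the 2-form component of `D_L²` agree modulo
`im ∂`, by `curv_two_mem_iff`. -/
theorem inducedConn_curvature_eq_zero_iff (h : Extends ι DA DL)
    (hc : ∀ l e, DL.conn l (DA.diff e) = DA.diff (DL.conn l e)) (i : ℤ) (v : Fin 2 → PL)
    (e : DA.kerAt i) : (inducedConn DA DL hc i).curvature v (Submodule.Quotient.mk e) = 0 ↔
      DL.curv 2 v (DirectSum.lof R ℤ X i e.1) ∈ LinearMap.range DA.diff := by
  rw [← h.diff_eq, DL.curv_two_mem_iff v (by rw [h.diff_eq]; exact e.2), h.diff_eq]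
  have h1 : DirectSum.lof R ℤ X i (DL.connAt i (v 0) (DL.connAt i (v 1) e.1)
        - DL.connAt i (v 1) (DL.connAt i (v 0) e.1) - DL.connAt i ⁅v 0, v 1⁆ e.1)
      = DL.conn.curvature v (DirectSum.lof R ℤ X i e.1) := by
    simp only [map_sub, lof_connAt, Connection.curvature_apply]
  rw [← h1]
  exact Submodule.Quotient.mk_eq_zero _

/-- The Atiyah cocycle of the induced connection on the cohomology. -/
theorem atiyahCocycle_inducedConn_eq_zero_iff (hflat : DA.IsFlat) (h : Extends ι DA DL)
    (hc : ∀ l e, DL.conn l (DA.diff e) = DA.diff (DL.conn l e)) (i : ℤ) :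
    Connection.atiyahCocycle ι (DA.connCoh hflat i) (inducedConn DA DL hc i)
        (DA.connCoh_curvature hflat i) (h.inducedConn hflat hc i) = 0 ↔
      ∀ (v : Fin 1 → PA) (x : Normal ι) (e : DA.kerAt i),
        atiyahCocycle hflat h 1 v x (DirectSum.lof R ℤ X i e.1) ∈ LinearMap.range DA.diff := by
  constructor
  · intro h0 v x e
    obtain ⟨l, rfl⟩ := Submodule.Quotient.mk_surjective _ x
    refine (inducedConn_curvature_eq_zero_iff h hc i _ e).1 ?_
    exact LinearMap.congr_fun (LinearMap.congr_fun (DFunLike.congr_fun h0 v)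
      (Submodule.Quotient.mk l)) (Submodule.Quotient.mk e)
  · intro h0
    refine AlternatingMap.ext fun v => LinearMap.ext fun x => LinearMap.ext fun e => ?_
    obtain ⟨l, rfl⟩ := Submodule.Quotient.mk_surjective _ x
    obtain ⟨e, rfl⟩ := Submodule.Quotient.mk_surjective _ e
    exact (inducedConn_curvature_eq_zero_iff h hc i _ e).2 (h0 v (Submodule.Quotient.mk l) e)

variable {r : PL →ₗ[R] PA}

/-- If the Atiyah class of `E` vanishes, so does that of its cohomology. -/
theorem atiyahCocycle_coh_mem_coboundaries (hr : ∀ a, r (ι a) = a) (hflat : DA.IsFlat)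
    (h : Extends ι DA DL) (i : ℤ) {nabla : Connection R PL (DA.Coh i)}
    (hnabla : Connection.Extends ι (DA.connCoh hflat i) nabla)
    {u : Fam R PA (Normal ι →ₗ[R] Module.End R (⨁ i, X i))} (hu : u ∈ cochains ι X 0)
    (hαu : hatDiff ι DA 0 u = atiyahCocycle hflat h) :
    Connection.atiyahCocycle ι (DA.connCoh hflat i) nabla (DA.connCoh_curvature hflat i) hnabla ∈
      (Connection.hatConn ι (DA.connCoh hflat i)).coboundaries 1 := by
  -- A primitive `u` is subtracted, so the new extension has zero Atiyah cocycle; its induced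
  -- connection on the cohomology then has zero cocycle as well.
  obtain ⟨DL', h', hα', -⟩ := exists_modification r hr u hflat h hu
  rw [hαu, sub_self] at hα'
  have hc := h'.conn_diff hflat (congrFun hα' 0)
  have h1 := (atiyahCocycle_inducedConn_eq_zero_iff hflat h' hc i).2 fun v x e => by
    rw [hα']
    exact Submodule.zero_mem _
  -- The difference of the given and the induced connection is a primitive of the cocycle of the
  -- given one.
  have h2 := Connection.atiyahCocycle_sub (DA.connCoh_curvature hflat i) hnabla
    (h'.inducedConn hflat hc i) (hnabla.diff (h'.inducedConn hflat hc i)) fun l e => by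
      rw [Connection.Extends.diff_mk, sub_sub_cancel]
  rw [h1] at h2
  exact ⟨_, AlternatingMap.ext fun v => LinearMap.ext fun x => LinearMap.ext fun e =>
    (sub_eq_zero.1 (h2 v x e).symm).symm⟩

end Superconnection


/-! ### Contractions of `∂` and removal of the components of the Atiyah cocycle. -/

namespace Forms

section

variable {R P N₁ N₂ N₃ : Type*} [CommRing R] [AddCommGroup P] [Module R P]
  [AddCommGroup N₁] [Module R N₁] [AddCommGroup N₂] [Module R N₂]
  [AddCommGroup N₃] [Module R N₃] [Module ℝ N₃]

/-- Used to read off the lowest component of `s u`, where only the product with the 0-form `∂`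
survives. -/
theorem wedgeAt_of_lt_right (B : N₁ →ₗ[R] N₂ →ₗ[R] N₃) (f : Fam R P N₁) (g : Fam R P N₂) (m : ℕ)
    (hg : ∀ n < m, g n = 0) (c : ℕ × ℕ → ℤ) (v : Fin m → P) :
    ∑ x ∈ Finset.HasAntidiagonal.antidiagonal m, c x • wedgeAt B f g m x.1 x.2 v
      = c (0, m) • B (f 0 ![]) (g m v) := by
  rw [Finset.sum_eq_single (0, m)]
  · rw [wedgeAt, dif_pos (zero_add m), wedge_zero_form_left]
  · rintro ⟨k, l⟩ hx hne
    have h := Finset.HasAntidiagonal.mem_antidiagonal.1 hx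
    have hl : l < m := by
      simp only [ne_eq, Prod.mk.injEq, not_and] at hne h
      by_contra hl
      exact hne (by omega) (by omega)
    rw [wedgeAt, dif_pos h, hg l hl, wedge_zero_right, AlternatingMap.zero_apply, smul_zero]
  · intro h
    exact absurd (Finset.HasAntidiagonal.mem_antidiagonal.2 (zero_add m)) h

theorem wedgeAt_of_lt_left (B : N₁ →ₗ[R] N₂ →ₗ[R] N₃) (f : Fam R P N₁) (g : Fam R P N₂) (m : ℕ)
    (hf : ∀ n < m, f n = 0) (c : ℕ × ℕ → ℤ) (v : Fin m → P) :
    ∑ x ∈ Finset.HasAntidiagonal.antidiagonal m, c x • wedgeAt B f g m x.1 x.2 v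
      = c (m, 0) • B (f m v) (g 0 ![]) := by
  rw [Finset.sum_eq_single (m, 0)]
  · rw [wedgeAt, dif_pos (add_zero m), wedge_zero_form_right]
  · rintro ⟨k, l⟩ hx hne
    have h := Finset.HasAntidiagonal.mem_antidiagonal.1 hx
    have hl : k < m := by
      simp only [ne_eq, Prod.mk.injEq, not_and] at hne h
      by_contra hl
      exact hne (by omega) (by omega)
    rw [wedgeAt, dif_pos h, hf k hl, wedge_zero_left, AlternatingMap.zero_apply, smul_zero]
  · intro h
    exact absurd (Finset.HasAntidiagonal.mem_antidiagonal.2 (add_zero m)) h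

end

end Forms

open Forms

theorem Connection.cohomologyClass_eq_zero_iff {R P N : Type*} [CommRing R] [Algebra ℝ R]
    [LieRing P] [Module R P] [LieRingModule P R] [LieAlgebra ℝ P]
    [LieRinehartRing R P] [LieRinehartAlgebra ℝ R P]
    [AddCommGroup N] [Module R N] [Module ℝ N] [IsScalarTower ℝ R N]
    (D : Connection R P N) (n : ℕ) (c : D.cocycles n) :
    D.cohomologyClass n c = 0 ↔ c.1 ∈ D.coboundaries n :=
  Submodule.Quotient.mk_eq_zero _

namespace Superconnection

variable {R PA PL : Type*} [CommRing R] [Algebra ℝ R]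
  [LieRing PA] [Module R PA] [LieRingModule PA R] [LieAlgebra ℝ PA]
  [LieRinehartRing R PA] [LieRinehartAlgebra ℝ R PA]
  [LieRing PL] [Module R PL] [LieRingModule PL R] [LieAlgebra ℝ PL]
  [LieRinehartRing R PL] [LieRinehartAlgebra ℝ R PL]
  {X : ℤ → Type*} [∀ i, AddCommGroup (X i)] [∀ i, Module R (X i)] [∀ i, Module ℝ (X i)]
  [∀ i, IsScalarTower ℝ R (X i)]
  {ι : LieRinehartHom R PA PL} {DA : Superconnection R PA X} {DL : Superconnection R PL X}

/-- The lowest component of the differential. -/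
theorem hatDiff_apply_of_lt (p : ℤ) (u : Fam R PA (Normal ι →ₗ[R] Module.End R (⨁ i, X i))) (m : ℕ)
    (hu : ∀ n < m, u n = 0) (v : Fin m → PA) (x : Normal ι) :
    hatDiff ι DA p u m v x = ((m + 1 : ℤ).negOnePow : ℤ) • (DA.diff * u m v x)
      - ((p + 1).negOnePow : ℤ) • (u m v x * DA.diff) := by
  obtain ⟨l, rfl⟩ := Submodule.Quotient.mk_surjective _ x
  have h1 : (Connection.hatConn ι DA.conn).dForms u m = 0 := by
    cases m with
    | zero => rfl
    | succ m =>
      change (Connection.hatConn ι DA.conn).dLin m (u m) = 0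
      rw [hu m (Nat.lt_succ_self m), map_zero]
  have h2 : hatDiff ι DA p u m v (Submodule.Quotient.mk l)
      = (Connection.hatConn ι DA.conn).dForms u m v (Submodule.Quotient.mk l)
        + slice ι _ l (hatBracket ι DA p u) m v := rfl
  rw [h2, h1, slice_hatBracket]
  have hs : ∀ n < m, slice ι (Module.End R (⨁ i, X i)) l u n = 0 := fun n hn => by
    refine AlternatingMap.ext fun w => ?_
    rw [slice_apply, hu n hn]
    rfl
  rw [wedgeAt_of_lt_right (compEnd R X) DA.form _ m hs
      (fun x => ((1 - (x.1 : ℤ)) * (x.2 + 1)).negOnePow),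
    wedgeAt_of_lt_left (compEnd R X) _ DA.form m hs
      (fun x => ((p + 1 + (p - x.1 + 1) * x.2).negOnePow))]
  refine (zero_add _).trans ?_
  congr 3
  · simp
  · simp

/-- Contracting data for the complex `(⨁ i, X i, ∂)` with cohomology in degree `0` only. -/
structure Contraction (D : Module.End R (⨁ i, X i)) where
  h : Module.End R (⨁ i, X i)
  q : Module.End R (⨁ i, X i)
  h_mem : h ∈ endDeg R X (-1)
  q_mem : q ∈ endDeg R X 0
  homotopy : q + D * h + h * D = 1
  diff_q : D * q = 0
  q_diff : q * D = 0
  q_apply : ∀ (i : ℤ), i ≠ 0 → ∀ e : X i, q (DirectSum.lof R ℤ X i e) = 0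

namespace Contraction

variable {D : Module.End R (⨁ i, X i)} (C : Contraction D)

/-- The homotopy on endomorphisms of degree `j`, where `s = (-1)^j`. -/
def homotopyEnd (s : ℤ) : Module.End R (⨁ i, X i) →ₗ[R] Module.End R (⨁ i, X i) :=
  LinearMap.mulLeft R C.h + s • (LinearMap.mulRight R C.h ∘ₗ LinearMap.mulLeft R C.q)

theorem homotopyEnd_apply (s : ℤ) (φ : Module.End R (⨁ i, X i)) :
    C.homotopyEnd s φ = C.h * φ + s • (C.q * φ * C.h) := rfl

theorem homotopyEnd_mem (s : ℤ) {j k : ℤ} (hk : j - 1 = k) {φ : Module.End R (⨁ i, X i)}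
    (hφ : φ ∈ endDeg R X j) : C.homotopyEnd s φ ∈ endDeg R X k := by
  rw [homotopyEnd_apply]
  refine Submodule.add_mem _ (endDeg_mul C.h_mem hφ (by omega)) (zsmul_mem ?_ _)
  exact endDeg_mul (endDeg_mul C.q_mem hφ rfl) C.h_mem (by omega)

/-- Write `φ = qφ + Dhφ + hDφ`. The last term is `s • hφD` by the commutation hypothesis. The first
is `qφhD`: insert `q + Dh + hD = 1` on the right of `qφ` and use `qφq = 0` and `qφD = 0`. The term
`D(qφh)` does not contribute since `Dq = 0`. -/
theorem commutator_homotopyEnd {s : ℤ} (hs : s * s = 1) {φ : Module.End R (⨁ i, X i)}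
    (hφ : D * φ = s • (φ * D)) (hq : C.q * φ * C.q = 0) :
    D * C.homotopyEnd s φ + s • (C.homotopyEnd s φ * D) = φ := by
  have h1 : s • (C.h * φ * D) = C.h * D * φ := by
    rw [mul_assoc, mul_assoc, hφ, mul_smul_comm]
  have h2 : C.q * φ * D = 0 := by
    have : C.q * (D * φ) = 0 := by rw [← mul_assoc, C.q_diff, zero_mul]
    rw [hφ, mul_smul_comm] at this
    have h3 := congrArg (s • ·) this
    simpa only [smul_smul, hs, one_smul, smul_zero, ← mul_assoc] using h3
  have h4 : C.q * φ = C.q * φ * C.h * D := by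
    have : C.q * φ * (C.q + D * C.h + C.h * D) = C.q * φ := by rw [C.homotopy, mul_one]
    rw [mul_add, mul_add, hq, ← mul_assoc (C.q * φ) D, h2, zero_mul, zero_add, zero_add,
      ← mul_assoc] at this
    exact this.symm
  have h5 : D * (C.q * φ * C.h) = 0 := by
    rw [← mul_assoc, ← mul_assoc, C.diff_q, zero_mul, zero_mul]
  rw [homotopyEnd_apply, mul_add, mul_smul_comm, h5, smul_zero, add_zero, add_mul, smul_add, h1,
    smul_mul_assoc, smul_smul, hs, one_smul, ← h4]
  calc D * (C.h * φ) + (C.h * D * φ + C.q * φ) = (C.q + D * C.h + C.h * D) * φ := by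
        rw [add_mul, add_mul, mul_assoc D]; abel
    _ = φ := by rw [C.homotopy, one_mul]

/-- The map `q` is supported in degree 0, and `φ` moves degree 0 elsewhere. -/
theorem q_mul_q_of_ne {j : ℤ} (hj : j ≠ 0) {φ : Module.End R (⨁ i, X i)} (hφ : φ ∈ endDeg R X j) :
    C.q * φ * C.q = 0 := by
  refine DirectSum.linearMap_ext R fun i => LinearMap.ext fun e => ?_
  change C.q (φ (C.q (DirectSum.lof R ℤ X i e))) = 0
  by_cases hi : i = 0
  · subst hi
    obtain ⟨e', he'⟩ := endDeg_apply hφ (C.q_mem 0 e) rfl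
    rw [← he']
    exact C.q_apply _ (by omega) e'
  · rw [C.q_apply i hi, map_zero, map_zero]

/-- The image of `q` is closed and `q` kills exact elements, so only the map induced by `φ` on
cohomology matters. -/
theorem q_mul_q_of_mem {φ : Module.End R (⨁ i, X i)}
    (hφ : ∀ e : X 0, D (DirectSum.lof R ℤ X 0 e) = 0 →
      φ (DirectSum.lof R ℤ X 0 e) ∈ LinearMap.range D) : C.q * φ * C.q = 0 := by
  refine DirectSum.linearMap_ext R fun i => LinearMap.ext fun e => ?_
  change C.q (φ (C.q (DirectSum.lof R ℤ X i e))) = 0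
  by_cases hi : i = 0
  · subst hi
    obtain ⟨e', he'⟩ : ∃ e' : X 0, DirectSum.lof R ℤ X 0 e' = C.q (DirectSum.lof R ℤ X 0 e) :=
      C.q_mem 0 e
    have h1 : D (C.q (DirectSum.lof R ℤ X 0 e)) = 0 := LinearMap.congr_fun C.diff_q _
    rw [← he'] at h1 ⊢
    obtain ⟨t, ht⟩ := hφ e' h1
    rw [← ht]
    exact LinearMap.congr_fun C.q_diff t
  · rw [C.q_apply i hi, map_zero, map_zero]

end Contraction

variable {r : PL →ₗ[R] PA}

/-- The family of forms concentrated in degree `m`. -/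
def single (m : ℕ) (w : PA [⋀^Fin m]→ₗ[R] (Normal ι →ₗ[R] Module.End R (⨁ i, X i))) :
    Forms R PA (Normal ι →ₗ[R] Module.End R (⨁ i, X i)) := Pi.single m w

theorem single_self (m : ℕ) (w : PA [⋀^Fin m]→ₗ[R] (Normal ι →ₗ[R] Module.End R (⨁ i, X i))) :
    single m w m = w := Pi.single_eq_same _ _

theorem single_of_ne {m n : ℕ} (h : n ≠ m)
    (w : PA [⋀^Fin m]→ₗ[R] (Normal ι →ₗ[R] Module.End R (⨁ i, X i))) : single m w n = 0 :=
  Pi.single_eq_of_ne h _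

theorem hatDiff_single_of_lt (p : ℤ) {m n : ℕ} (h : n < m)
    (w : PA [⋀^Fin m]→ₗ[R] (Normal ι →ₗ[R] Module.End R (⨁ i, X i))) :
    hatDiff ι DA p (single m w) n = 0 := by
  refine AlternatingMap.ext fun v => LinearMap.ext fun x => ?_
  rw [hatDiff_apply_of_lt p (single m w) n (fun k hk => single_of_ne (by omega) w),
    single_of_ne (by omega) w]
  change _ • (DA.diff * 0) - _ • (0 * DA.diff) = 0
  rw [mul_zero, zero_mul, smul_zero, smul_zero, sub_zero]

/-- In the lowest form degree the equation `s α = 0` involves only the commutator with `∂`. -/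
theorem atiyahCocycle_lowest (hflat : DA.IsFlat) (h : Extends ι DA DL) (m : ℕ)
    (h0 : ∀ n < m, atiyahCocycle hflat h n = 0) (v : Fin m → PA) (x : Normal ι) :
    DA.diff * atiyahCocycle hflat h m v x
      = ((m + 1 : ℤ).negOnePow : ℤ) • (atiyahCocycle hflat h m v x * DA.diff) := by
  have h1 := hatDiff_apply_of_lt (DA := DA) 1 _ m h0 v x
  rw [hatDiff_atiyahCocycle] at h1
  have h2 := congrArg (((m + 1 : ℤ).negOnePow : ℤ) • ·) (sub_eq_zero.1 (Eq.symm h1))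
  simp only [smul_smul] at h2
  have h3 : (((1 : ℤ) + 1).negOnePow : ℤ) = 1 := rfl
  rw [h3, mul_one, ← Units.val_mul, Int.units_mul_self, Units.val_one, one_smul] at h2
  exact h2

/-- Elimination of the lowest component of the Atiyah cocycle. -/
theorem exists_modification_lowest (hr : ∀ a, r (ι a) = a) (C : Contraction DA.diff)
    (hflat : DA.IsFlat) (h : Extends ι DA DL) (m : ℕ)
    (h0 : ∀ n < m, atiyahCocycle hflat h n = 0)
    (hq : ∀ v x, C.q * atiyahCocycle hflat h m v x * C.q = 0) :
    ∃ u ∈ cochains ι X 0, ∃ (DL' : Superconnection R PL X) (h' : Extends ι DA DL'),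
      atiyahCocycle hflat h' = atiyahCocycle hflat h - hatDiff ι DA 0 u ∧
      ∀ n < m + 1, atiyahCocycle hflat h' n = 0 := by
  -- This is the parity of `1 - m`, the degree of the endomorphisms in `α^(m)`.
  let s : ℤ := (m + 1 : ℤ).negOnePow
  have hs : s * s = 1 := by
    change ((_ : ℤˣ) : ℤ) * _ = 1
    rw [← Units.val_mul, Int.units_mul_self, Units.val_one]
  -- The lowest part of `s w` is `s • ∂w + w∂`; the extra factor `s` in `w` turns it into the
  -- commutator formula of `commutator_homotopyEnd`.
  let w : PA [⋀^Fin m]→ₗ[R] (Normal ι →ₗ[R] Module.End R (⨁ i, X i)) :=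
    (LinearMap.compRight R (s • C.homotopyEnd s)).compAlternatingMap (atiyahCocycle hflat h m)
  have hw : ∀ v x, w v x = s • C.homotopyEnd s (atiyahCocycle hflat h m v x) := fun _ _ => rfl
  have hu : single m w ∈ cochains ι X 0 := by
    intro n v x
    by_cases hn : n = m
    · subst hn
      rw [single_self, hw]
      exact zsmul_mem (C.homotopyEnd_mem s (by omega)
        (atiyahCocycle_mem_cochains hflat h n v x)) _
    · rw [single_of_ne hn]
      exact Submodule.zero_mem _
  obtain ⟨DL', h', hα, -⟩ := exists_modification r hr (single m w) hflat h hu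
  refine ⟨single m w, hu, DL', h', hα, fun n hn => ?_⟩
  refine AlternatingMap.ext fun v => LinearMap.ext fun x => ?_
  rw [hα]
  change atiyahCocycle hflat h n v x - hatDiff ι DA 0 (single m w) n v x = 0
  rcases Nat.lt_succ_iff_lt_or_eq.1 hn with hlt | rfl
  · rw [h0 n hlt, hatDiff_single_of_lt 0 hlt w]
    exact sub_zero 0
  · rw [hatDiff_apply_of_lt 0 (single n w) n (fun k hk => single_of_ne (by omega) w), single_self,
      hw, sub_eq_zero]
    have h1 := C.commutator_homotopyEnd hs (atiyahCocycle_lowest hflat h n h0 v x) (hq v x)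
    have h2 : (((0 : ℤ) + 1).negOnePow : ℤ) = -1 := rfl
    rw [h2]
    change _ = s • (DA.diff * (s • _)) - _
    rw [mul_smul_comm, smul_smul, hs, one_smul, neg_one_smul, sub_neg_eq_add, smul_mul_assoc, h1]

theorem sub_hatDiff_trans {u w : Fam R PA (Normal ι →ₗ[R] Module.End R (⨁ i, X i))}
    {a b c : Fam R PA (Normal ι →ₗ[R] Module.End R (⨁ i, X i))}
    (hb : b = a - hatDiff ι DA 0 u) (hc : c = b - hatDiff ι DA 0 w) :
    c = a - hatDiff ι DA 0 (u + w) := by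
  rw [hc, hb, map_add, sub_sub]

/-- From form degree two on, `α^(m)` has degree `1 - m ≠ 0`, so there is no obstruction; removing a
component only affects components of the same or higher form degree. -/
theorem exists_modification_higher (hr : ∀ a, r (ι a) = a) (C : Contraction DA.diff)
    (hflat : DA.IsFlat) (h : Extends ι DA DL)
    (h0 : ∀ n < 2, atiyahCocycle hflat h n = 0) (k : ℕ) :
    ∃ u ∈ cochains ι X 0, ∃ (DL' : Superconnection R PL X) (h' : Extends ι DA DL'),
      atiyahCocycle hflat h' = atiyahCocycle hflat h - hatDiff ι DA 0 u ∧
      ∀ n < k + 2, atiyahCocycle hflat h' n = 0 := by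
  induction k with
  | zero =>
    exact ⟨0, Submodule.zero_mem _, DL, h, by rw [map_zero, sub_zero], h0⟩
  | succ k ih =>
    obtain ⟨u, hu, DL', h', hα, h0'⟩ := ih
    obtain ⟨w, hw, DL'', h'', hα', h0''⟩ := exists_modification_lowest hr C hflat h' (k + 2) h0'
      fun v x => C.q_mul_q_of_ne (j := 1 - ((k + 2 : ℕ) : ℤ)) (by push_cast; omega)
        (atiyahCocycle_mem_cochains hflat h' (k + 2) v x)
    refine ⟨u + w, Submodule.add_mem _ hu hw, DL'', h'', sub_hatDiff_trans hα hα', ?_⟩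
    intro n hn
    exact h0'' n (by omega)

/-- A module supported in degrees from `-N` to `0` leaves no room for a shift by less than `-N`. -/
theorem endDeg_eq_zero {N : ℕ} (hpos : ∀ i, 0 < i → Subsingleton (X i))
    (hfin : ∀ i, i < -(N : ℤ) → Subsingleton (X i)) {j : ℤ} (hj : j < -(N : ℤ))
    {φ : Module.End R (⨁ i, X i)} (hφ : φ ∈ endDeg R X j) : φ = 0 := by
  refine DirectSum.linearMap_ext R fun i => LinearMap.ext fun e => ?_
  change φ (DirectSum.lof R ℤ X i e) = 0
  by_cases hi : 0 < i
  · have := hpos i hi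
    rw [Subsingleton.elim e 0, map_zero, map_zero]
  · obtain ⟨e', he'⟩ := hφ i e
    have := hfin (i + j) (by omega)
    rw [← he', Subsingleton.elim e' 0, map_zero]

namespace Contraction

variable (C : Contraction DA.diff)

/-- The inclusion of the cohomology as the harmonic elements. -/
def incl : DA.Coh 0 →ₗ[R] (⨁ i, X i) :=
  ((DA.imAt 0).submoduleOf (DA.kerAt 0)).liftQ
    (C.q ∘ₗ DirectSum.lof R ℤ X 0 ∘ₗ (DA.kerAt 0).subtype) (by
      rintro e ⟨t, ht⟩
      change C.q (DirectSum.lof R ℤ X 0 e.1) = 0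
      have ht' : DA.diff t = DirectSum.lof R ℤ X 0 e.1 := ht
      rw [← ht']
      exact LinearMap.congr_fun C.q_diff t)

theorem incl_mk (e : DA.kerAt 0) :
    C.incl (Submodule.Quotient.mk e) = C.q (DirectSum.lof R ℤ X 0 e.1) := rfl

theorem diff_incl (e : DA.Coh 0) : DA.diff (C.incl e) = 0 := by
  obtain ⟨e, rfl⟩ := Submodule.Quotient.mk_surjective _ e
  exact LinearMap.congr_fun C.diff_q _

theorem incl_mem (e : DA.Coh 0) : C.incl e ∈ LinearMap.range (DirectSum.lof R ℤ X 0) := by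
  obtain ⟨e, rfl⟩ := Submodule.Quotient.mk_surjective _ e
  exact C.q_mem 0 e.1

theorem lof_component_q (x : ⨁ i, X i) :
    DirectSum.lof R ℤ X 0 (DirectSum.component R ℤ X 0 (C.q x)) = C.q x := by
  suffices h : DirectSum.lof R ℤ X 0 ∘ₗ DirectSum.component R ℤ X 0 ∘ₗ C.q = C.q from
    LinearMap.congr_fun h x
  refine DirectSum.linearMap_ext R fun i => LinearMap.ext fun e => ?_
  change DirectSum.lof R ℤ X 0 (DirectSum.component R ℤ X 0 (C.q (DirectSum.lof R ℤ X i e)))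
    = C.q (DirectSum.lof R ℤ X i e)
  by_cases hi : i = 0
  · subst hi
    obtain ⟨e', he'⟩ := C.q_mem 0 e
    have he'' : DirectSum.lof R ℤ X 0 e' = C.q (DirectSum.lof R ℤ X 0 e) := he'
    rw [← he'', DirectSum.component.lof_self]
  · rw [C.q_apply i hi, map_zero, map_zero]

/-- The projection to the cohomology. -/
def proj : (⨁ i, X i) →ₗ[R] DA.Coh 0 :=
  Submodule.mkQ _ ∘ₗ (DirectSum.component R ℤ X 0 ∘ₗ C.q).codRestrict (DA.kerAt 0) fun x => by
    change DA.diff (DirectSum.lof R ℤ X 0 (DirectSum.component R ℤ X 0 (C.q x))) = 0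
    rw [lof_component_q]
    exact LinearMap.congr_fun C.diff_q x

theorem proj_diff (x : ⨁ i, X i) : C.proj (DA.diff x) = 0 := by
  have h : C.q (DA.diff x) = 0 := LinearMap.congr_fun C.q_diff x
  refine (Submodule.Quotient.mk_eq_zero _).2 ?_
  refine ⟨0, ?_⟩
  change DA.diff 0 = DirectSum.lof R ℤ X 0 (DirectSum.component R ℤ X 0 (C.q (DA.diff x)))
  rw [h, map_zero, map_zero, map_zero]

/-- On closed elements the homotopy formula reduces to `q e = e - ∂ (h e)`, so `q` does not change
cohomology classes. -/
theorem q_lof_sub_mem {e : X 0} (he : DA.diff (DirectSum.lof R ℤ X 0 e) = 0) :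
    C.q (DirectSum.lof R ℤ X 0 e) - DirectSum.lof R ℤ X 0 e ∈ LinearMap.range DA.diff := by
  have h := LinearMap.congr_fun C.homotopy (DirectSum.lof R ℤ X 0 e)
  change C.q (DirectSum.lof R ℤ X 0 e) + DA.diff (C.h (DirectSum.lof R ℤ X 0 e))
    + C.h (DA.diff (DirectSum.lof R ℤ X 0 e)) = DirectSum.lof R ℤ X 0 e at h
  rw [he, map_zero, add_zero] at h
  refine ⟨-C.h (DirectSum.lof R ℤ X 0 e), ?_⟩
  rw [map_neg]
  nth_rewrite 3 [← h]
  abel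

theorem proj_lof (e : DA.kerAt 0) :
    C.proj (DirectSum.lof R ℤ X 0 e.1) = Submodule.Quotient.mk e := by
  refine (Submodule.Quotient.eq _).2 ?_
  change DirectSum.lof R ℤ X 0 (DirectSum.component R ℤ X 0 (C.q (DirectSum.lof R ℤ X 0 e.1)) - e.1)
    ∈ LinearMap.range DA.diff
  rw [map_sub, lof_component_q]
  exact C.q_lof_sub_mem e.2

theorem proj_of_mem {i : ℤ} (hi : i ≠ 0) (e : X i) : C.proj (DirectSum.lof R ℤ X i e) = 0 := by
  refine (Submodule.Quotient.mk_eq_zero _).2 ⟨0, ?_⟩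
  change DA.diff 0 = DirectSum.lof R ℤ X 0
    (DirectSum.component R ℤ X 0 (C.q (DirectSum.lof R ℤ X i e)))
  rw [C.q_apply i hi, map_zero, map_zero, map_zero]

/-- The endomorphism given by an endomorphism of the cohomology. -/
def liftEnd : Module.End R (DA.Coh 0) →ₗ[R] Module.End R (⨁ i, X i) where
  toFun φ := C.incl ∘ₗ φ ∘ₗ C.proj
  map_add' φ ψ := LinearMap.ext fun x => map_add C.incl _ _
  map_smul' c φ := LinearMap.ext fun x => map_smul C.incl c _

theorem liftEnd_apply (φ : Module.End R (DA.Coh 0)) (x : ⨁ i, X i) :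
    C.liftEnd φ x = C.incl (φ (C.proj x)) := rfl

theorem liftEnd_mem (φ : Module.End R (DA.Coh 0)) : C.liftEnd φ ∈ endDeg R X 0 := by
  intro i e
  by_cases hi : i = 0
  · subst hi
    exact C.incl_mem _
  · rw [liftEnd_apply, C.proj_of_mem hi, map_zero, map_zero]
    exact Submodule.zero_mem _

/-- With `liftEnd_mul_diff` this shows that lifted endomorphisms commute with `∂`, so modifying by
them does not bring back `α^(0)`. -/
theorem diff_mul_liftEnd (φ : Module.End R (DA.Coh 0)) : DA.diff * C.liftEnd φ = 0 :=
  LinearMap.ext fun _ => C.diff_incl _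

theorem liftEnd_mul_diff (φ : Module.End R (DA.Coh 0)) : C.liftEnd φ * DA.diff = 0 :=
  LinearMap.ext fun x => by
    change C.incl (φ (C.proj (DA.diff x))) = 0
    rw [proj_diff, map_zero, map_zero]

end Contraction

/-- Modification of the superconnection so as to change the induced connection on the
cohomology by a given form. -/
theorem exists_modification_coh (hr : ∀ a, r (ι a) = a) (C : Contraction DA.diff)
    (hflat : DA.IsFlat) (h : Extends ι DA DL) (h0 : atiyahCocycle hflat h 0 = 0)
    (c : Normal ι →ₗ[R] Module.End R (DA.Coh 0)) :
    ∃ u ∈ cochains ι X 0, ∃ (DL' : Superconnection R PL X) (h' : Extends ι DA DL')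
      (h0' : atiyahCocycle hflat h' 0 = 0),
      atiyahCocycle hflat h' = atiyahCocycle hflat h - hatDiff ι DA 0 u ∧
      ∀ l e, inducedConn DA DL' (h'.conn_diff hflat h0') 0 l e
        = inducedConn DA DL (h.conn_diff hflat h0) 0 l e - c (Submodule.Quotient.mk l) e := by
  let w : PA [⋀^Fin 0]→ₗ[R] (Normal ι →ₗ[R] Module.End R (⨁ i, X i)) :=
    AlternatingMap.constOfIsEmpty R PA (Fin 0) (C.liftEnd ∘ₗ c)
  have hw : ∀ v x, w v x = C.liftEnd (c x) := fun _ _ => rfl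
  have hu : single 0 w ∈ cochains ι X 0 := by
    intro n v x
    by_cases hn : n = 0
    · subst hn
      rw [single_self, hw]
      exact C.liftEnd_mem _
    · rw [single_of_ne hn]
      exact Submodule.zero_mem _
  obtain ⟨DL', h', hα, hconn⟩ := exists_modification r hr (single 0 w) hflat h hu
  have h0' : atiyahCocycle hflat h' 0 = 0 := by
    refine AlternatingMap.ext fun v => LinearMap.ext fun x => ?_
    rw [hα]
    change atiyahCocycle hflat h 0 v x - hatDiff ι DA 0 (single 0 w) 0 v x = 0
    rw [h0, hatDiff_apply_of_lt 0 (single 0 w) 0 (fun k hk => absurd hk (Nat.not_lt_zero k)),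
      single_self, hw, C.diff_mul_liftEnd, C.liftEnd_mul_diff, smul_zero, smul_zero, sub_zero]
    exact sub_zero 0
  refine ⟨single 0 w, hu, DL', h', h0', hα, fun l e => ?_⟩
  obtain ⟨e, rfl⟩ := Submodule.Quotient.mk_surjective _ e
  obtain ⟨f, hf⟩ := Submodule.Quotient.mk_surjective _
    (c (Submodule.Quotient.mk l) (Submodule.Quotient.mk e))
  -- The lift of `c` produces the harmonic representative `q f` instead of `f`; both represent the
  -- same class.
  have h1 : ∃ f' : DA.kerAt 0, DirectSum.lof R ℤ X 0 f'.1 = C.q (DirectSum.lof R ℤ X 0 f.1) := by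
    obtain ⟨f', hf'⟩ := C.q_mem 0 f.1
    have hf'' : DirectSum.lof R ℤ X 0 f' = C.q (DirectSum.lof R ℤ X 0 f.1) := hf'
    refine ⟨⟨f', ?_⟩, hf''⟩
    change DA.diff (DirectSum.lof R ℤ X 0 f') = 0
    rw [hf'']
    exact LinearMap.congr_fun C.diff_q _
  obtain ⟨f', hf'⟩ := h1
  have hff : (Submodule.Quotient.mk f' : DA.Coh 0) = Submodule.Quotient.mk f := by
    refine (Submodule.Quotient.eq _).2 ?_
    change DirectSum.lof R ℤ X 0 (f'.1 - f.1) ∈ LinearMap.range DA.diff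
    rw [map_sub, hf']
    exact C.q_lof_sub_mem f.2
  have h2 : ∃ g : DA.kerAt 0, DirectSum.lof R ℤ X 0 g.1 = DL.conn l (DirectSum.lof R ℤ X 0 e.1) := by
    have hl := DL.lof_connAt 0 l e.1
    refine ⟨⟨DL.connAt 0 l e.1, ?_⟩, hl⟩
    change DA.diff (DirectSum.lof R ℤ X 0 _) = 0
    have he : DA.diff (DirectSum.lof R ℤ X 0 e.1) = 0 := e.2
    rw [hl, ← h.conn_diff hflat h0, he, map_zero]
  obtain ⟨g, hg⟩ := h2
  rw [inducedConn_mk (h.conn_diff hflat h0) 0 l e g hg, ← hf, ← hff, ← Submodule.Quotient.mk_sub]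
  refine inducedConn_mk (h'.conn_diff hflat h0') 0 l e (g - f') ?_
  rw [hconn, single_self, hw, Contraction.liftEnd_apply, C.proj_lof, ← hf, C.incl_mk, ← hf', ← hg]
  exact map_sub _ _ _

/-- If the Atiyah class of the cohomology vanishes, so does that of `E`. -/
theorem atiyahCocycle_mem_coboundaries (hr : ∀ a, r (ι a) = a) (C : Contraction DA.diff)
    (hpos : ∀ i, 0 < i → Subsingleton (X i))
    (hfin : ∃ N : ℕ, ∀ i, i < -(N : ℤ) → Subsingleton (X i)) (hflat : DA.IsFlat)
    (h : Extends ι DA DL) {nabla : Connection R PL (DA.Coh 0)}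
    (hnabla : Connection.Extends ι (DA.connCoh hflat 0) nabla)
    (hat : Connection.atiyahCocycle ι (DA.connCoh hflat 0) nabla (DA.connCoh_curvature hflat 0)
      hnabla ∈ (Connection.hatConn ι (DA.connCoh hflat 0)).coboundaries 1) :
    ∃ u ∈ cochains ι X 0, hatDiff ι DA 0 u = atiyahCocycle hflat h := by
  -- The component `α^(0)` has endomorphism degree 1 and is removed without obstruction.
  obtain ⟨u₁, hu₁, DL₁, h₁, hα₁, h0₁⟩ := exists_modification_lowest hr C hflat h 0
    (fun n hn => absurd hn (Nat.not_lt_zero n)) fun v x => C.q_mul_q_of_ne (j := 1 - ((0 : ℕ) : ℤ))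
      (by simp) (atiyahCocycle_mem_cochains hflat h 0 v x)
  have h0₁' := h0₁ 0 (by omega)
  obtain ⟨w, hw⟩ := hat
  have hcW : (AlternatingMap.constOfIsEmpty R PA (Fin 0) (w ![])) = w :=
    AlternatingMap.ext fun v => congrArg w (Subsingleton.elim _ _)
  -- Subtracting the primitive `w` from the given connection makes its Atiyah cocycle vanish
  -- identically.
  let nabla' := nabla.subHom (w ![])
  have hnabla' : Connection.Extends ι (DA.connCoh hflat 0) nabla' := hnabla.subHom (w ![])
  have hat' : Connection.atiyahCocycle ι (DA.connCoh hflat 0) nabla'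
      (DA.connCoh_curvature hflat 0) hnabla' = 0 := by
    refine AlternatingMap.ext fun v => LinearMap.ext fun x => LinearMap.ext fun e => ?_
    rw [Connection.atiyahCocycle_sub (DA.connCoh_curvature hflat 0) hnabla hnabla' (w ![])
      (fun l e => rfl), hcW, hw]
    exact sub_self _
  -- The form used is the difference of the induced connection and `nabla'`, so that the new induced
  -- connection is `nabla'` itself.
  obtain ⟨u₂, hu₂, DL₂, h₂, h0₂, hα₂, hconn⟩ := exists_modification_coh hr C hflat h₁ h0₁'
    ((h₁.inducedConn hflat (h₁.conn_diff hflat h0₁') 0).diff hnabla')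
  have hconn' : inducedConn DA DL₂ (h₂.conn_diff hflat h0₂) 0 = nabla' := by
    have : ∀ l e, inducedConn DA DL₂ (h₂.conn_diff hflat h0₂) 0 l e = nabla' l e := fun l e => by
      rw [hconn, Connection.Extends.diff_mk, sub_sub_cancel]
    cases hN : nabla' with | mk F hF => ?_
    cases hM : inducedConn DA DL₂ (h₂.conn_diff hflat h0₂) 0 with | mk G hG => ?_
    rw [hN, hM] at this
    congr 1
    exact LinearMap.ext fun l => LinearMap.ext fun e => this l e
  have hat₂ : Connection.atiyahCocycle ι (DA.connCoh hflat 0)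
      (inducedConn DA DL₂ (h₂.conn_diff hflat h0₂) 0) (DA.connCoh_curvature hflat 0)
      (h₂.inducedConn hflat (h₂.conn_diff hflat h0₂) 0) = 0 := by
    simp only [hconn']
    exact hat'
  have hmem := (atiyahCocycle_inducedConn_eq_zero_iff hflat h₂ (h₂.conn_diff hflat h0₂) 0).1 hat₂
  -- This is the only place where the hypothesis on the cohomology is needed: it gives `q α^(1) q =
  -- 0`.
  obtain ⟨u₃, hu₃, DL₃, h₃, hα₃, h0₃⟩ := exists_modification_lowest hr C hflat h₂ 1
    (fun n hn => by
      obtain rfl : n = 0 := by omega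
      exact h0₂) fun v x => C.q_mul_q_of_mem fun e he => hmem v x ⟨e, he⟩
  obtain ⟨N, hN⟩ := hfin
  obtain ⟨u₄, hu₄, DL₄, h₄, hα₄, h0₄⟩ := exists_modification_higher hr C hflat h₃ h0₃ N
  -- For `n ≥ N + 2` the degree `1 - n` is below `-N`, so the remaining components vanish
  -- automatically.
  have hα₄0 : atiyahCocycle hflat h₄ = 0 := by
    ext1 n
    by_cases hn : n < N + 2
    · exact h0₄ n hn
    · refine AlternatingMap.ext fun v => LinearMap.ext fun x => ?_
      exact endDeg_eq_zero hpos hN (j := 1 - (n : ℤ)) (by omega)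
        (atiyahCocycle_mem_cochains hflat h₄ n v x)
  have hfinal := sub_hatDiff_trans (sub_hatDiff_trans (sub_hatDiff_trans hα₁ hα₂) hα₃) hα₄
  rw [hα₄0] at hfinal
  exact ⟨u₁ + u₂ + u₃ + u₄, Submodule.add_mem _ (Submodule.add_mem _
    (Submodule.add_mem _ hu₁ hu₂) hu₃) hu₄, (sub_eq_zero.1 hfinal.symm).symm⟩

/-- The Atiyah class of a resolution vanishes if and only if that of its cohomology does. -/
theorem cohomologyClass_atiyahCocycle_eq_zero_iff
    (hι : ∃ r : PL →ₗ[R] PA, ∀ a, r (ι a) = a) (hC : Nonempty (Contraction DA.diff))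
    (hpos : ∀ i, 0 < i → Subsingleton (X i))
    (hfin : ∃ N : ℕ, ∀ i, i < -(N : ℤ) → Subsingleton (X i)) (hflat : DA.IsFlat)
    (h : Extends ι DA DL) {nabla : Connection R PL (DA.Coh 0)}
    (hnabla : Connection.Extends ι (DA.connCoh hflat 0) nabla) :
    ∃ (hα : atiyahCocycle hflat h ∈ cocycles ι DA 1)
      (hat : Connection.atiyahCocycle ι (DA.connCoh hflat 0) nabla
            (DA.connCoh_curvature hflat 0) hnabla ∈
          (Connection.hatConn ι (DA.connCoh hflat 0)).cocycles 1),
      (cohomologyClass ι DA 1 ⟨_, hα⟩ = 0 ↔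
        (Connection.hatConn ι (DA.connCoh hflat 0)).cohomologyClass 1 ⟨_, hat⟩ = 0) := by
  refine ⟨atiyahCocycle_mem_cocycles hflat h, Connection.atiyahCocycle_mem_cocycles _ hnabla, ?_⟩
  obtain ⟨r, hr⟩ := hι
  obtain ⟨C⟩ := hC
  refine (Submodule.Quotient.mk_eq_zero _).trans
    (Iff.trans ?_ (Connection.cohomologyClass_eq_zero_iff _ 1 _).symm)
  constructor
  · rintro ⟨u, hu, hα⟩
    exact atiyahCocycle_coh_mem_coboundaries hr hflat h 0 hnabla hu hα
  · intro hat
    exact atiyahCocycle_mem_coboundaries hr C hpos hfin hflat h hnabla hat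

end Superconnection


/-! ### Sections of vector bundles and morphisms of constant rank. -/

section Sections

open Topology

theorem finiteDimensional_fiber {B : Type*} [TopologicalSpace B] (F : Type*) [NormedAddCommGroup F]
    [NormedSpace ℝ F] [FiniteDimensional ℝ F] {V : B → Type*} [TopologicalSpace (TotalSpace F V)]
    [∀ x, TopologicalSpace (V x)] [∀ x, AddCommGroup (V x)] [∀ x, Module ℝ (V x)]
    [FiberBundle F V] [VectorBundle ℝ F V] (x : B) : FiniteDimensional ℝ (V x) :=
  LinearEquiv.finiteDimensional
    ((trivializationAt F V x).continuousLinearEquivAt ℝ x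
      (mem_baseSet_trivializationAt F V x)).symm.toLinearEquiv

variable {EM : Type*} [NormedAddCommGroup EM] [NormedSpace ℝ EM] [FiniteDimensional ℝ EM]
  {H : Type*} [TopologicalSpace H] {I : ModelWithCorners ℝ EM H}
  {M : Type*} [TopologicalSpace M] [ChartedSpace H M] [IsManifold I ∞ M]
  [T2Space M] [SigmaCompactSpace M]
  {F : Type*} [NormedAddCommGroup F] [NormedSpace ℝ F] [FiniteDimensional ℝ F]
  {V : M → Type*} [TopologicalSpace (TotalSpace F V)]
  [∀ x, TopologicalSpace (V x)] [∀ x, AddCommGroup (V x)] [∀ x, Module ℝ (V x)]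
  [FiberBundle F V] [VectorBundle ℝ F V] [ContMDiffVectorBundle ∞ F V I]
  {F' : Type*} [NormedAddCommGroup F'] [NormedSpace ℝ F'] [FiniteDimensional ℝ F']
  {V' : M → Type*} [TopologicalSpace (TotalSpace F' V')]
  [∀ x, TopologicalSpace (V' x)] [∀ x, AddCommGroup (V' x)] [∀ x, Module ℝ (V' x)]
  [FiberBundle F' V'] [VectorBundle ℝ F' V'] [ContMDiffVectorBundle ∞ F' V' I]

variable (I) in
theorem exists_bump {U : Set M} (hU : IsOpen U) {x : M} (hx : x ∈ U) :
    ∃ b : C^∞⟮I, M; 𝓘(ℝ, ℝ), ℝ⟯, b x = 1 ∧ tsupport b ⊆ U := by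
  have : LocallyCompactSpace H := I.locallyCompactSpace
  have : LocallyCompactSpace M := ChartedSpace.locallyCompactSpace H M
  obtain ⟨b, h0, h1, -⟩ := exists_contMDiffMap_zero_one_nhds_of_isClosed I (n := ⊤)
    hU.isClosed_compl (isClosed_singleton (x := x)) (by simpa using hx)
  refine ⟨b, h1.self_of_nhdsSet x rfl, fun y hy => ?_⟩
  by_contra hyU
  exact notMem_tsupport_iff_eventuallyEq.2 (Filter.Eventually.filter_mono
    (nhds_le_nhdsSet (Set.mem_compl hyU)) h0) hy

/-- There is a section through every point. -/
theorem exists_section_eq (x : M) (v : V x) : ∃ s : Cₛ^∞⟮I; F, V⟯, s x = v := by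
  have : ContMDiffVectorBundle 1 F V I := ContMDiffVectorBundle.of_le (n := ∞) (by simp)
  let e := trivializationAt F V x
  let b := Module.finBasis ℝ F
  have hx : x ∈ e.baseSet := mem_baseSet_trivializationAt F V x
  obtain ⟨f, hf1, hf2⟩ := exists_bump I e.open_baseSet hx
  -- The section has constant coefficients in a local frame and is then cut off by a bump function.
  let s₀ : ∀ y, V y := fun y => ∑ i, (e.localFrameCoeff I b i x v) • e.localFrame b i y
  have hs₀ : ContMDiffOn I (I.prod 𝓘(ℝ, F)) ∞ (fun y => TotalSpace.mk' F y (s₀ y)) e.baseSet :=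
    ContMDiffOn.sum_section fun i _ =>
      (e.contMDiffOn_localFrame_baseSet ∞ b i).const_smul_section
  refine ⟨⟨fun y => f y • s₀ y, ContMDiffOn.smul_section_of_tsupport f.contMDiff.contMDiffOn e.open_baseSet hf2
    hs₀⟩, ?_⟩
  change f x • s₀ x = v
  classical
  -- The expansion in the frame is pointwise, so any section with value `v` at `x` serves, even a
  -- discontinuous one.
  have h := e.eq_sum_localFrameCoeff_smul (I := I) (b := b) (s := Function.update 0 x v) hx
  rw [Function.update_self] at h
  rw [hf1, one_smul]
  exact h.symm

/-- Extension of a functional on a fiber to a functional on sections. -/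
theorem exists_functional (x : M) (l : V x →ₗ[ℝ] ℝ) :
    ∃ (Φ : Cₛ^∞⟮I; F, V⟯ →ₗ[C^∞⟮I, M; 𝓘(ℝ, ℝ), ℝ⟯] C^∞⟮I, M; 𝓘(ℝ, ℝ), ℝ⟯)
      (L : ∀ y, V y →ₗ[ℝ] ℝ), (∀ s y, Φ s y = L y (s y)) ∧ L x = l := by
  have : ContMDiffVectorBundle 1 F V I := ContMDiffVectorBundle.of_le (n := ∞) (by simp)
  let e := trivializationAt F V x
  let b := Module.finBasis ℝ F
  have hx : x ∈ e.baseSet := mem_baseSet_trivializationAt F V x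
  obtain ⟨f, hf1, hf2⟩ := exists_bump I e.open_baseSet hx
  let L : ∀ y, V y →ₗ[ℝ] ℝ := fun y =>
    f y • ∑ i, l (e.localFrame b i x) • e.localFrameCoeff I b i y
  have hL : ∀ y (v : V y), L y v
      = f y * ∑ i, l (e.localFrame b i x) * e.localFrameCoeff I b i y v := fun y v => by
    simp [L]
  have hsm : ∀ s : Cₛ^∞⟮I; F, V⟯, ContMDiff I 𝓘(ℝ, ℝ) ∞ fun y => L y (s y) := fun s => by
    simp only [hL]
    refine contMDiff_of_tsupport fun y hy => ?_
    have hy' : y ∈ e.baseSet := hf2 (tsupport_mul_subset_left hy)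
    refine f.contMDiff.contMDiffAt.mul ?_
    refine ContMDiffAt.sum fun i _ => contMDiffAt_const.mul ?_
    exact contMDiffAt_localFrameCoeff b hy' s.contMDiff.contMDiffAt i
  refine ⟨{ toFun := fun s => ⟨fun y => L y (s y), hsm s⟩
            map_add' := fun s t => ?_
            map_smul' := fun c s => ?_ }, L, fun s y => rfl, ?_⟩
  · ext y
    exact map_add (L y) (s y) (t y)
  · ext y
    exact map_smul (L y) (c y) (s y)
  · refine LinearMap.ext fun v => ?_
    rw [hL, hf1, one_mul]
    classical
    have h := e.eq_sum_localFrameCoeff_smul (I := I) (b := b) (s := Function.update 0 x v) hx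
    rw [Function.update_self] at h
    conv_rhs => rw [h, map_sum]
    refine Finset.sum_congr rfl fun i _ => ?_
    rw [map_smul, smul_eq_mul, mul_comm]

/-- The values at `x` of the sections in the image of `φ`. -/
def fiberRange (φ : Cₛ^∞⟮I; F, V⟯ →ₗ[C^∞⟮I, M; 𝓘(ℝ, ℝ), ℝ⟯] Cₛ^∞⟮I; F', V'⟯) (x : M) :
    Submodule ℝ (V' x) where
  carrier := {v | ∃ t, φ t x = v}
  add_mem' := by
    rintro _ _ ⟨t, rfl⟩ ⟨t', rfl⟩
    exact ⟨t + t', by rw [map_add]; rfl⟩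
  zero_mem' := ⟨0, by rw [map_zero]; rfl⟩
  smul_mem' := by
    rintro c _ ⟨t, rfl⟩
    exact ⟨algebraMap ℝ C^∞⟮I, M; 𝓘(ℝ, ℝ), ℝ⟯ c • t, by rw [map_smul]; rfl⟩

variable (φ : Cₛ^∞⟮I; F, V⟯ →ₗ[C^∞⟮I, M; 𝓘(ℝ, ℝ), ℝ⟯] Cₛ^∞⟮I; F', V'⟯)

/-- Linearity over smooth functions implies locality: a bump function supported where `s = t` makes
the two sections equal globally and does not change the values at `x`. -/
theorem linearMap_congr_of_eventuallyEq {s t : Cₛ^∞⟮I; F, V⟯} {x : M}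
    (h : ∀ᶠ y in 𝓝 x, s y = t y) : φ s x = φ t x := by
  obtain ⟨U, hU, hUo, hxU⟩ := eventually_nhds_iff.1 h
  obtain ⟨b, hb1, hb2⟩ := exists_bump I hUo hxU
  have h1 : b • s = b • t := by
    refine ContMDiffSection.ext fun y => ?_
    rw [section_smul_apply, section_smul_apply]
    by_cases hy : y ∈ U
    · rw [hU y hy]
    · have : b y = 0 := image_eq_zero_of_notMem_tsupport fun h' => hy (hb2 h')
      rw [this, zero_smul, zero_smul]
  have h2 := congrArg (fun s => φ s x) h1
  simpa only [map_smul, section_smul_apply, hb1, one_smul] using h2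

/-- Local generalized inverses of a morphism of constant rank. -/
theorem exists_local_inverse {r : ℕ} (hr : ∀ x, Module.finrank ℝ (fiberRange φ x) = r) (x : M) :
    ∃ (g : C^∞⟮I, M; 𝓘(ℝ, ℝ), ℝ⟯)
      (ψ : Cₛ^∞⟮I; F', V'⟯ →ₗ[C^∞⟮I, M; 𝓘(ℝ, ℝ), ℝ⟯] Cₛ^∞⟮I; F, V⟯), g x ≠ 0 ∧
      ∀ (s : Cₛ^∞⟮I; F', V'⟯) (y : M), g y ≠ 0 → s y ∈ fiberRange φ y →
        φ (ψ s) y = g y • s y := by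
  have hfd : ∀ y, FiniteDimensional ℝ (V' y) := finiteDimensional_fiber F'
  -- A basis of the image at `x` is realized by sections `φ (t i)`; dual functionals at `x` are
  -- extended to the functionals `Φ i`.
  let b := Module.finBasisOfFinrankEq ℝ (fiberRange φ x) (hr x)
  choose t ht using fun i => (b i).2
  have hli : LinearIndependent ℝ fun i => ((b i : fiberRange φ x) : V' x) :=
    b.linearIndependent.map' (fiberRange φ x).subtype (Submodule.ker_subtype _)
  let b' := Module.Basis.span hli
  have hl : ∀ i, ∃ l : V' x →ₗ[ℝ] ℝ, ∀ j, l (b j) = if j = i then 1 else 0 := fun i => by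
    obtain ⟨l, hl⟩ := LinearMap.exists_extend (b'.coord i)
    refine ⟨l, fun j => ?_⟩
    have h1 : l (b' j) = b'.coord i (b' j) := LinearMap.congr_fun hl (b' j)
    rw [Module.Basis.coord_apply, Module.Basis.repr_self, Finsupp.single_apply] at h1
    rwa [show ((b' j : Submodule.span ℝ _) : V' x) = b j from congrArg Subtype.val (Module.Basis.span_apply hli j)] at h1
  choose l hl using hl
  choose Φ L hΦ hL using fun i => exists_functional (I := I) (F := F') x (l i)
  let G : Matrix (Fin r) (Fin r) C^∞⟮I, M; 𝓘(ℝ, ℝ), ℝ⟯ := fun i j => Φ i (φ (t j))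
  let evy : M → C^∞⟮I, M; 𝓘(ℝ, ℝ), ℝ⟯ →+* ℝ := fun y =>
    { toFun := fun f => f y
      map_one' := rfl
      map_zero' := rfl
      map_add' := fun _ _ => rfl
      map_mul' := fun _ _ => rfl }
  have hdet : ∀ y, G.det y = ((evy y).mapMatrix G).det := fun y => RingHom.map_det (evy y) G
  -- Cramer's rule without division: the matrix `G` of the `Φ i (φ (t j))` is the identity at `x`,
  -- and the adjugate inverts it up to the factor `det G`.
  refine ⟨G.det, ∑ i, ∑ j, (G.adjugate i j • Φ j).smulRight (t i), ?_, fun s y hy hs => ?_⟩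
  · have h1 : (evy x).mapMatrix G = 1 := by
      ext i j
      change Φ i (φ (t j)) x = _
      rw [hΦ, hL, ht, hl, Matrix.one_apply]
      simp only [eq_comm]
    rw [hdet, h1, Matrix.det_one]
    exact one_ne_zero
  · let Gy := (evy y).mapMatrix G
    have hGy : ∀ i j, Gy i j = L i y (φ (t j) y) := fun i j => hΦ i _ y
    have hinj : ∀ c : Fin r → ℝ, Gy.mulVec c = 0 → c = 0 := fun c hc =>
      Matrix.eq_zero_of_mulVec_eq_zero (by rw [← hdet]; exact hy) hc
    have hLs : ∀ i (c : Fin r → ℝ), L i y (∑ j, c j • φ (t j) y) = Gy.mulVec c i := fun i c => by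
      rw [map_sum]
      refine Finset.sum_congr rfl fun j _ => ?_
      rw [map_smul, smul_eq_mul, mul_comm, ← hGy]
    let w : Fin r → fiberRange φ y := fun j => ⟨φ (t j) y, t j, rfl⟩
    have hw : LinearIndependent ℝ w := by
      refine Fintype.linearIndependent_iff.2 fun c hc => ?_
      have hc' : ∑ j, c j • φ (t j) y = 0 := by
        have := congrArg Subtype.val hc
        simpa [w] using this
      have := hinj c (funext fun i => by rw [← hLs, hc', map_zero]; rfl)
      exact fun i => congrFun this i
    -- Constant rank enters here: where `det G` is nonzero the `r` vectors `φ (t j) y` are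
    -- independent, hence span the image.
    have hspan : Submodule.span ℝ (Set.range w) = ⊤ :=
      hw.span_eq_top_of_card_eq_finrank' (by rw [Fintype.card_fin, hr])
    obtain ⟨c, hc⟩ := (Submodule.mem_span_range_iff_exists_fun ℝ).1
      (hspan ▸ Submodule.mem_top : (⟨s y, hs⟩ : fiberRange φ y) ∈ Submodule.span ℝ (Set.range w))
    have hc' : ∑ j, c j • φ (t j) y = s y := by
      have := congrArg Subtype.val hc
      simpa [w] using this
    have hsum : ∀ (u : Fin r → Cₛ^∞⟮I; F', V'⟯), (∑ i, u i) y = ∑ i, u i y := fun u =>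
      map_sum (⟨⟨fun s : Cₛ^∞⟮I; F', V'⟯ => s y, rfl⟩, fun _ _ => rfl⟩ :
        Cₛ^∞⟮I; F', V'⟯ →+ V' y) u _
    have h1 : φ ((∑ i, ∑ j, (G.adjugate i j • Φ j).smulRight (t i)) s) y
        = ∑ i, ∑ j, (G.adjugate i j y * Φ j s y) • φ (t i) y := by
      simp only [LinearMap.sum_apply, map_sum, hsum]
      refine Finset.sum_congr rfl fun i _ => Finset.sum_congr rfl fun j _ => ?_
      rw [LinearMap.smulRight_apply, map_smul]
      rfl
    have h2 : ∀ i j, G.adjugate i j y = Gy.adjugate i j := fun i j => by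
      have := RingHom.map_adjugate (evy y) G
      exact congrFun (congrFun this i) j
    have h3 : ∀ j, Φ j s y = Gy.mulVec c j := fun j => by rw [hΦ, ← hc', hLs]
    have h4 : ∀ i, ∑ j, Gy.adjugate i j * Gy.mulVec c j = G.det y * c i := fun i => by
      have : Gy.adjugate.mulVec (Gy.mulVec c) = Gy.det • c := by
        rw [Matrix.mulVec_mulVec, Matrix.adjugate_mul, Matrix.smul_mulVec, Matrix.one_mulVec]
      rw [hdet]
      exact congrFun this i
    rw [h1, ← hc', Finset.smul_sum]
    refine Finset.sum_congr rfl fun i _ => ?_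
    rw [← Finset.sum_smul, smul_smul, ← h4]
    simp only [h2, h3]

/-- Generalized inverses of a morphism of constant rank. -/
theorem exists_generalized_inverse {r : ℕ}
    (hr : ∀ x, Module.finrank ℝ (fiberRange φ x) = r) :
    ∃ ψ : Cₛ^∞⟮I; F', V'⟯ →ₗ[C^∞⟮I, M; 𝓘(ℝ, ℝ), ℝ⟯] Cₛ^∞⟮I; F, V⟯,
      ∀ (s : Cₛ^∞⟮I; F', V'⟯) (x : M), s x ∈ fiberRange φ x → φ (ψ s) x = s x := by
  choose g ψ hg hψ using exists_local_inverse φ hr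
  obtain ⟨ρ, hρ⟩ := SmoothPartitionOfUnity.exists_isSubordinate I (s := Set.univ) isClosed_univ
    (fun i : M => {x | g i x ≠ 0})
    (fun i => isOpen_ne_fun (g i).contMDiff.continuous continuous_const)
    (fun x _ => Set.mem_iUnion.2 ⟨x, hg x⟩)
  -- The quotient `ρ i / g i` is smooth because `ρ i` is supported where `g i` does not vanish.
  let θ : M → C^∞⟮I, M; 𝓘(ℝ, ℝ), ℝ⟯ := fun i =>
    ⟨fun x => ρ i x • (g i x)⁻¹, ρ.contMDiff_smul (n := ⊤) fun x hx =>
      ((g i).contMDiff.contMDiffAt).inv₀ (hρ i hx)⟩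
  have hθ : ∀ i x, ρ i x = 0 → θ i x = 0 := fun i x h => by
    change ρ i x • (g i x)⁻¹ = 0
    rw [h, zero_smul]
  have hsupp : ∀ s x, (Function.support fun i => θ i x • ψ i s x) ⊆ ρ.finsupport x := by
    intro s x i hi
    rw [Finset.mem_coe, SmoothPartitionOfUnity.mem_finsupport]
    exact fun h => hi (by change θ i x • _ = 0; rw [hθ i x h, zero_smul])
  have hfin : ∀ s x, (Function.support fun i => θ i x • ψ i s x).Finite := fun s x =>
    (ρ.finsupport x).finite_toSet.subset (hsupp s x)
  have hlf : ∀ s, LocallyFinite fun i => {x : M | θ i x • ψ i s x ≠ 0} := fun s =>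
    ρ.locallyFinite.subset fun i x hx h => hx (by rw [hθ i x h, zero_smul])
  let Ψ : Cₛ^∞⟮I; F', V'⟯ →ₗ[C^∞⟮I, M; 𝓘(ℝ, ℝ), ℝ⟯] Cₛ^∞⟮I; F, V⟯ :=
    { toFun := fun s => ⟨fun x => ∑ᶠ i, θ i x • ψ i s x,
        ContMDiff.finsum_section_of_locallyFinite (hlf s) fun i => (θ i • ψ i s).contMDiff⟩
      map_add' := fun s t => ContMDiffSection.ext fun x => by
        change ∑ᶠ i, θ i x • ψ i (s + t) x = ∑ᶠ i, θ i x • ψ i s x + ∑ᶠ i, θ i x • ψ i t x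
        rw [← finsum_add_distrib (hfin s x) (hfin t x)]
        refine finsum_congr fun i => ?_
        rw [map_add, ← smul_add]
        rfl
      map_smul' := fun f s => ContMDiffSection.ext fun x => by
        change ∑ᶠ i, θ i x • ψ i (f • s) x = f x • ∑ᶠ i, θ i x • ψ i s x
        rw [smul_finsum' _ (hfin s x)]
        refine finsum_congr fun i => ?_
        rw [map_smul, section_smul_apply, smul_comm] }
  refine ⟨Ψ, fun s x hs => ?_⟩
  -- Near `x` the sum is finite with a fixed index set, and by locality `φ` may be applied termwise.
  have h1 : ∀ᶠ y in 𝓝 x, Ψ s y = (∑ i ∈ ρ.fintsupport x, θ i • ψ i s) y := by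
    filter_upwards [ρ.eventually_finsupport_subset x] with y hy
    have h2 : (∑ i ∈ ρ.fintsupport x, θ i • ψ i s) y = ∑ i ∈ ρ.fintsupport x, θ i y • ψ i s y :=
      map_sum (⟨⟨fun s : Cₛ^∞⟮I; F, V⟯ => s y, rfl⟩, fun _ _ => rfl⟩ :
        Cₛ^∞⟮I; F, V⟯ →+ V y) _ _
    rw [h2]
    exact finsum_eq_sum_of_support_subset _ ((hsupp s y).trans (Finset.coe_subset.2 hy))
  rw [linearMap_congr_of_eventuallyEq φ h1, map_sum]
  have h2 : (∑ i ∈ ρ.fintsupport x, φ (θ i • ψ i s)) x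
      = ∑ i ∈ ρ.fintsupport x, φ (θ i • ψ i s) x :=
    map_sum (⟨⟨fun s : Cₛ^∞⟮I; F', V'⟯ => s x, rfl⟩, fun _ _ => rfl⟩ :
      Cₛ^∞⟮I; F', V'⟯ →+ V' x) _ _
  have h3 : ∀ i, φ (θ i • ψ i s) x = ρ i x • s x := fun i => by
    rw [map_smul, section_smul_apply]
    by_cases h : ρ i x = 0
    · rw [hθ i x h, h, zero_smul, zero_smul]
    · have hgi : g i x ≠ 0 := hρ i (subset_tsupport _ h)
      rw [hψ i s x hgi hs]
      change (ρ i x • (g i x)⁻¹) • g i x • s x = _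
      rw [smul_smul, smul_eq_mul, mul_assoc, inv_mul_cancel₀ hgi, mul_one]
  rw [h2]
  simp only [h3]
  rw [← Finset.sum_smul, ρ.sum_finsupport' x (Set.mem_univ x) (ρ.finsupport_subset_fintsupport x),
    one_smul]

end Sections


open Forms

/-! ### The contraction of a regular resolution. -/

namespace Superconnection

section Algebra

variable {R : Type*} [CommRing R] {X : ℤ → Type*} [∀ i, AddCommGroup (X i)] [∀ i, Module R (X i)]

/-- The component `X (i - 1) → X i` of an endomorphism. -/
def stepAt (D : Module.End R (⨁ i, X i)) (i : ℤ) : X (i - 1) →ₗ[R] X i :=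
  DirectSum.component R ℤ X i ∘ₗ D ∘ₗ DirectSum.lof R ℤ X (i - 1)

variable {D : Module.End R (⨁ i, X i)}

theorem component_eq_stepAt (hD : D ∈ endDeg R X 1) (i : ℤ) (t : ⨁ i, X i) :
    DirectSum.component R ℤ X i (D t) = stepAt D i (DirectSum.component R ℤ X (i - 1) t) := by
  suffices h : DirectSum.component R ℤ X i ∘ₗ D = stepAt D i ∘ₗ DirectSum.component R ℤ X (i - 1)
    from LinearMap.congr_fun h t
  refine DirectSum.linearMap_ext R fun j => LinearMap.ext fun e => ?_
  change DirectSum.component R ℤ X i (D (DirectSum.lof R ℤ X j e))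
    = stepAt D i (DirectSum.component R ℤ X (i - 1) (DirectSum.lof R ℤ X j e))
  by_cases hj : j = i - 1
  · subst hj
    rw [DirectSum.component.lof_self]
    rfl
  · obtain ⟨e', he'⟩ := hD j e
    rw [← he', DirectSum.component.of, DirectSum.component.of, dif_neg hj, dif_neg (by omega),
      map_zero]

theorem lof_stepAt (hD : D ∈ endDeg R X 1) (i : ℤ) (e : X (i - 1)) :
    DirectSum.lof R ℤ X i (stepAt D i e) = D (DirectSum.lof R ℤ X (i - 1) e) := by
  obtain ⟨e', he'⟩ := endDeg_apply hD (k := i) ⟨e, rfl⟩ (by omega)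
  have : stepAt D i e = e' := by
    change DirectSum.component R ℤ X i (D (DirectSum.lof R ℤ X (i - 1) e)) = e'
    rw [← he', DirectSum.component.lof_self]
  rw [this, he']

theorem one_mem_endDeg : (1 : Module.End R (⨁ i, X i)) ∈ endDeg R X 0 := fun i e =>
  lof_range_congr (i := i) (add_zero i).symm ⟨e, rfl⟩

/-- Contracting data from a generalized inverse of `∂` of degree `-1`. -/
def Contraction.ofInverse (h : Module.End R (⨁ i, X i)) (hD : D ∈ endDeg R X 1) (hDD : D * D = 0)
    (hh : h ∈ endDeg R X (-1)) (hDhD : D * h * D = D)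
    (hker : ∀ i, i ≠ 0 → ∀ e : X i, D (DirectSum.lof R ℤ X i e) = 0 →
      D (h (DirectSum.lof R ℤ X i e)) = DirectSum.lof R ℤ X i e) : Contraction D := by
  have hDh : D * h ∈ endDeg R X 0 := endDeg_mul hD hh (by omega)
  have hq : 1 - D * h - h * D ∈ endDeg R X 0 :=
    Submodule.sub_mem _ (Submodule.sub_mem _ one_mem_endDeg hDh) (endDeg_mul hh hD (by omega))
  have hDq : D * (1 - D * h - h * D) = 0 := by
    rw [mul_sub, mul_sub, ← mul_assoc, ← mul_assoc, hDD, hDhD]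
    simp
  have hqD : (1 - D * h - h * D) * D = 0 := by
    rw [sub_mul, sub_mul, mul_assoc h, hDD, hDhD]
    simp
  have hDhq : D * (D * h * (1 - D * h - h * D)) = 0 := by
    rw [← mul_assoc, ← mul_assoc, hDD, zero_mul, zero_mul]
  -- The operator `p = 1 - Dh - hD` satisfies `Dp = pD = 0` but need not vanish outside degree 0.
  -- There `Dh` is the identity on closed elements, so `p - Dhp` vanishes; replacing `h` by `h + hp`
  -- preserves the homotopy identity because `pD = 0`.
  exact
    { h := h + h * (1 - D * h - h * D)
      q := (1 - D * h - h * D) - D * h * (1 - D * h - h * D)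
      h_mem := Submodule.add_mem _ hh (endDeg_mul hh hq (by omega))
      q_mem := Submodule.sub_mem _ hq (endDeg_mul hDh hq (by omega))
      homotopy := by
        rw [add_mul, mul_assoc h (1 - D * h - h * D), hqD, mul_zero, mul_add, ← mul_assoc D h]
        abel
      diff_q := by rw [mul_sub, hDq, hDhq, sub_zero]
      q_diff := by rw [sub_mul, mul_assoc (D * h), hqD, mul_zero, sub_zero]
      q_apply := fun i hi e => by
        obtain ⟨e', he'⟩ := endDeg_apply hq (k := i) ⟨e, rfl⟩ (by omega)
        have h1 : D (DirectSum.lof R ℤ X i e') = 0 := by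
          rw [he']
          exact LinearMap.congr_fun hDq _
        change (1 - D * h - h * D) (DirectSum.lof R ℤ X i e)
          - D (h ((1 - D * h - h * D) (DirectSum.lof R ℤ X i e))) = 0
        rw [← he', hker i hi e' h1, sub_self] }

end Algebra

section

variable {R : Type*} [CommRing R] [Algebra ℝ R] {P : Type*}
    [LieRing P] [Module R P] [LieRingModule P R] [LieAlgebra ℝ P]
    [LieRinehartRing R P] [LieRinehartAlgebra ℝ R P]
    {X : ℤ → Type*} [∀ i, AddCommGroup (X i)] [∀ i, Module R (X i)] [∀ i, Module ℝ (X i)]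
    [∀ i, IsScalarTower ℝ R (X i)] (D : Superconnection R P X)

theorem diff_mul_diff (hD : D.IsFlat) : D.diff * D.diff = 0 := by
  have h := DFunLike.congr_fun (hD 0) ![]
  rw [curv_eq] at h
  rw [Pi.add_apply, Pi.add_apply, AlternatingMap.add_apply, AlternatingMap.add_apply] at h
  have h1 : D.conn.curvatureForms 0 ![] = 0 := rfl
  have h2 : D.endConn.dForms D.form 0 ![] = 0 := rfl
  rw [h1, h2, zero_add, zero_add, star_zero_form, eps_zero_form] at h
  exact h

theorem diff_mem : D.diff ∈ endDeg R X 1 := D.form_degree 0 ![]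

end

section Bundles

variable {EM : Type*} [NormedAddCommGroup EM] [NormedSpace ℝ EM] [FiniteDimensional ℝ EM]
  {H : Type*} [TopologicalSpace H] {I : ModelWithCorners ℝ EM H}
  {M : Type*} [TopologicalSpace M] [ChartedSpace H M] [IsManifold I ∞ M]
  [T2Space M] [SigmaCompactSpace M]
  {F : ℤ → Type*} [∀ i, NormedAddCommGroup (F i)] [∀ i, NormedSpace ℝ (F i)]
  [∀ i, FiniteDimensional ℝ (F i)]
  {E : ℤ → M → Type*} [∀ i, TopologicalSpace (TotalSpace (F i) (E i))]
  [∀ i x, TopologicalSpace (E i x)] [∀ i x, AddCommGroup (E i x)] [∀ i x, Module ℝ (E i x)]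
  [∀ i, FiberBundle (F i) (E i)] [∀ i, VectorBundle ℝ (F i) (E i)]
  [∀ i, ContMDiffVectorBundle ∞ (F i) (E i) I]
  {P : Type*} [LieRing P] [Module C^∞⟮I, M; 𝓘(ℝ, ℝ), ℝ⟯ P]
  [LieRingModule P C^∞⟮I, M; 𝓘(ℝ, ℝ), ℝ⟯] [LieAlgebra ℝ P]
  [LieRinehartRing C^∞⟮I, M; 𝓘(ℝ, ℝ), ℝ⟯ P] [LieRinehartAlgebra ℝ C^∞⟮I, M; 𝓘(ℝ, ℝ), ℝ⟯ P]
  (D : Superconnection C^∞⟮I, M; 𝓘(ℝ, ℝ), ℝ⟯ P fun i => Cₛ^∞⟮I; F i, E i⟯)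

theorem fiberRange_stepAt (i : ℤ) (x : M) : fiberRange (stepAt D.diff i) x = D.fiberIm i x := by
  ext v
  constructor
  · rintro ⟨t, rfl⟩
    exact ⟨_, rfl⟩
  · rintro ⟨t, rfl⟩
    refine ⟨DirectSum.component C^∞⟮I, M; 𝓘(ℝ, ℝ), ℝ⟯ ℤ (fun i => Cₛ^∞⟮I; F i, E i⟯) (i - 1) t, ?_⟩
    rw [← component_eq_stepAt D.diff_mem]
    rfl

/-- The complex of a regular resolution has contracting data. -/
theorem IsResolution.exists_contraction (hflat : D.IsFlat) (hreg : D.IsRegular)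
    (hres : D.IsResolution) : Nonempty (Contraction D.diff) := by
  -- Constant rank gives, for each `i`, a generalized inverse of `∂ : E_(i-1) → E_i`; it is a true
  -- right inverse on sections lying pointwise in the image.
  have hψ : ∀ i, ∃ ψ : Cₛ^∞⟮I; F i, E i⟯ →ₗ[C^∞⟮I, M; 𝓘(ℝ, ℝ), ℝ⟯] Cₛ^∞⟮I; F (i - 1), E (i - 1)⟯,
      ∀ (s : Cₛ^∞⟮I; F i, E i⟯), (∀ x, s x ∈ D.fiberIm i x) → stepAt D.diff i (ψ s) = s := by
    intro i
    obtain ⟨r, hr⟩ := hreg i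
    obtain ⟨ψ, hψ⟩ := exists_generalized_inverse (stepAt D.diff i) (r := r) fun x => by
      rw [fiberRange_stepAt, hr]
    refine ⟨ψ, fun s hs => ContMDiffSection.ext fun x => hψ s x ?_⟩
    rw [fiberRange_stepAt]
    exact hs x
  choose ψ hψ using hψ
  let h : Module.End C^∞⟮I, M; 𝓘(ℝ, ℝ), ℝ⟯ (⨁ i, Cₛ^∞⟮I; F i, E i⟯) :=
    DirectSum.toModule _ ℤ _ fun i => DirectSum.lof _ ℤ _ (i - 1) ∘ₗ ψ i
  have hh : ∀ i (e : Cₛ^∞⟮I; F i, E i⟯), h (DirectSum.lof C^∞⟮I, M; 𝓘(ℝ, ℝ), ℝ⟯ ℤ _ i e)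
      = DirectSum.lof C^∞⟮I, M; 𝓘(ℝ, ℝ), ℝ⟯ ℤ (fun i => Cₛ^∞⟮I; F i, E i⟯) (i - 1) (ψ i e) :=
    fun i e => DirectSum.toModule_lof _ _ _
  have hDh : ∀ i (e : Cₛ^∞⟮I; F i, E i⟯), (∀ x, e x ∈ D.fiberIm i x) →
      D.diff (h (DirectSum.lof C^∞⟮I, M; 𝓘(ℝ, ℝ), ℝ⟯ ℤ _ i e))
        = DirectSum.lof C^∞⟮I, M; 𝓘(ℝ, ℝ), ℝ⟯ ℤ (fun i => Cₛ^∞⟮I; F i, E i⟯) i e := by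
    intro i e he
    rw [hh, ← lof_stepAt D.diff_mem, hψ i e he]
  refine ⟨Contraction.ofInverse h D.diff_mem (D.diff_mul_diff hflat) (fun i e => ?_) ?_ ?_⟩
  · rw [hh]
    exact ⟨_, rfl⟩
  · refine DirectSum.linearMap_ext _ fun i => LinearMap.ext fun e => ?_
    obtain ⟨e', he'⟩ := D.diff_mem i e
    change D.diff (h (D.diff (DirectSum.lof C^∞⟮I, M; 𝓘(ℝ, ℝ), ℝ⟯ ℤ (fun i => Cₛ^∞⟮I; F i, E i⟯) i e))) = D.diff (DirectSum.lof C^∞⟮I, M; 𝓘(ℝ, ℝ), ℝ⟯ ℤ (fun i => Cₛ^∞⟮I; F i, E i⟯) i e)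
    rw [← he']
    refine hDh _ e' fun x => ⟨DirectSum.lof C^∞⟮I, M; 𝓘(ℝ, ℝ), ℝ⟯ ℤ (fun i => Cₛ^∞⟮I; F i, E i⟯) i e, ?_⟩
    rw [← he']
    exact congrArg (fun s : Cₛ^∞⟮I; F (i + 1), E (i + 1)⟯ => s x)
      (DirectSum.of_eq_same (β := fun i => Cₛ^∞⟮I; F i, E i⟯) (i + 1) e')
  -- A closed section of nonzero degree lies pointwise in the kernel, hence pointwise in the image
  -- because the complex is exact there.
  · intro i hi e he
    refine hDh i e fun x => hres i hi x ⟨e, ?_, rfl⟩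
    rw [he]
    rfl

end Bundles

end Superconnection

/-! ### Splitting of a Lie pair on sections. -/

section Splitting

variable {EM : Type*} [NormedAddCommGroup EM] [NormedSpace ℝ EM] [FiniteDimensional ℝ EM]
  {H : Type*} [TopologicalSpace H] {I : ModelWithCorners ℝ EM H}
  {M : Type*} [TopologicalSpace M] [ChartedSpace H M] [IsManifold I ∞ M]
  [T2Space M] [SigmaCompactSpace M]
  {FA : Type*} [NormedAddCommGroup FA] [NormedSpace ℝ FA] [FiniteDimensional ℝ FA]
  {A : M → Type*} [TopologicalSpace (TotalSpace FA A)]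
  [∀ x, TopologicalSpace (A x)] [∀ x, AddCommGroup (A x)] [∀ x, Module ℝ (A x)]
  [FiberBundle FA A] [VectorBundle ℝ FA A] [ContMDiffVectorBundle ∞ FA A I]
  [LieAlgebroid I FA A]
  {FL : Type*} [NormedAddCommGroup FL] [NormedSpace ℝ FL] [FiniteDimensional ℝ FL]
  {L : M → Type*} [TopologicalSpace (TotalSpace FL L)]
  [∀ x, TopologicalSpace (L x)] [∀ x, AddCommGroup (L x)] [∀ x, Module ℝ (L x)]
  [FiberBundle FL L] [VectorBundle ℝ FL L] [ContMDiffVectorBundle ∞ FL L I]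
  [LieAlgebroid I FL L]

/-- The inclusion of a Lie pair splits on sections. -/
theorem LiePair.exists_splitting (ι : LiePair I FA A FL L) :
    ∃ r : Cₛ^∞⟮I; FL, L⟯ →ₗ[C^∞⟮I, M; 𝓘(ℝ, ℝ), ℝ⟯] Cₛ^∞⟮I; FA, A⟯, ∀ a, r (ι.toHom a) = a := by
  have hrange : ∀ x, fiberRange ι.toHom.toLin x = LinearMap.range (ι.toFun x) := by
    intro x
    ext v
    constructor
    · rintro ⟨t, rfl⟩
      exact ⟨t x, rfl⟩
    · rintro ⟨a, rfl⟩
      obtain ⟨t, rfl⟩ := exists_section_eq (I := I) (F := FA) x a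
      exact ⟨t, rfl⟩
  -- Fiberwise injectivity makes the rank constant, equal to that of `A`; it also turns the
  -- generalized inverse into a left inverse.
  obtain ⟨r, hr⟩ := exists_generalized_inverse ι.toHom.toLin (r := Module.finrank ℝ FA) fun x => by
    rw [hrange, LinearMap.finrank_range_of_inj (ι.injective x)]
    exact ((trivializationAt FA A x).continuousLinearEquivAt ℝ x
      (mem_baseSet_trivializationAt FA A x)).toLinearEquiv.finrank_eq
  exact ⟨r, fun a => ContMDiffSection.ext fun x => ι.injective x (hr (ι.toHom a) x ⟨a, rfl⟩)⟩

end Splitting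

end LiePairAtiyah
end

open LiePairAtiyah

theorem mainTheorem3
    {EM : Type*} [NormedAddCommGroup EM] [NormedSpace ℝ EM] [FiniteDimensional ℝ EM]
    {H : Type*} [TopologicalSpace H] (I : ModelWithCorners ℝ EM H)
    {M : Type*} [TopologicalSpace M] [ChartedSpace H M] [IsManifold I ∞ M]
    [BoundarylessManifold I M] [T2Space M] [SigmaCompactSpace M]
    {FA : Type*} [NormedAddCommGroup FA] [NormedSpace ℝ FA] [FiniteDimensional ℝ FA]
    {A : M → Type*} [TopologicalSpace (TotalSpace FA A)]
    [∀ x, TopologicalSpace (A x)] [∀ x, AddCommGroup (A x)] [∀ x, Module ℝ (A x)]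
    [FiberBundle FA A] [VectorBundle ℝ FA A] [ContMDiffVectorBundle ∞ FA A I]
    [LieAlgebroid I FA A]
    {FL : Type*} [NormedAddCommGroup FL] [NormedSpace ℝ FL] [FiniteDimensional ℝ FL]
    {L : M → Type*} [TopologicalSpace (TotalSpace FL L)]
    [∀ x, TopologicalSpace (L x)] [∀ x, AddCommGroup (L x)] [∀ x, Module ℝ (L x)]
    [FiberBundle FL L] [VectorBundle ℝ FL L] [ContMDiffVectorBundle ∞ FL L I]
    [LieAlgebroid I FL L]
    (ι : LiePair I FA A FL L)
    {F : ℤ → Type*} [∀ i, NormedAddCommGroup (F i)] [∀ i, NormedSpace ℝ (F i)]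
    [∀ i, FiniteDimensional ℝ (F i)]
    {E : ℤ → M → Type*} [∀ i, TopologicalSpace (TotalSpace (F i) (E i))]
    [∀ i x, TopologicalSpace (E i x)] [∀ i x, AddCommGroup (E i x)] [∀ i x, Module ℝ (E i x)]
    [∀ i, FiberBundle (F i) (E i)] [∀ i, VectorBundle ℝ (F i) (E i)]
    [∀ i, ContMDiffVectorBundle ∞ (F i) (E i) I]
    (hpos : ∀ i, 0 < i → ∀ x, Subsingleton (E i x))
    (hfin : ∃ n : ℕ, ∀ i, i < -(n : ℤ) → ∀ x, Subsingleton (E i x))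
    (DA : Superconnection C^∞⟮I, M; 𝓘(ℝ, ℝ), ℝ⟯ Cₛ^∞⟮I; FA, A⟯
      fun i => Cₛ^∞⟮I; F i, E i⟯)
    (hflat : DA.IsFlat) (hreg : DA.IsRegular) (hres : DA.IsResolution)
    (DL : Superconnection C^∞⟮I, M; 𝓘(ℝ, ℝ), ℝ⟯ Cₛ^∞⟮I; FL, L⟯
      fun i => Cₛ^∞⟮I; F i, E i⟯)
    (hDL : Superconnection.Extends ι.toHom DA DL)
    (nabla : Connection C^∞⟮I, M; 𝓘(ℝ, ℝ), ℝ⟯ Cₛ^∞⟮I; FL, L⟯ (DA.Coh 0))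
    (hnabla : Connection.Extends ι.toHom (DA.connCoh hflat 0) nabla) :
    ∃ (hα : Superconnection.atiyahCocycle hflat hDL ∈
          Superconnection.cocycles ι.toHom DA 1)
      (hat : Connection.atiyahCocycle ι.toHom (DA.connCoh hflat 0) nabla
            (DA.connCoh_curvature hflat 0) hnabla ∈
          (Connection.hatConn ι.toHom (DA.connCoh hflat 0)).cocycles 1),
      (Superconnection.cohomologyClass ι.toHom DA 1 ⟨_, hα⟩ = 0 ↔
        (Connection.hatConn ι.toHom (DA.connCoh hflat 0)).cohomologyClass 1
          ⟨_, hat⟩ = 0) := by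
  exact Superconnection.cohomologyClass_atiyahCocycle_eq_zero_iff ι.exists_splitting
    (hres.exists_contraction DA hflat hreg)
    -- Bundles with trivial fibers have trivial modules of sections, which is the form of
    -- boundedness used algebraically.
    (fun i hi => ⟨fun s t => ContMDiffSection.ext fun x => (hpos i hi x).elim _ _⟩)
    (hfin.imp fun n hn i hi => ⟨fun s t => ContMDiffSection.ext fun x => (hn i hi x).elim _ _⟩)
    hflat hDL hnabla
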